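/- **Setting.** An Orlicz N-function is a continuous even convex $\varphi:\mathbb R\to\mathbb R$, increasing for $x>0$, with $\varphi(0)=0$, $\varphi(x)/x\to0$ as $x\to0$ and $\varphi(x)/x\to\infty$ as $x\to\infty$. Let $\varphi$ be an N-function such that $\lim_{x\to0}\varphi(x)/x^2$ exists in $(0,+\infty]$, let $f$ be its density (the nondecreasing right-continuous $f$ on $[0,\infty)$ with $f(0)=0$, $f(x)\to\infty$ as $x\to\infty$ and $\varphi(u)=\int_0^{|u|}f(v)\,dv$), and let $\varphi^*(x)=\sup_{y}(xy-\varphi(y))$. A real random variable $\xi$ with $\mathbf E\xi=0$ is in $Sub_\varphi(\Omega)$ if for some $a\ge0$, $\mathbf E e^{\lambda\xi}\le e^{\varphi(a\lambda)}$ for all $\lambda\in\mathbb R$; $\tau_\varphi(\xi)$ is the infimum of such $a$. A process $X(t)$, $t\in\mathbb R$, is strictly $Sub_\varphi(\Omega)$ with determinative constant $C_X>0$ if all $X(t)\in Sub_\varphi(\Omega)$, $\sup_t\tau_\varphi(X(t))<\infty$, and $\tau_\varphi(\sum_i\lambda_iX(t_i))\le C_X\bigl(\mathbf E(\sum_i\lambda_iX(t_i))^2\bigr)^{1/2}$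 for all finite real linear combinations. Put $\hat g(y)=\int_{\mathbb R} e^{-iyx}g(x)\,dx$. Let $\phi\in L_2(\mathbb R)$ be an $f$-wavelet: $\hat\phi(0)\ne0$, $\hat\phi$ is continuous at $0$, $\sum_{k\in\mathbb Z}|\hat\phi(y+2\pi k)|^2=1$ a.e., and $\hat\phi(y)=m_0(y/2)\hat\phi(y/2)$ a.e. for some $2\pi$-periodic $m_0\in L_2([0,2\pi])$. Let $\psi$ be the corresponding $m$-wavelet: $\hat\psi(y)=\overline{m_0(y/2+\pi)}\,e^{-iy/2}\,\hat\phi(y/2)$. Assume that $\phi,\psi$ are continuous and that for each $\delta\in\{\phi,\psi\}$ there is a non-increasing $\Phi_\delta:[0,\infty)\to\mathbb R$ with $|\delta(x)|\le\Phi_\delta(|x|)$ a.e. and $\int_{\mathbb R}\Phi_\delta(|x|)\,dx<\infty$. Put $$C_\delta=3\Phi_\delta(0)+4\int_{1/2}^\infty\Phi_\delta(t)\,dt,\qquad C_\delta(S,k)=\int_{k-S-1}^\infty\Phi_\delta(t)\,dt+\int_{k-1}^\infty\Phi_\delta(t)\,dt\quad(k\ge S+1).$$ Let $\phi_{0k}(x)=\phi(x-k)$,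 $\psi_{jk}(x)=2^{j/2}\psi(2^jx-k)$. **Theorem.** Let $X(t)$, $t\in\mathbb R$, be a measurable strictly $Sub_\varphi(\Omega)$ process with determinative constant $C_X$ and continuous covariance function $R(t,s)=\mathbf E X(t)X(s)$. Suppose there are an even function $c$ on $\mathbb R$, non-decreasing on $[0,\infty)$, with $c(0)>1$, a function $A:(0,\infty)\to(0,\infty)$ and $x_0\in\mathbb R$ such that $c(ax)\le c(x)A(a)$ for all $a>0$, $x\ge x_0$, $\int_{\mathbb R}c(x)\Phi_\delta(|x|)\,dx<\infty$ for $\delta=\phi,\psi$, and $|R(t,t)|^{1/2}\le c(t)$ for all $t$. Let $\xi_{0k}=\int_{\mathbb R}X(t)\overline{\phi_{0k}(t)}\,dt$ and $\eta_{jk}=\int_{\mathbb R}X(t)\overline{\psi_{jk}(t)}\,dt$ (mean-square integrals), and for $\mathbf k_n=(k_0',k_0,\dots,k_{n-1})$ let $$X_{n,\mathbf k_n}(t)=\sum_{|k|\le k_0'}\xi_{0k}\phi_{0k}(t)+\sum_{j=0}^{n-1}\sum_{|k|\le k_j}\eta_{jk}\psi_{jk}(t).$$ Let $T>0$, $p\ge1$,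 $\int_0^T(\mathbf E X(t)^2)^{p/2}dt<\infty$, and assume $$\sup_{k\in\mathbb Z}(\mathbf E|\xi_{0k}|^2)^{1/2}\,C_\phi+\sum_{j=0}^\infty\sup_{k\in\mathbb Z}(\mathbf E|\eta_{jk}|^2)^{1/2}\,2^{j/2}C_\psi<\infty .$$ Then $X$ and all $X_{n,\mathbf k_n}$ have almost all trajectories in $L_p([0,T])$, and $X_{n,\mathbf k_n}\to X$ in $L_p([0,T])$ in probability when $\mathbf k_n\to\infty$: if $n\to\infty$, $k_0'=k_0'(n)\to\infty$ and $k_j=k_j(n)\to\infty$ for every $j$, then $\mathbf P\{(\int_0^T|X_{n,\mathbf k_n}(t)-X(t)|^pdt)^{1/p}>\varepsilon\}\to0$ for every $\varepsilon>0$. Furthermore, let $k_0'\ge T+1$, $J=\min\{n,\min\{j\ge 0: k_j<2^jT+1\}\}$ and $$c_n^\infty=C_X^p\,T\Bigl(\sup_k(\mathbf E|\xi_{0k}|^2)^{1/2}C_\phi(T,k_0')+\sum_{j=0}^{J-1}\sup_k(\mathbf E|\eta_{jk}|^2)^{1/2}2^{j/2}C_\psi(2^jT,k_j)+\sum_{j=J}^\infty\sup_k(\mathbf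 E|\eta_{jk}|^2)^{1/2}2^{j/2}C_\psi\Bigr)^p.$$ Then for every $\varepsilon>0$ with $\varepsilon>c_n^\infty\bigl(f(p\,(c_n^\infty/\varepsilon)^{1/p})\bigr)^p$, $$\mathbf P\Bigl\{\int_0^T|X_{n,\mathbf k_n}(t)-X(t)|^p\,dt>\varepsilon\Bigr\}\le2\exp\bigl\{-\varphi^*\bigl((\varepsilon/c_n^\infty)^{1/p}\bigr)\bigr\},$$ where the right-hand side is read as $0$ if $c_n^\infty=0$. -/

import Mathlib

open MeasureTheory Filter Topology
open scoped ENNReal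

noncomputable section

namespace SubGaussWavelet

/-! ### Orlicz N-functions -/

/-- Orlicz N-functions: continuous, even, convex, `φ 0 = 0`, increasing for `x > 0`,
`φ x / x → 0` as `x → 0` and `φ x / x → ∞` as `x → ∞`. -/
structure IsNFunction (φ : ℝ → ℝ) : Prop where
  continuous : Continuous φ
  even : ∀ x, φ (-x) = φ x
  convex : ConvexOn ℝ Set.univ φ
  strictMono : StrictMonoOn φ (Set.Ioi 0)
  zero : φ 0 = 0
  div_tendsto_zero : Tendsto (fun x => φ x / x) (𝓝[≠] 0) (𝓝 0)
  div_tendsto_atTop : Tendsto (fun x => φ x / x) atTop atTop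

/-- Assumption Q: `φ` is an N-function and `φ x / x ^ 2` has a limit in `(0, ∞]` as `x → 0`. -/
def AssumptionQ (φ : ℝ → ℝ) : Prop :=
  IsNFunction φ ∧ ∃ c : ℝ≥0∞, 0 < c ∧
    Tendsto (fun x => ENNReal.ofReal (φ x / x ^ 2)) (𝓝[≠] 0) (𝓝 c)

/-- `f` (only its values on `[0, ∞)` matter) is the density of the N-function `φ`. -/
structure IsDensity (φ f : ℝ → ℝ) : Prop where
  monotoneOn : MonotoneOn f (Set.Ici 0)
  rightContinuous : ∀ x, 0 ≤ x → ContinuousWithinAt f (Set.Ici x) x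
  zero : f 0 = 0
  tendsto_atTop : Tendsto f atTop atTop
  integral_eq : ∀ u, φ u = ∫ v in (0 : ℝ)..|u|, f v

/-- The Young–Fenchel transform. -/
def youngFenchel (φ : ℝ → ℝ) (x : ℝ) : ℝ := ⨆ y : ℝ, (x * y - φ y)

/-! ### φ-sub-Gaussian random variables and processes -/

section Sub

variable {Ω : Type*} [MeasurableSpace Ω]

/-- `E exp(l ξ) ≤ exp(φ(a l))` for all real `l` (expectation taken in `[0, ∞]`). -/
def ExpMomentBound (φ : ℝ → ℝ) (P : Measure Ω) (ξ : Ω → ℝ) (a : ℝ) : Prop :=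
  ∀ l : ℝ, ∫⁻ ω, ENNReal.ofReal (Real.exp (l * ξ ω)) ∂P ≤ ENNReal.ofReal (Real.exp (φ (a * l)))

/-- The zero-mean random variable `ξ` belongs to `Sub_φ(Ω)`. -/
def IsSub (φ : ℝ → ℝ) (P : Measure Ω) (ξ : Ω → ℝ) : Prop :=
  Integrable ξ P ∧ ∫ ω, ξ ω ∂P = 0 ∧ ∃ r : ℝ, 0 ≤ r ∧ ExpMomentBound φ P ξ r

/-- The norm `τ_φ`. -/
def subNorm (φ : ℝ → ℝ) (P : Measure Ω) (ξ : Ω → ℝ) : ℝ :=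
  sInf {a : ℝ | 0 ≤ a ∧ ExpMomentBound φ P ξ a}

/-- The process `X` belongs to `Sub_φ(Ω)`. -/
def IsSubProcess {ι : Type*} (φ : ℝ → ℝ) (P : Measure Ω) (X : ι → Ω → ℝ) : Prop :=
  (∀ t, IsSub φ P (X t)) ∧ BddAbove (Set.range fun t => subNorm φ P (X t))

/-- `X` is a strictly `Sub_φ(Ω)` process with determinative constant `C`. -/
def IsStrictlySub {ι : Type*} (φ : ℝ → ℝ) (P : Measure Ω) (X : ι → Ω → ℝ) (C : ℝ) : Prop :=
  IsSubProcess φ P X ∧ 0 < C ∧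
    ∀ (s : Finset ι) (a : ι → ℝ),
      subNorm φ P (fun ω => ∑ i ∈ s, a i * X i ω) ≤
        C * Real.sqrt (∫ ω, (∑ i ∈ s, a i * X i ω) ^ 2 ∂P)

/-- The covariance function of a centred real process. -/
def cov (P : Measure Ω) (X : ℝ → Ω → ℝ) (t s : ℝ) : ℝ := ∫ ω, X t ω * X s ω ∂P

end Sub

/-! ### Wavelets -/

/-- `ĝ(y) = ∫ e^{-iyx} g(x) dx`. All functions to which this is applied below satisfy
Assumption S, hence are integrable. -/
def fourier (g : ℝ → ℂ) (y : ℝ) : ℂ := ∫ x : ℝ, Complex.exp (-(Complex.I * y * x)) * g x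

/-- `fw` is an f-wavelet with associated `2π`-periodic function `m₀`. -/
structure IsFWavelet (fw m₀ : ℝ → ℂ) : Prop where
  memLp : MemLp fw 2 volume
  fourier_zero : fourier fw 0 ≠ 0
  continuousAt : ContinuousAt (fourier fw) 0
  sum_eq_one : ∀ᵐ y : ℝ, HasSum (fun k : ℤ => ‖fourier fw (y + 2 * Real.pi * k)‖ ^ 2) 1
  mask_memLp : MemLp m₀ 2 (volume.restrict (Set.Icc 0 (2 * Real.pi)))
  mask_periodic : Function.Periodic m₀ (2 * Real.pi)
  refinement : ∀ᵐ y : ℝ, fourier fw y = m₀ (y / 2) * fourier fw (y / 2)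

/-- `mw` is the m-wavelet of the f-wavelet `fw`: it is the inverse Fourier transform of
`conj (m₀ (y/2 + π)) e^{-iy/2} f̂w(y/2)`, i.e. this function is its Fourier transform. -/
def IsMWavelet (fw m₀ mw : ℝ → ℂ) : Prop :=
  Integrable mw volume ∧
  ∀ᵐ y : ℝ, fourier mw y =
    starRingEnd ℂ (m₀ (y / 2 + Real.pi)) * Complex.exp (-(Complex.I * (y / 2))) *
      fourier fw (y / 2)

/-- `g_{jk}(x) = 2^{j/2} g(2^j x - k)`. -/
def dilate (g : ℝ → ℂ) (j : ℕ) (k : ℤ) (x : ℝ) : ℂ :=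
  (((2 : ℝ) ^ ((j : ℝ) / 2) : ℝ) : ℂ) * g (2 ^ j * x - k)

/-- Assumption S for `g` with majorant `Φ` (only the values of `Φ` on `[0, ∞)` matter). -/
structure AssumptionS (g : ℝ → ℂ) (Φ : ℝ → ℝ) : Prop where
  antitoneOn : AntitoneOn Φ (Set.Ici 0)
  bound : ∀ᵐ x : ℝ, ‖g x‖ ≤ Φ |x|
  integrable : Integrable (fun x : ℝ => Φ |x|) volume

/-- `C_δ = 3 Φ(0) + 4 ∫_{1/2}^∞ Φ`. -/
def constC (Φ : ℝ → ℝ) : ℝ := 3 * Φ 0 + 4 * ∫ t in Set.Ioi (1 / 2 : ℝ), Φ t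

/-- `C_δ(T, k) = ∫_{k-T-1}^∞ Φ + ∫_{k-1}^∞ Φ`, meaningful for `k ≥ T + 1`. -/
def tailC (Φ : ℝ → ℝ) (T : ℝ) (k : ℕ) : ℝ :=
  (∫ t in Set.Ioi ((k : ℝ) - T - 1), Φ t) + ∫ t in Set.Ioi ((k : ℝ) - 1), Φ t

/-! ### Wavelet coefficients and approximants -/

section Expansion

variable {Ω : Type*} [MeasurableSpace Ω]

open Classical in
/-- The class in complex `L_2(Ω)` of a real square-integrable random variable. -/
def toL2 (P : Measure Ω) (ξ : Ω → ℝ) : Lp ℂ 2 P :=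
  if h : MemLp (fun ω => (ξ ω : ℂ)) 2 P then h.toLp else 0

/-- The mean-square integral `∫ X(t) conj(g(t)) dt`: the integral, in the Hilbert space
`L_2(Ω)`, of the `L_2(Ω)`-valued function `t ↦ conj(g(t)) X(t)`. -/
def coeff (P : Measure Ω) (X : ℝ → Ω → ℝ) (g : ℝ → ℂ) : Lp ℂ 2 P :=
  ∫ t : ℝ, starRingEnd ℂ (g t) • toL2 P (X t)

/-- `ξ_{0k}`. -/
def xi (P : Measure Ω) (X : ℝ → Ω → ℝ) (fw : ℝ → ℂ) (k : ℤ) : Lp ℂ 2 P :=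
  coeff P X (dilate fw 0 k)

/-- `η_{jk}`. -/
def eta (P : Measure Ω) (X : ℝ → Ω → ℝ) (mw : ℝ → ℂ) (j : ℕ) (k : ℤ) : Lp ℂ 2 P :=
  coeff P X (dilate mw j k)

/-- The approximant `X_{n, k_n}(t)`, where `k_n = (k0, k 0, …, k (n-1))`. -/
def approx (P : Measure Ω) (X : ℝ → Ω → ℝ) (fw mw : ℝ → ℂ) (n k0 : ℕ) (k : ℕ → ℕ)
    (t : ℝ) (ω : Ω) : ℂ :=
  (∑ i ∈ Finset.Icc (-(k0 : ℤ)) (k0 : ℤ), xi P X fw i ω * dilate fw 0 i t) +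
    ∑ j ∈ Finset.range n, ∑ i ∈ Finset.Icc (-(k j : ℤ)) (k j : ℤ),
      eta P X mw j i ω * dilate mw j i t

/-- `sup_k (E|ξ_{0k}|²)^{1/2}`. -/
def supXi (P : Measure Ω) (X : ℝ → Ω → ℝ) (fw : ℝ → ℂ) : ℝ≥0∞ :=
  ⨆ k : ℤ, eLpNorm (xi P X fw k) 2 P

/-- `sup_k (E|η_{jk}|²)^{1/2}`. -/
def supEta (P : Measure Ω) (X : ℝ → Ω → ℝ) (mw : ℝ → ℂ) (j : ℕ) : ℝ≥0∞ :=
  ⨆ k : ℤ, eLpNorm (eta P X mw j k) 2 P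

/-- `J = min{n, min{j : k_j < 2^j T + 1}}` (only `k_0, …, k_{n-1}` matter). -/
def levelJ (T : ℝ) (n : ℕ) (k : ℕ → ℕ) : ℕ :=
  sInf {j : ℕ | j = n ∨ (k j : ℝ) < 2 ^ j * T + 1}

/-- The constant `c_n^∞`. -/
def cInfty (P : Measure Ω) (X : ℝ → Ω → ℝ) (fw mw : ℝ → ℂ) (Φf Φm : ℝ → ℝ)
    (CX p T : ℝ) (n k0 : ℕ) (k : ℕ → ℕ) : ℝ :=
  CX ^ p * T *
    (supXi P X fw * ENNReal.ofReal (tailC Φf T k0)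
      + ∑ j ∈ Finset.range (levelJ T n k),
          supEta P X mw j *
            ENNReal.ofReal ((2 : ℝ) ^ ((j : ℝ) / 2) * tailC Φm (2 ^ j * T) (k j))
      + ∑' j : {j : ℕ // levelJ T n k ≤ j},
          supEta P X mw j * ENNReal.ofReal ((2 : ℝ) ^ ((j : ℝ) / 2) * constC Φm)).toReal ^ p

/-- `∫_0^T |X_{n,k_n}(t) - X(t)|^p dt`, for the trajectory `ω`, with values in `[0, ∞]`. -/
def lpError (P : Measure Ω) (X : ℝ → Ω → ℝ) (fw mw : ℝ → ℂ) (p T : ℝ)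
    (n k0 : ℕ) (k : ℕ → ℕ) (ω : Ω) : ℝ≥0∞ :=
  ∫⁻ t in Set.Icc 0 T, ‖approx P X fw mw n k0 k t ω - (X t ω : ℂ)‖ₑ ^ p

/-- The process `Y` belongs to `L_p([0,T])`. -/
def InLp (P : Measure Ω) (Y : ℝ → Ω → ℂ) (p T : ℝ) : Prop :=
  ∀ᵐ ω ∂P, MemLp (fun t => Y t ω) (ENNReal.ofReal p) (volume.restrict (Set.Icc 0 T))

end Expansion

end SubGaussWavelet

end

/-!
The family `2^j K(2^j t, 2^j s)` built from the reproducing kernel `K` of the integer translates of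
`φ` is an approximate identity, because `∫ K(t, s) ds = 1` almost everywhere by the partition of
unity. Mallat's identity for the conjugate mirror filter splits the kernel at level `j + 1` into
the kernel at level `j` and the wavelet terms of level `j`. Hence `X(t)`, a continuous
`L_2(Ω)`-valued function of growth `c`, is the telescoping limit of its expansion, and the
mean-square error of a truncation is bounded by the tails of `∑ₖ |δ(x - k)|`.

The error lies in the closed span of `X` in `L_2(Ω)`, where Fatou's lemma extends the strict
sub-Gaussian inequality from finite combinations: if `σ` is its mean-square norm, then
`E cosh(l |error|) ≤ exp(φ(C_X σ l))`. This bounds the `s`-th moments for every `s ≥ p`, Minkowski's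
and Markov's inequalities turn these into a deviation bound for the `L_p` error, and optimizing
over `s` produces the Young–Fenchel transform `φ*`; the condition on `ε` puts the optimal `s` above
`p`.
-/

open scoped FourierTransform ComplexConjugate

namespace SubGaussWavelet

theorem tendsto_tailC (Φ : ℝ → ℝ) (S : ℝ) : Tendsto (fun K : ℕ => tailC Φ S K) atTop (𝓝 0) := by
  have hK (b : ℝ) : Tendsto (fun K : ℕ => (K : ℝ) - b) atTop atTop :=
    tendsto_atTop_add_const_right _ (-b) tendsto_natCast_atTop_atTop
  simpa only [tailC, sub_sub, add_zero] using
    (tendsto_integral_Ioi_zero (f := Φ) (hK (S + 1))).add (tendsto_integral_Ioi_zero (hK 1))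

namespace AssumptionS

variable {g : ℝ → ℂ} {Φ : ℝ → ℝ}

theorem majorant_nonneg (hS : AssumptionS g Φ) {x : ℝ} (hx : 0 ≤ x) : 0 ≤ Φ x := by
  obtain ⟨y, hxy, hy⟩ := (Measure.dense_of_ae hS.bound).exists_mem_open isOpen_Ioi
    (Set.nonempty_Ioi (a := x))
  have hy0 : 0 ≤ y := hx.trans hy.le
  calc 0 ≤ ‖g y‖ := norm_nonneg _
    _ ≤ Φ y := by simpa only [Set.mem_ofPred_eq, abs_of_nonneg hy0] using hxy
    _ ≤ Φ x := hS.antitoneOn hx hy0 hy.le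

theorem norm_le (hS : AssumptionS g Φ) (hg : Continuous g) (x : ℝ) : ‖g x‖ ≤ Φ |x| := by
  have approach {V : Set ℝ} (hV : IsOpen V) (hxV : x ∈ closure V) (hle : ∀ y ∈ V, |x| ≤ |y|) :
      ‖g x‖ ≤ Φ |x| := by
    have hsub : V ∩ {y | ‖g y‖ ≤ Φ |y|} ⊆ {y | ‖g y‖ ≤ Φ |x|} := fun y hy =>
      hy.2.trans (hS.antitoneOn (abs_nonneg x) (abs_nonneg y) (hle y hy.1))
    have hcl : IsClosed {y | ‖g y‖ ≤ Φ |x|} := isClosed_le hg.norm continuous_const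
    have hdense := (Measure.dense_of_ae hS.bound).open_subset_closure_inter hV
    exact closure_minimal hsub hcl (closure_minimal hdense isClosed_closure hxV)
  rcases le_total 0 x with hx | hx
  · exact approach (isOpen_Ioi (a := x)) (by simp) fun y hy => abs_le_abs_of_nonneg hx hy.le
  · exact approach (isOpen_Iio (a := x)) (by simp) fun y hy => abs_le_abs_of_nonpos hx hy.le

theorem norm_le_majorant_zero (hS : AssumptionS g Φ) (hg : Continuous g) (x : ℝ) : ‖g x‖ ≤ Φ 0 :=
  (hS.norm_le hg x).trans (hS.antitoneOn Set.self_mem_Ici (abs_nonneg x) (abs_nonneg x))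

theorem integrable_self (hS : AssumptionS g Φ) (hg : Continuous g) : Integrable g :=
  hS.integrable.mono' hg.aestronglyMeasurable hS.bound

theorem integrableOn_Ioi (hS : AssumptionS g Φ) {a : ℝ} (ha : 0 ≤ a) :
    IntegrableOn Φ (Set.Ioi a) :=
  (hS.integrable.integrableOn (s := Set.Ioi a)).congr_fun
    (fun x hx => by simp only [abs_of_nonneg (ha.trans (le_of_lt hx))]) measurableSet_Ioi

theorem setIntegral_Ioi_nonneg (hS : AssumptionS g Φ) {a : ℝ} (ha : 0 ≤ a) :
    0 ≤ ∫ t in Set.Ioi a, Φ t :=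
  setIntegral_nonneg measurableSet_Ioi fun _ hx => hS.majorant_nonneg (ha.trans (le_of_lt hx))

theorem setIntegral_Ioi_anti (hS : AssumptionS g Φ) {a b : ℝ} (ha : 0 ≤ a) (hab : a ≤ b) :
    ∫ t in Set.Ioi b, Φ t ≤ ∫ t in Set.Ioi a, Φ t :=
  setIntegral_mono_set (hS.integrableOn_Ioi ha)
    (ae_restrict_of_forall_mem measurableSet_Ioi fun _ hx =>
      hS.majorant_nonneg (ha.trans (le_of_lt hx))) (Set.Ioi_subset_Ioi hab).eventuallyLE

theorem constC_nonneg (hS : AssumptionS g Φ) : 0 ≤ constC Φ := by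
  have hΦ := hS.majorant_nonneg le_rfl
  have hI := hS.setIntegral_Ioi_nonneg (a := 1 / 2) (by norm_num)
  unfold constC
  positivity

theorem setIntegral_Ioi_zero_le (hS : AssumptionS g Φ) :
    ∫ t in Set.Ioi (0 : ℝ), Φ t ≤ Φ 0 / 2 + ∫ t in Set.Ioi (1 / 2 : ℝ), Φ t := by
  have hI := hS.integrableOn_Ioi le_rfl
  rw [← intervalIntegral.integral_interval_add_Ioi hI (hS.integrableOn_Ioi one_half_pos.le),
    intervalIntegral.integral_of_le (by norm_num : (0 : ℝ) ≤ 1 / 2)]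
  gcongr
  calc ∫ t in Set.Ioc (0 : ℝ) (1 / 2), Φ t ≤ ∫ _ in Set.Ioc (0 : ℝ) (1 / 2), Φ 0 :=
        setIntegral_mono_on (hI.mono_set fun _ hx => hx.1) (by simp) measurableSet_Ioc
          fun _ hx => hS.antitoneOn Set.self_mem_Ici hx.1.le hx.1.le
    _ = Φ 0 / 2 := by simp; ring

/-- Each point is charged to the unit interval to its left. -/
theorem tsum_ofReal_le_setIntegral (hS : AssumptionS g Φ) {a : ℝ} (ha : 0 ≤ a) {u : ℕ → ℝ}
    (hu : ∀ m : ℕ, a + (m + 1) ≤ u m) :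
    ∑' m, ENNReal.ofReal (Φ (u m)) ≤ ENNReal.ofReal (∫ t in Set.Ioi a, Φ t) := by
  have hpos : ∀ m : ℕ, 0 ≤ a + (m + 1) := fun m => by positivity
  refine ENNReal.tsum_le_of_sum_range_le fun n => ?_
  rw [← ENNReal.ofReal_sum_of_nonneg fun m _ => hS.majorant_nonneg ((hpos m).trans (hu m))]
  refine ENNReal.ofReal_le_ofReal ?_
  calc ∑ m ∈ Finset.range n, Φ (u m) ≤ ∑ m ∈ Finset.range n, Φ (a + (m + 1 : ℕ)) := by
        refine Finset.sum_le_sum fun m _ => ?_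
        push_cast
        exact hS.antitoneOn (hpos m) ((hpos m).trans (hu m)) (hu m)
    _ ≤ ∫ t in a..a + n, Φ t :=
        (hS.antitoneOn.mono fun _ hx => ha.trans hx.1).sum_le_integral
    _ ≤ ∫ t in Set.Ioi a, Φ t := by
        rw [intervalIntegral.integral_of_le (by simp)]
        exact setIntegral_mono_set (hS.integrableOn_Ioi ha)
          (ae_restrict_of_forall_mem measurableSet_Ioi fun _ hx =>
            hS.majorant_nonneg (ha.trans (le_of_lt hx))) Set.Ioc_subset_Ioi_self.eventuallyLE

theorem ofReal_majorant_anti (hS : AssumptionS g Φ) {u v : ℝ} (hu : 0 ≤ u) (huv : u ≤ v) :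
    ENNReal.ofReal (Φ v) ≤ ENNReal.ofReal (Φ u) :=
  ENNReal.ofReal_le_ofReal (hS.antitoneOn hu (hu.trans huv) huv)

theorem tsum_majorant_fract_le (hS : AssumptionS g Φ) {y : ℝ} (hy0 : 0 ≤ y) (hy1 : y < 1) :
    ∑' k : ℤ, ENNReal.ofReal (Φ |y - k|) ≤ ENNReal.ofReal (constC Φ) := by
  have hneg : ∑' n : ℕ, ENNReal.ofReal (Φ |y - ((-((n : ℤ) + 1) : ℤ) : ℝ)|) ≤
      ENNReal.ofReal (∫ t in Set.Ioi (0 : ℝ), Φ t) :=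
    hS.tsum_ofReal_le_setIntegral le_rfl fun n => by
      push_cast
      linarith [le_abs_self (y - (-(n + 1)))]
  have hpos : ∑' n : ℕ, ENNReal.ofReal (Φ |y - ((n : ℤ) : ℝ)|) ≤
      ENNReal.ofReal (Φ 0) + (ENNReal.ofReal (Φ 0) +
        ENNReal.ofReal (∫ t in Set.Ioi (0 : ℝ), Φ t)) := by
    rw [tsum_eq_zero_add' ENNReal.summable, tsum_eq_zero_add' ENNReal.summable]
    refine add_le_add ?_ (add_le_add ?_ ?_)
    · exact hS.ofReal_majorant_anti le_rfl (abs_nonneg _)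
    · exact hS.ofReal_majorant_anti le_rfl (abs_nonneg _)
    · refine hS.tsum_ofReal_le_setIntegral le_rfl fun n => ?_
      push_cast
      linarith [neg_le_abs (y - (n + 1 + 1))]
  have hΦ := hS.majorant_nonneg le_rfl
  have hI := hS.setIntegral_Ioi_nonneg le_rfl
  calc ∑' k : ℤ, ENNReal.ofReal (Φ |y - k|)
      ≤ ENNReal.ofReal (Φ 0) + (ENNReal.ofReal (Φ 0) +
          ENNReal.ofReal (∫ t in Set.Ioi (0 : ℝ), Φ t)) +
          ENNReal.ofReal (∫ t in Set.Ioi (0 : ℝ), Φ t) := by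
        rw [tsum_of_nat_of_neg_add_one ENNReal.summable ENNReal.summable]
        gcongr
    _ = ENNReal.ofReal (2 * Φ 0 + 2 * ∫ t in Set.Ioi (0 : ℝ), Φ t) := by
        rw [← ENNReal.ofReal_add hΦ hI, ← ENNReal.ofReal_add hΦ (by positivity),
          ← ENNReal.ofReal_add (by positivity) hI]
        ring_nf
    _ ≤ ENNReal.ofReal (constC Φ) := by
        refine ENNReal.ofReal_le_ofReal ?_
        have hI0 := hS.setIntegral_Ioi_zero_le
        have hI2 := hS.setIntegral_Ioi_nonneg (a := 1 / 2) (by norm_num)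
        unfold constC
        linarith

theorem tsum_majorant_le (hS : AssumptionS g Φ) (x : ℝ) :
    ∑' k : ℤ, ENNReal.ofReal (Φ |x - k|) ≤ ENNReal.ofReal (constC Φ) := by
  convert hS.tsum_majorant_fract_le (Int.fract_nonneg x) (Int.fract_lt_one x) using 1
  rw [← (Equiv.addRight ⌊x⌋).tsum_eq]
  congr 1 with k
  simp only [Equiv.coe_addRight, Int.cast_add, Int.fract]
  ring_nf

theorem enorm_le (hS : AssumptionS g Φ) (hg : Continuous g) (x : ℝ) :
    ‖g x‖ₑ ≤ ENNReal.ofReal (Φ |x|) := by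
  rw [← ofReal_norm]
  exact ENNReal.ofReal_le_ofReal (hS.norm_le hg x)

theorem tsum_enorm_le (hS : AssumptionS g Φ) (hg : Continuous g) (x : ℝ) :
    ∑' k : ℤ, ‖g (x - k)‖ₑ ≤ ENNReal.ofReal (constC Φ) :=
  (ENNReal.tsum_le_tsum fun _ => hS.enorm_le hg _).trans (hS.tsum_majorant_le x)

theorem summable_norm (hS : AssumptionS g Φ) (hg : Continuous g) (x : ℝ) :
    Summable fun k : ℤ => ‖g (x - k)‖ := by
  have hfin := (hS.tsum_enorm_le hg x).trans_lt ENNReal.ofReal_lt_top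
  simpa only [toReal_enorm] using ENNReal.summable_toReal hfin.ne

/-- For `x ∈ [0, S]`, the translates by `k > K` are charged to `[K - S - 1, ∞)` and those by
`k < -K` to `[K - 1, ∞)`. -/
theorem tsum_tail_enorm_le (hS : AssumptionS g Φ) (hg : Continuous g) {x S : ℝ} (hx0 : 0 ≤ x)
    (hxS : x ≤ S) {K : ℕ} (hK : S + 1 ≤ K) :
    ∑' k : ℤ, (if k ∈ Finset.Icc (-(K : ℤ)) K then 0 else ‖g (x - k)‖ₑ) ≤
      ENNReal.ofReal (tailC Φ S K) := by
  set F : ℤ → ℝ≥0∞ := fun k => if k ∈ Finset.Icc (-(K : ℤ)) K then 0 else ‖g (x - k)‖ₑ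
  have hF0 : ∀ k ∈ Finset.Icc (-(K : ℤ)) K, F k = 0 := fun k hk => if_pos hk
  have hF : ∀ k, F k ≤ ENNReal.ofReal (Φ |x - k|) := fun k => by
    simp only [F]
    split_ifs
    exacts [zero_le, hS.enorm_le hg _]
  have tsum_eq_tsum_shift {G : ℕ → ℝ≥0∞} {N : ℕ} (hG : ∀ n < N, G n = 0) :
      ∑' n, G n = ∑' n, G (n + N) := by
    rw [← ENNReal.summable.sum_add_tsum_nat_add' (k := N),
      Finset.sum_eq_zero (fun i hi => hG i (Finset.mem_range.1 hi)), zero_add]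
  rw [tsum_of_nat_of_neg_add_one ENNReal.summable ENNReal.summable, tailC,
    ENNReal.ofReal_add (hS.setIntegral_Ioi_nonneg (by linarith))
      (hS.setIntegral_Ioi_nonneg (by linarith))]
  gcongr
  · rw [tsum_eq_tsum_shift (N := K) fun n hn => hF0 _ (by rw [Finset.mem_Icc]; omega)]
    refine (ENNReal.tsum_le_tsum fun n => hF _).trans
      (hS.tsum_ofReal_le_setIntegral (by linarith) fun n => ?_)
    push_cast
    linarith [neg_le_abs (x - (n + K))]
  · rw [tsum_eq_tsum_shift (N := K) fun n hn => hF0 _ (by rw [Finset.mem_Icc]; omega)]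
    refine (ENNReal.tsum_le_tsum fun n => hF _).trans
      (hS.tsum_ofReal_le_setIntegral (by linarith) fun n => ?_)
    push_cast
    linarith [le_abs_self (x - -(n + K + 1))]

/-- One of the two arguments is at distance at least `|x - y| / 2` from `k`. -/
theorem enorm_mul_enorm_le (hS : AssumptionS g Φ) (hg : Continuous g) (x y k : ℝ) :
    ‖g (x - k)‖ₑ * ‖g (y - k)‖ₑ ≤
      ENNReal.ofReal (Φ (|x - y| / 2)) * (‖g (x - k)‖ₑ + ‖g (y - k)‖ₑ) := by
  have far {z : ℝ} (hz : |x - y| / 2 ≤ |z|) : ‖g z‖ₑ ≤ ENNReal.ofReal (Φ (|x - y| / 2)) :=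
    (hS.enorm_le hg z).trans (hS.ofReal_majorant_anti (by positivity) hz)
  have htri : |x - y| ≤ |x - k| + |y - k| := by
    simpa only [sub_sub_sub_cancel_right] using abs_sub (x - k) (y - k)
  rcases le_total (|x - y| / 2) |x - k| with hx | hx
  · exact mul_le_mul' (far hx) le_add_self
  · rw [mul_comm]
    exact mul_le_mul' (far (by linarith)) le_self_add

theorem tsum_enorm_mul_enorm_le (hS : AssumptionS g Φ) (hg : Continuous g) (x y : ℝ) :
    ∑' k : ℤ, ‖g (x - k)‖ₑ * ‖g (y - k)‖ₑ ≤
      ENNReal.ofReal (2 * constC Φ * Φ (|x - y| / 2)) := by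
  calc ∑' k : ℤ, ‖g (x - k)‖ₑ * ‖g (y - k)‖ₑ
      ≤ ENNReal.ofReal (Φ (|x - y| / 2)) * (∑' k : ℤ, ‖g (x - k)‖ₑ + ∑' k : ℤ, ‖g (y - k)‖ₑ) := by
        rw [← ENNReal.tsum_add, ← ENNReal.tsum_mul_left]
        exact ENNReal.tsum_le_tsum fun k => hS.enorm_mul_enorm_le hg x y k
    _ ≤ ENNReal.ofReal (Φ (|x - y| / 2)) *
          (ENNReal.ofReal (constC Φ) + ENNReal.ofReal (constC Φ)) := by
        gcongr <;> exact hS.tsum_enorm_le hg _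
    _ = ENNReal.ofReal (2 * constC Φ * Φ (|x - y| / 2)) := by
        rw [← ENNReal.ofReal_add hS.constC_nonneg hS.constC_nonneg,
          ← ENNReal.ofReal_mul (hS.majorant_nonneg (by positivity))]
        ring_nf

end AssumptionS

/-! ### Fourier transforms: correlations and periodization -/

theorem fourier_two_pi_mul (g : ℝ → ℂ) (w : ℝ) : fourier g (2 * Real.pi * w) = 𝓕 g w := by
  rw [Real.fourier_real_eq_integral_exp_smul, fourier]
  congr 1 with x
  rw [smul_eq_mul]
  congr 2
  push_cast
  ring

theorem continuous_fourierTransform {g : ℝ → ℂ} (hg : Integrable g) : Continuous (𝓕 g) :=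
  VectorFourier.fourierIntegral_continuous Real.continuous_fourierChar (by fun_prop) hg

theorem conj_fourierChar (x : ℝ) : conj (𝐞 x : ℂ) = 𝐞 (-x) := by
  rw [AddChar.map_neg_eq_inv, Circle.coe_inv_eq_conj]

theorem fourierChar_intCast_mul_add (k : ℤ) (w : ℝ) (n : ℤ) : 𝐞 (k * (w + n)) = 𝐞 (k * w) := by
  have hn : 𝐞 (k * n : ℝ) = 1 := by
    ext
    rw [Real.fourierChar_apply, Circle.coe_one, ← Complex.exp_int_mul_two_pi_mul_I (k * n)]
    congr 1
    push_cast
    ring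
  rw [mul_add, AddChar.map_add_eq_mul, hn, mul_one]

theorem integral_fourierChar_intCast_mul (k : ℤ) :
    ∫ w in (0 : ℝ)..1, (𝐞 (k * w) : ℂ) = if k = 0 then 1 else 0 := by
  split_ifs with hk
  · simp [hk]
  · have hc : (2 * Real.pi * Complex.I * k : ℂ) ≠ 0 := by simp [hk, Real.pi_ne_zero]
    have hexp (w : ℝ) : (𝐞 (k * w) : ℂ) = Complex.exp (2 * Real.pi * Complex.I * k * w) := by
      rw [Real.fourierChar_apply]
      congr 1
      push_cast
      ring
    simp_rw [hexp]
    rw [integral_exp_mul_complex hc, Complex.ofReal_one, Complex.ofReal_zero, mul_one, mul_zero,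
      Complex.exp_zero, mul_comm _ (k : ℂ), Complex.exp_int_mul_two_pi_mul_I, sub_self, zero_div]

theorem ae_comp_mul_left {p : ℝ → Prop} (h : ∀ᵐ y : ℝ, p y) {r : ℝ} (hr : r ≠ 0) :
    ∀ᵐ w : ℝ, p (r * w) :=
  (Measure.quasiMeasurePreserving_smul volume hr).ae h

theorem ae_comp_add_right {p : ℝ → Prop} (h : ∀ᵐ y : ℝ, p y) (r : ℝ) : ∀ᵐ w : ℝ, p (w + r) :=
  (measurePreserving_add_right volume r).quasiMeasurePreserving.ae h

theorem ae_of_ae_restrict_Ioc_zero_one {p : ℝ → Prop} (hper : ∀ (w : ℝ) (n : ℤ), p (w + n) → p w)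
    (h : ∀ᵐ w ∂volume.restrict (Set.Ioc (0 : ℝ) 1), p w) : ∀ᵐ w : ℝ, p w := by
  rw [ae_restrict_iff' measurableSet_Ioc] at h
  filter_upwards [ae_all_iff.2 fun n : ℤ => ae_comp_add_right h n] with w hw
  obtain ⟨n, hn⟩ := Set.mem_iUnion.1 ((iUnion_Ioc_intCast ℝ).symm ▸ Set.mem_univ w)
  refine hper w (-n) (hw (-n) ?_)
  push_cast
  exact ⟨by linarith [hn.1], by linarith [hn.2]⟩

theorem lintegral_eq_lintegral_periodization {G : ℝ → ℝ≥0∞} (hG : Measurable G) :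
    ∫⁻ w, G w = ∫⁻ w in Set.Ioc (0 : ℝ) 1, ∑' k : ℤ, G (w + k) := by
  rw [lintegral_tsum (f := fun (k : ℤ) w => G (w + k))
      (fun k => (hG.comp (measurable_add_const (k : ℝ))).aemeasurable),
    ← setLIntegral_univ, ← iUnion_Ioc_intCast ℝ,
    lintegral_iUnion (fun _ => measurableSet_Ioc) (Set.pairwise_disjoint_Ioc_intCast ℝ)]
  congr 1 with k
  rw [← (measurePreserving_add_right volume (k : ℝ)).setLIntegral_comp_preimage
    measurableSet_Ioc hG]
  simp

theorem integral_eq_integral_periodization {G S : ℝ → ℂ} (hG : Integrable G)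
    (hS : ∀ᵐ w : ℝ, HasSum (fun k : ℤ => G (w + k)) (S w)) :
    ∫ w, G w = ∫ w in (0 : ℝ)..1, S w := by
  have hsum := hG.hasSum_intervalIntegral_comp_add_int
  have hnorm := hG.norm.hasSum_intervalIntegral_comp_add_int.summable
  simp_rw [intervalIntegral.integral_of_le zero_le_one] at hsum hnorm ⊢
  have hswap := hasSum_integral_of_summable_integral_norm
    (μ := volume.restrict (Set.Ioc (0 : ℝ) 1)) (F := fun (k : ℤ) w => G (w + k))
    (fun k => (hG.comp_add_right (k : ℝ)).integrableOn) hnorm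
  rw [hsum.unique hswap]
  exact integral_congr_ae (ae_restrict_of_ae (hS.mono fun w hw => hw.tsum_eq))

theorem fourierInv_intCast_eq_integral_periodization {G S : ℝ → ℂ} (hG : Integrable G)
    (hS : ∀ᵐ w : ℝ, HasSum (fun n : ℤ => G (w + n)) (S w)) (k : ℤ) :
    𝓕⁻ G (k : ℝ) = ∫ w in (0 : ℝ)..1, (𝐞 (k * w) : ℂ) * S w := by
  simp only [Real.fourierInv_eq, RCLike.inner_apply, conj_trivial, Circle.smul_def, smul_eq_mul]
  refine integral_eq_integral_periodization (G := fun w => (𝐞 (k * w) : ℂ) * G w)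
    (hG.bdd_mul (by fun_prop) (.of_forall fun _ => (Circle.norm_coe _).le)) ?_
  filter_upwards [hS] with w hw
  simpa only [fourierChar_intCast_mul_add] using hw.mul_left (𝐞 (k * w) : ℂ)

theorem fourierTransform_conj_neg (b : ℝ → ℂ) (w : ℝ) :
    𝓕 (fun x => conj (b (-x))) w = conj (𝓕 b w) := by
  rw [Real.fourier_real_eq, Real.fourier_real_eq, ← integral_conj, ← integral_neg_eq_self]
  simp only [neg_neg, Circle.smul_def, smul_eq_mul, map_mul, conj_fourierChar, neg_mul]

theorem integral_mul_conj_comp_sub {a b : ℝ → ℂ} (ha : Integrable a) (hb : Integrable b)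
    (hbc : Continuous b) {B : ℝ} (hbB : ∀ x, ‖b x‖ ≤ B)
    (hab : Integrable fun w => 𝓕 a w * conj (𝓕 b w)) (x : ℝ) :
    ∫ z, a z * conj (b (z - x)) = 𝓕⁻ (fun w => 𝓕 a w * conj (𝓕 b w)) x := by
  let b' : ℝ → ℂ := fun y => conj (b (-y))
  have hb'c : Continuous b' := Complex.continuous_conj.comp (hbc.comp continuous_neg)
  have hb'i : Integrable b' :=
    hb.comp_neg.norm.mono' hb'c.aestronglyMeasurable (by simp [b'])
  let u : ℝ → ℂ := convolution a b' (ContinuousLinearMap.mul ℂ ℂ) volume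
  have huF : 𝓕 u = fun w => 𝓕 a w * conj (𝓕 b w) := by
    ext w
    rw [Real.fourier_mul_convolution_eq ha hb'i, fourierTransform_conj_neg]
  have huc : Continuous u := by
    refine BddAbove.continuous_convolution_right_of_integrable _ ⟨B, ?_⟩ ha hb'c
    rintro _ ⟨y, rfl⟩
    simpa [b'] using hbB (-y)
  rw [← huF, huc.fourierInv_fourier_eq (ha.integrable_convolution _ hb'i) (huF ▸ hab)]
  simp only [u, b', convolution_def, ContinuousLinearMap.mul_apply', neg_sub]

theorem eq_of_fourierTransform_ae_eq {u v : ℝ → ℂ} (hu : Continuous u) (hui : Integrable u)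
    (hv : Continuous v) (hvi : Integrable v) (h : 𝓕 u =ᵐ[volume] 𝓕 v) : u = v := by
  have hsub : 𝓕 (u - v) = 0 := by
    rw [← Continuous.ae_eq_iff_eq volume (continuous_fourierTransform (hui.sub hvi))
      continuous_zero]
    filter_upwards [h] with w hw
    have hconv {g : ℝ → ℂ} (hg : Integrable g) : Integrable fun y : ℝ => 𝐞 (-(y * w)) • g y := by
      simpa only [RCLike.inner_apply, conj_trivial, mul_comm w] using
        (Real.fourierIntegral_convergent_iff (V := ℝ) w).2 hg
    simp only [Real.fourier_real_eq, Pi.sub_apply, smul_sub] at hw ⊢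
    rw [integral_sub (hconv hui) (hconv hvi), hw, sub_self, Pi.zero_apply]
  have hinv := (hu.sub hv).fourierInv_fourier_eq (hui.sub hvi)
    (by change Integrable (𝓕 (u - v)); rw [hsub]; exact integrable_zero _ _ _)
  change 𝓕⁻ (𝓕 (u - v)) = u - v at hinv
  rw [hsub] at hinv
  refine sub_eq_zero.1 (hinv.symm.trans (funext fun x => ?_))
  simp [Real.fourierInv_eq]

section Scaling

variable {fw m₀ : ℝ → ℂ} {Φ : ℝ → ℝ}

theorem IsFWavelet.hasSum_norm_fourierTransform_sq (hfw : IsFWavelet fw m₀) :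
    ∀ᵐ w : ℝ, HasSum (fun k : ℤ => ‖𝓕 fw (w + k)‖ ^ 2) 1 := by
  filter_upwards [ae_comp_mul_left hfw.sum_eq_one Real.two_pi_pos.ne'] with w hw
  simpa only [← mul_add, fourier_two_pi_mul] using hw

theorem IsFWavelet.integrable_norm_fourierTransform_sq (hfw : IsFWavelet fw m₀)
    (hi : Integrable fw) : Integrable fun w => ‖𝓕 fw w‖ ^ 2 := by
  have hc := continuous_fourierTransform hi
  refine ⟨(hc.norm.pow 2).aestronglyMeasurable, ?_⟩
  have hone : ∀ᵐ w ∂(volume.restrict (Set.Ioc (0 : ℝ) 1)),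
      ∑' k : ℤ, ‖‖𝓕 fw (w + k)‖ ^ 2‖ₑ = 1 := by
    refine ae_restrict_of_ae (hfw.hasSum_norm_fourierTransform_sq.mono fun w hw => ?_)
    have hterm (k : ℤ) : ‖‖𝓕 fw (w + k)‖ ^ 2‖ₑ = ENNReal.ofReal (‖𝓕 fw (w + k)‖ ^ 2) :=
      Real.enorm_of_nonneg (by positivity)
    simp_rw [hterm]
    rw [← ENNReal.ofReal_tsum_of_nonneg (fun _ => by positivity) hw.summable, hw.tsum_eq,
      ENNReal.ofReal_one]
  rw [HasFiniteIntegral, lintegral_eq_lintegral_periodization (by fun_prop),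
    lintegral_congr_ae hone]
  simp

theorem IsFWavelet.integral_mul_conj_comp_sub_intCast (hfw : IsFWavelet fw m₀)
    (hS : AssumptionS fw Φ) (hc : Continuous fw) (k : ℤ) :
    ∫ z, fw z * conj (fw (z - k)) = if k = 0 then 1 else 0 := by
  have hi := hS.integrable_self hc
  have hsq (w : ℝ) : 𝓕 fw w * conj (𝓕 fw w) = ((‖𝓕 fw w‖ ^ 2 : ℝ) : ℂ) := by
    rw [Complex.mul_conj, Complex.normSq_eq_norm_sq]
  have hInt : Integrable fun w => 𝓕 fw w * conj (𝓕 fw w) := by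
    simp_rw [hsq]
    exact (hfw.integrable_norm_fourierTransform_sq hi).ofReal
  have hper : ∀ᵐ w : ℝ, HasSum (fun n : ℤ => 𝓕 fw (w + n) * conj (𝓕 fw (w + n))) 1 := by
    filter_upwards [hfw.hasSum_norm_fourierTransform_sq] with w hw
    simpa only [hsq, Complex.ofReal_one] using Complex.hasSum_ofReal.2 hw
  rw [integral_mul_conj_comp_sub hi hi hc (hS.norm_le_majorant_zero hc) hInt,
    fourierInv_intCast_eq_integral_periodization hInt hper]
  simpa only [mul_one] using integral_fourierChar_intCast_mul k

end Scaling

/-! ### Absolutely convergent trigonometric series and two-scale relations -/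

/-- The trigonometric series `∑ₖ dₖ e^{-2πikw}` with coefficients `d`; filters are studied through
it. The sign is that of the Fourier transform, so that translation by `k` contributes the `k`-th
mode. -/
noncomputable def expSum (d : ℤ → ℂ) (w : ℝ) : ℂ := ∑' k : ℤ, d k * 𝐞 (-(k * w))

/-- The function `x ↦ 2 ∑ₖ dₖ g(2x - k)`, the right-hand side of a two-scale relation. With the
factor `2` outside the sum, its Fourier transform at `2w` is `expSum d w * 𝓕 g w`. -/
noncomputable def twoScale (d : ℤ → ℂ) (g : ℝ → ℂ) (x : ℝ) : ℂ := 2 * ∑' k : ℤ, d k * g (2 * x - k)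

section ExpSum

variable {d : ℤ → ℂ}

theorem norm_mul_fourierChar (z : ℂ) (x : ℝ) : ‖z * (𝐞 x : ℂ)‖ = ‖z‖ := by
  rw [norm_mul, Circle.norm_coe, mul_one]

theorem continuous_expSum (hd : Summable fun k => ‖d k‖) : Continuous (expSum d) :=
  continuous_tsum (fun k => by fun_prop) hd fun k w => (norm_mul_fourierChar _ _).le

theorem hasSum_expSum (hd : Summable fun k => ‖d k‖) (w : ℝ) :
    HasSum (fun k : ℤ => d k * (𝐞 (-(k * w)) : ℂ)) (expSum d w) :=
  (Summable.of_norm (by simpa only [norm_mul_fourierChar] using hd)).hasSum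

theorem norm_expSum_le (hd : Summable fun k => ‖d k‖) (w : ℝ) : ‖expSum d w‖ ≤ ∑' k, ‖d k‖ := by
  refine (norm_tsum_le_tsum_norm ?_).trans_eq ?_ <;> simp only [norm_mul_fourierChar, hd]

theorem expSum_add_intCast (d : ℤ → ℂ) (w : ℝ) (n : ℤ) : expSum d (w + n) = expSum d w := by
  have h (k : ℤ) : 𝐞 (-(k * (w + n))) = 𝐞 (-(k * w)) := by
    simpa only [Int.cast_neg, neg_mul] using fourierChar_intCast_mul_add (-k) w n
  simp only [expSum, h]

theorem integral_fourierChar_mul_expSum (hd : Summable fun k => ‖d k‖) (k : ℤ) :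
    ∫ w in (0 : ℝ)..1, (𝐞 (k * w) : ℂ) * expSum d w = d k := by
  have hmode (j : ℤ) (w : ℝ) : (𝐞 (k * w) : ℂ) * (d j * (𝐞 (-(j * w)) : ℂ)) =
      d j * (𝐞 ((k - j : ℤ) * w) : ℂ) := by
    rw [mul_left_comm, ← Circle.coe_mul, ← AddChar.map_add_eq_mul]
    push_cast
    ring_nf
  have hterm (j : ℤ) : ∫ w in Set.Ioc (0 : ℝ) 1, d j * (𝐞 ((k - j : ℤ) * w) : ℂ) =
      if j = k then d k else 0 := by
    rw [integral_const_mul, ← intervalIntegral.integral_of_le zero_le_one,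
      integral_fourierChar_intCast_mul]
    by_cases hjk : j = k
    · simp [hjk]
    · rw [if_neg (by omega), if_neg hjk, mul_zero]
  have hswap := hasSum_integral_of_summable_integral_norm
    (μ := volume.restrict (Set.Ioc (0 : ℝ) 1))
    (F := fun (j : ℤ) w => d j * (𝐞 ((k - j : ℤ) * w) : ℂ))
    (fun j => Continuous.integrableOn_Ioc (by fun_prop))
    (by simpa only [norm_mul_fourierChar, integral_const, measureReal_restrict_apply_univ,
      Real.volume_real_Ioc_of_le zero_le_one, sub_zero, one_smul] using hd)
  simp_rw [hterm, ← hmode, tsum_mul_left] at hswap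
  rw [intervalIntegral.integral_of_le zero_le_one]
  exact hswap.unique (hasSum_ite_eq k (d k))

theorem ae_restrict_eq_zero_of_fourier_coefficients_eq_zero {D : ℝ → ℂ}
    (hD : MemLp D 2 (volume.restrict (Set.Ioc (0 : ℝ) 1)))
    (hcoeff : ∀ k : ℤ, ∫ w in (0 : ℝ)..1, (𝐞 (k * w) : ℂ) * D w = 0) :
    ∀ᵐ w ∂volume.restrict (Set.Ioc (0 : ℝ) 1), D w = 0 := by
  have hzero (k : ℤ) : fourierCoeffOn (zero_lt_one' ℝ) D k = 0 := by
    have hmode (w : ℝ) : _root_.fourier (-k) (w : AddCircle ((1 : ℝ) - 0)) • D w =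
        (𝐞 ((-k : ℤ) * w) : ℂ) * D w := by
      rw [fourier_coe_apply, Real.fourierChar_apply, smul_eq_mul]
      congr 2
      push_cast
      ring
    rw [fourierCoeffOn_eq_integral]
    simp_rw [hmode, hcoeff, smul_zero]
  have hparseval := hasSum_sq_fourierCoeffOn (zero_lt_one' ℝ) hD
  simp only [hzero, norm_zero, ne_eq, OfNat.ofNat_ne_zero, not_false_eq_true, zero_pow, sub_zero,
    inv_one, one_smul, intervalIntegral.integral_of_le zero_le_one] at hparseval
  have hnorm := (integral_eq_zero_iff_of_nonneg (fun _ => by positivity)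
    hD.norm.integrable_sq).1 (hparseval.unique hasSum_zero)
  filter_upwards [hnorm] with w hw
  simpa using hw

theorem ae_eq_expSum {μ : ℝ → ℂ} (hd : Summable fun k => ‖d k‖)
    (hm : MemLp μ 2 (volume.restrict (Set.Ioc (0 : ℝ) 1)))
    (hper : ∀ (w : ℝ) (n : ℤ), μ (w + n) = μ w)
    (hcoeff : ∀ k : ℤ, ∫ w in (0 : ℝ)..1, (𝐞 (k * w) : ℂ) * μ w = d k) :
    ∀ᵐ w : ℝ, μ w = expSum d w := by
  have hE : MemLp (expSum d) 2 (volume.restrict (Set.Ioc (0 : ℝ) 1)) :=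
    MemLp.of_bound (continuous_expSum hd).aestronglyMeasurable _ (.of_forall (norm_expSum_le hd))
  have hint {v : ℝ → ℂ} (hv : MemLp v 2 (volume.restrict (Set.Ioc (0 : ℝ) 1))) (k : ℤ) :
      IntervalIntegrable (fun w : ℝ => (𝐞 (k * w) : ℂ) * v w) volume 0 1 := by
    rw [intervalIntegrable_iff_integrableOn_Ioc_of_le zero_le_one]
    exact (hv.integrable one_le_two).bdd_mul (by fun_prop)
      (.of_forall fun _ => (Circle.norm_coe _).le)
  refine ae_of_ae_restrict_Ioc_zero_one (fun w n h => ?_) ?_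
  · rwa [hper, expSum_add_intCast] at h
  · refine (ae_restrict_eq_zero_of_fourier_coefficients_eq_zero (hm.sub hE) fun k => ?_).mono
      fun w hw => sub_eq_zero.1 hw
    simp only [Pi.sub_apply, mul_sub]
    rw [intervalIntegral.integral_sub (hint hm k) (hint hE k), hcoeff,
      integral_fourierChar_mul_expSum hd, sub_self]

end ExpSum

section TwoScale

variable {g : ℝ → ℂ} {d : ℤ → ℂ} {B : ℝ}

theorem integrable_comp_two_mul_sub (hi : Integrable g) (k : ℝ) :
    Integrable fun x : ℝ => g (2 * x - k) :=
  (hi.comp_sub_right k).comp_mul_left' two_ne_zero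

theorem integral_comp_two_mul_sub {E : Type*} [NormedAddCommGroup E] [NormedSpace ℝ E]
    (v : ℝ → E) (k : ℝ) : ∫ x : ℝ, v (2 * x - k) = (2 : ℝ)⁻¹ • ∫ x, v x := by
  rw [Measure.integral_comp_mul_left (fun y => v (y - k)) 2, integral_sub_right_eq_self v k,
    abs_of_pos (by norm_num)]

theorem continuous_twoScale (hd : Summable fun k => ‖d k‖) (hB : ∀ x, ‖g x‖ ≤ B)
    (hg : Continuous g) : Continuous (twoScale d g) := by
  refine continuous_const.mul (continuous_tsum (fun k => by fun_prop) (hd.mul_right B)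
    fun k x => ?_)
  rw [norm_mul]
  gcongr
  exact hB _

theorem summable_integral_norm_mul_comp_two_mul_sub (hd : Summable fun k => ‖d k‖) :
    Summable fun k : ℤ => ∫ x, ‖d k * g (2 * x - k)‖ := by
  simp only [norm_mul, integral_const_mul, integral_comp_two_mul_sub fun x => ‖g x‖]
  exact hd.mul_right _

theorem integrable_tsum {F : ℤ → ℝ → ℂ} (hF : ∀ k, Integrable (F k))
    (hs : Summable fun k => ∫ x, ‖F k x‖) : Integrable fun x => ∑' k, F k x := by
  have hL1 : ∑' k, ‖(hF k).toL1 (F k)‖ₑ ≠ ∞ := by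
    refine tsum_enorm_ne_top_iff_summable_norm.2 (hs.congr fun k => ?_)
    rw [L1.norm_of_fun_eq_integral_norm]
  refine (L1.integrable_coeFn (∑' k, (hF k).toL1 (F k))).congr ((Lp.coeFn_tsum hL1).trans ?_)
  filter_upwards [ae_all_iff.2 fun k => (hF k).coeFn_toL1] with x hx
  simp only [hx]

theorem integrable_twoScale (hd : Summable fun k => ‖d k‖) (hi : Integrable g) :
    Integrable (twoScale d g) :=
  (integrable_tsum
    (fun k => (integrable_comp_two_mul_sub hi k).const_mul (d k))
    (summable_integral_norm_mul_comp_two_mul_sub hd)).const_mul 2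

theorem fourierTransform_comp_two_mul_sub (g : ℝ → ℂ) (k w : ℝ) :
    𝓕 (fun x => g (2 * x - k)) (2 * w) = 2⁻¹ * ((𝐞 (-(k * w)) : ℂ) * 𝓕 g w) := by
  have hphase (x : ℝ) : (𝐞 (-(x * (2 * w))) : ℂ) =
      (𝐞 (-(k * w)) : ℂ) * (𝐞 (-((2 * x - k) * w)) : ℂ) := by
    rw [← Circle.coe_mul, ← AddChar.map_add_eq_mul]
    ring_nf
  simp_rw [Real.fourier_real_eq, Circle.smul_def, smul_eq_mul, hphase, mul_assoc]
  rw [integral_const_mul, integral_comp_two_mul_sub fun y => (𝐞 (-(y * w)) : ℂ) * g y,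
    Complex.real_smul]
  push_cast
  ring

theorem hasSum_fourierTransform {F : ℤ → ℝ → ℂ} (hF : ∀ k, Integrable (F k))
    (hs : Summable fun k => ∫ x, ‖F k x‖) (w : ℝ) :
    HasSum (fun k => 𝓕 (F k) w) (𝓕 (fun x => ∑' k, F k x) w) := by
  have hswap := hasSum_integral_of_summable_integral_norm
    (F := fun k x => (𝐞 (-(x * w)) : ℂ) * F k x)
    (fun k => (hF k).bdd_mul (by fun_prop) (.of_forall fun _ => (Circle.norm_coe _).le))
    (by simpa only [norm_mul, Circle.norm_coe, one_mul] using hs)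
  simpa only [Real.fourier_real_eq, Circle.smul_def, smul_eq_mul, tsum_mul_left] using hswap

theorem fourierTransform_twoScale (hd : Summable fun k => ‖d k‖) (hi : Integrable g) (w : ℝ) :
    𝓕 (twoScale d g) (2 * w) = expSum d w * 𝓕 g w := by
  have hconst (c : ℂ) (u : ℝ → ℂ) (v : ℝ) : 𝓕 (fun x => c * u x) v = c * 𝓕 u v := by
    simp only [Real.fourier_real_eq, Circle.smul_def, smul_eq_mul, mul_left_comm _ c,
      integral_const_mul]
  have hsum := (hasSum_fourierTransform
    (fun k => (integrable_comp_two_mul_sub hi k).const_mul (d k))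
    (summable_integral_norm_mul_comp_two_mul_sub hd) (2 * w)).mul_left 2
  refine ((hconst 2 _ _).trans ?_)
  refine hsum.unique (((hasSum_expSum hd w).mul_right (𝓕 g w)).congr_fun fun k => ?_)
  rw [hconst, fourierTransform_comp_two_mul_sub]
  ring

theorem eq_twoScale {v : ℝ → ℂ} (hv : Continuous v) (hvi : Integrable v)
    (hd : Summable fun k => ‖d k‖) (hB : ∀ x, ‖g x‖ ≤ B) (hg : Continuous g)
    (hi : Integrable g) (h : ∀ᵐ w : ℝ, 𝓕 v (2 * w) = expSum d w * 𝓕 g w) :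
    v = twoScale d g := by
  refine eq_of_fourierTransform_ae_eq hv hvi (continuous_twoScale hd hB hg)
    (integrable_twoScale hd hi) ?_
  filter_upwards [ae_comp_mul_left h (r := 2⁻¹) (by norm_num)] with w hw
  rwa [← fourierTransform_twoScale hd hi, mul_inv_cancel_left₀ two_ne_zero] at hw

theorem hasSum_integral_mul_conj_twoScale_comp_sub {u : ℝ → ℂ} (hu : Integrable u)
    (hd : Summable fun k => ‖d k‖) (hB : ∀ x, ‖g x‖ ≤ B) (hg : Continuous g) (k : ℤ) :
    HasSum (fun l : ℤ => 2 * (conj (d l) * ∫ z, u z * conj (g (2 * z - (l + 2 * k : ℤ)))))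
      (∫ z, u z * conj (twoScale d g (z - k))) := by
  have hF (l : ℤ) : Integrable fun z : ℝ =>
      2 * (conj (d l) * (u z * conj (g (2 * z - (l + 2 * k : ℤ))))) :=
    ((hu.mul_bdd (c := B) (Complex.continuous_conj.comp (by fun_prop)).aestronglyMeasurable
      (.of_forall fun _ => (RCLike.norm_conj _).trans_le (hB _))).const_mul _).const_mul 2
  have hnorm (l : ℤ) : ∫ z, ‖2 * (conj (d l) * (u z * conj (g (2 * z - (l + 2 * k : ℤ)))))‖ ≤
      ‖d l‖ * (2 * B * ∫ z, ‖u z‖) := by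
    rw [← mul_assoc, ← integral_const_mul]
    refine integral_mono (hF l).norm (hu.norm.const_mul _) fun z => ?_
    simp only [norm_mul, RCLike.norm_conj, Complex.norm_ofNat]
    calc 2 * (‖d l‖ * (‖u z‖ * ‖g (2 * z - (l + 2 * k : ℤ))‖))
        ≤ 2 * (‖d l‖ * (‖u z‖ * B)) := by gcongr; exact hB _
      _ = ‖d l‖ * (2 * B) * ‖u z‖ := by ring
  have hpoint (z : ℝ) : ∑' l : ℤ, 2 * (conj (d l) * (u z * conj (g (2 * z - (l + 2 * k : ℤ))))) =
      u z * conj (twoScale d g (z - k)) := by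
    simp only [twoScale, map_mul, map_ofNat, Complex.conj_tsum, tsum_mul_left,
      mul_left_comm _ (u z)]
    push_cast
    simp only [mul_sub, sub_sub, add_comm]
  have hswap := hasSum_integral_of_summable_integral_norm hF
    (.of_nonneg_of_le (fun _ => integral_nonneg fun _ => norm_nonneg _) hnorm (hd.mul_right _))
  simpa only [hpoint, integral_const_mul] using hswap

end TwoScale

/-! ### The mask -/

/-- The coefficients of the two-scale relation of the scaling function `fw`, read off by
orthonormality of its integer translates. -/
noncomputable def maskCoeff (fw : ℝ → ℂ) (k : ℤ) : ℂ := ∫ z, fw z * conj (fw (2 * z - k))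

/-- The coefficients of the two-scale relation of the wavelet whose scaling function has
coefficients `h` (the conjugate mirror filter). -/
noncomputable def waveCoeff (h : ℤ → ℂ) (k : ℤ) : ℂ := (-1) ^ (1 - k) * conj (h (1 - k))

section Mask

variable {fw m₀ mw : ℝ → ℂ} {Φ : ℝ → ℝ}

theorem AssumptionS.tsum_lintegral_enorm_mul_conj_lt_top (hS : AssumptionS fw Φ)
    (hc : Continuous fw) {v : ℝ → ℂ} (hv : Integrable v) (r : ℝ) :
    ∑' k : ℤ, ∫⁻ z : ℝ, ‖v z * conj (fw (r * z - k))‖ₑ < ∞ := by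
  have hm (k : ℤ) : AEMeasurable fun z : ℝ => ‖v z * conj (fw (r * z - k))‖ₑ :=
    (hv.aestronglyMeasurable.mul
      (Complex.continuous_conj.comp (by fun_prop)).aestronglyMeasurable).enorm
  calc ∑' k : ℤ, ∫⁻ z : ℝ, ‖v z * conj (fw (r * z - k))‖ₑ
      = ∫⁻ z : ℝ, ∑' k : ℤ, ‖v z * conj (fw (r * z - k))‖ₑ := (lintegral_tsum hm).symm
    _ ≤ ∫⁻ z : ℝ, ‖v z‖ₑ * ENNReal.ofReal (constC Φ) := by
        refine lintegral_mono fun z => ?_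
        simp_rw [enorm_mul, RCLike.enorm_conj, ENNReal.tsum_mul_left]
        gcongr
        exact hS.tsum_enorm_le hc _
    _ = (∫⁻ z : ℝ, ‖v z‖ₑ) * ENNReal.ofReal (constC Φ) :=
        lintegral_mul_const' _ _ ENNReal.ofReal_ne_top
    _ < ∞ := ENNReal.mul_lt_top hv.2 ENNReal.ofReal_lt_top

theorem AssumptionS.summable_norm_maskCoeff (hS : AssumptionS fw Φ) (hc : Continuous fw) :
    Summable fun k => ‖maskCoeff fw k‖ :=
  tsum_enorm_ne_top_iff_summable_norm.1 (ne_top_of_le_ne_top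
    (hS.tsum_lintegral_enorm_mul_conj_lt_top hc (hS.integrable_self hc) 2).ne
    (ENNReal.tsum_le_tsum fun _ => enorm_integral_le_lintegral_enorm _))

theorem fourierTransform_comp_div_two (g : ℝ → ℂ) (w : ℝ) :
    𝓕 (fun z => 2⁻¹ * g (z / 2)) w = 𝓕 g (2 * w) := by
  have hphase (z : ℝ) : (𝐞 (-(z * w)) : ℂ) * (2⁻¹ * g (z / 2)) =
      2⁻¹ * ((𝐞 (-(z / 2 * (2 * w))) : ℂ) * g (z / 2)) := by
    rw [← mul_assoc (z / 2), div_mul_cancel₀ z two_ne_zero]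
    ring
  simp_rw [Real.fourier_real_eq, Circle.smul_def, smul_eq_mul, hphase]
  rw [integral_const_mul,
    Measure.integral_comp_div (fun z => (𝐞 (-(z * (2 * w))) : ℂ) * g z) 2]
  simp

theorem integral_comp_div_two_mul_conj_comp_sub (fw : ℝ → ℂ) (k : ℤ) :
    ∫ z : ℝ, 2⁻¹ * fw (z / 2) * conj (fw (z - k)) = maskCoeff fw k := by
  have hscale := Measure.integral_comp_div (fun z : ℝ => fw z * conj (fw (2 * z - k))) 2
  simp only [mul_div_cancel₀ (_ : ℝ) (two_ne_zero' ℝ)] at hscale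
  simp_rw [mul_assoc]
  rw [integral_const_mul, hscale, maskCoeff]
  simp

namespace IsFWavelet

theorem mask_two_pi_mul_add_intCast (hfw : IsFWavelet fw m₀) (w : ℝ) (n : ℤ) :
    m₀ (2 * Real.pi * (w + n)) = m₀ (2 * Real.pi * w) := by
  rw [← hfw.mask_periodic.int_mul n (2 * Real.pi * w), mul_add, mul_comm (n : ℝ)]

theorem fourierTransform_two_mul (hfw : IsFWavelet fw m₀) :
    ∀ᵐ w : ℝ, 𝓕 fw (2 * w) = m₀ (2 * Real.pi * w) * 𝓕 fw w := by
  filter_upwards [ae_comp_mul_left hfw.refinement (r := 2 * (2 * Real.pi)) (by positivity)]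
    with w hw
  rwa [mul_assoc, mul_div_cancel_left₀ _ two_ne_zero, mul_left_comm, fourier_two_pi_mul,
    fourier_two_pi_mul] at hw

theorem fourierTransform_two_mul_add_intCast (hfw : IsFWavelet fw m₀) :
    ∀ᵐ w : ℝ, ∀ k : ℤ, 𝓕 fw (2 * (w + k)) = m₀ (2 * Real.pi * w) * 𝓕 fw (w + k) := by
  filter_upwards [ae_all_iff.2 fun k : ℤ => ae_comp_add_right hfw.fourierTransform_two_mul k]
    with w hw k
  rw [hw k, hfw.mask_two_pi_mul_add_intCast]

theorem hasSum_fourierTransform_two_mul_mul_conj (hfw : IsFWavelet fw m₀) :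
    ∀ᵐ w : ℝ, HasSum (fun k : ℤ => 𝓕 fw (2 * (w + k)) * conj (𝓕 fw (w + k)))
      (m₀ (2 * Real.pi * w)) := by
  filter_upwards [hfw.fourierTransform_two_mul_add_intCast, hfw.hasSum_norm_fourierTransform_sq]
    with w hw hs
  have hmask := (Complex.hasSum_ofReal.2 hs).mul_left (m₀ (2 * Real.pi * w))
  rw [Complex.ofReal_one, mul_one] at hmask
  refine hmask.congr_fun fun k => ?_
  rw [hw k, mul_assoc, Complex.mul_conj, Complex.normSq_eq_norm_sq]

/- `|m₀(2πw)|²` is the part of `∑ₖ |𝓕 fw (2w + k)|² = 1` carried by even `k`. -/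
theorem norm_mask_le_one (hfw : IsFWavelet fw m₀) :
    ∀ᵐ w : ℝ, ‖m₀ (2 * Real.pi * w)‖ ≤ 1 := by
  filter_upwards [hfw.fourierTransform_two_mul_add_intCast, hfw.hasSum_norm_fourierTransform_sq,
    ae_comp_mul_left hfw.hasSum_norm_fourierTransform_sq two_ne_zero] with w hw hs hs2
  have hinj : Function.Injective fun k : ℤ => 2 * k := mul_right_injective₀ two_ne_zero
  have heven (k : ℤ) : ‖𝓕 fw (2 * w + (2 * k : ℤ))‖ ^ 2 =
      ‖m₀ (2 * Real.pi * w)‖ ^ 2 * ‖𝓕 fw (w + k)‖ ^ 2 := by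
    rw [← mul_pow, ← norm_mul, ← hw k]
    push_cast
    rw [mul_add]
  refine (sq_le_one_iff₀ (norm_nonneg _)).1 ?_
  calc ‖m₀ (2 * Real.pi * w)‖ ^ 2
      = ∑' k : ℤ, ‖𝓕 fw (2 * w + (2 * k : ℤ))‖ ^ 2 := by
        simp_rw [heven, tsum_mul_left, hs.tsum_eq, mul_one]
    _ ≤ ∑' k : ℤ, ‖𝓕 fw (2 * w + k)‖ ^ 2 :=
        tsum_comp_le_tsum_of_inj hs2.summable (fun _ => by positivity) hinj
    _ = 1 := hs2.tsum_eq

theorem integrable_fourierTransform_two_mul_mul_conj (hfw : IsFWavelet fw m₀)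
    (hi : Integrable fw) : Integrable fun w => 𝓕 fw (2 * w) * conj (𝓕 fw w) := by
  have hF := continuous_fourierTransform hi
  have hF2 : MemLp (𝓕 fw) 2 := (memLp_two_iff_integrable_sq_norm hF.aestronglyMeasurable).2
    (hfw.integrable_norm_fourierTransform_sq hi)
  have hF2' : MemLp (fun w => 𝓕 fw (2 * w)) 2 :=
    (memLp_two_iff_integrable_sq_norm (hF.comp (by fun_prop)).aestronglyMeasurable).2
      ((hfw.integrable_norm_fourierTransform_sq hi).comp_mul_left' two_ne_zero)
  exact hF2'.integrable_mul hF2.star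

theorem memLp_mask (hfw : IsFWavelet fw m₀) (hi : Integrable fw) :
    MemLp (fun w => m₀ (2 * Real.pi * w)) 2 (volume.restrict (Set.Ioc (0 : ℝ) 1)) := by
  refine MemLp.of_bound ?_ 1 (ae_restrict_of_ae hfw.norm_mask_le_one)
  have hF := continuous_fourierTransform hi
  refine (aestronglyMeasurable_of_tendsto_ae (u := (atTop : Filter (Finset ℤ)))
    (f := fun s w => ∑ k ∈ s, 𝓕 fw (2 * (w + k)) * conj (𝓕 fw (w + k))) (fun s => ?_)
    hfw.hasSum_fourierTransform_two_mul_mul_conj).restrict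
  exact (continuous_finsetSum _ fun k _ => (hF.comp (by fun_prop)).mul
    (Complex.continuous_conj.comp (hF.comp (by fun_prop)))).aestronglyMeasurable

theorem integral_fourierChar_mul_mask (hfw : IsFWavelet fw m₀) (hS : AssumptionS fw Φ)
    (hc : Continuous fw) (k : ℤ) :
    ∫ w in (0 : ℝ)..1, (𝐞 (k * w) : ℂ) * m₀ (2 * Real.pi * w) = maskCoeff fw k := by
  have hi := hS.integrable_self hc
  have hInt := hfw.integrable_fourierTransform_two_mul_mul_conj hi
  have hhalf : Integrable fun z => (2⁻¹ : ℂ) * fw (z / 2) :=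
    (hi.comp_div two_ne_zero).const_mul _
  have hplancherel := integral_mul_conj_comp_sub hhalf hi hc (hS.norm_le_majorant_zero hc)
    (by simpa only [fourierTransform_comp_div_two] using hInt) k
  simp only [fourierTransform_comp_div_two, integral_comp_div_two_mul_conj_comp_sub]
    at hplancherel
  rw [hplancherel, fourierInv_intCast_eq_integral_periodization hInt
    hfw.hasSum_fourierTransform_two_mul_mul_conj]

theorem mask_eq_expSum (hfw : IsFWavelet fw m₀) (hS : AssumptionS fw Φ) (hc : Continuous fw) :
    ∀ᵐ w : ℝ, m₀ (2 * Real.pi * w) = expSum (maskCoeff fw) w :=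
  ae_eq_expSum (μ := fun w => m₀ (2 * Real.pi * w)) (hS.summable_norm_maskCoeff hc)
    (hfw.memLp_mask (hS.integrable_self hc)) hfw.mask_two_pi_mul_add_intCast
    (hfw.integral_fourierChar_mul_mask hS hc)

theorem eq_twoScale (hfw : IsFWavelet fw m₀) (hS : AssumptionS fw Φ) (hc : Continuous fw) :
    fw = twoScale (maskCoeff fw) fw := by
  have hi := hS.integrable_self hc
  refine SubGaussWavelet.eq_twoScale hc hi (hS.summable_norm_maskCoeff hc)
    (hS.norm_le_majorant_zero hc) hc hi ?_
  filter_upwards [hfw.fourierTransform_two_mul, hfw.mask_eq_expSum hS hc] with w hw hmask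
  rw [hw, hmask]

theorem hasSum_maskCoeff_mul_conj (hfw : IsFWavelet fw m₀) (hS : AssumptionS fw Φ)
    (hc : Continuous fw) (k : ℤ) :
    HasSum (fun l : ℤ => maskCoeff fw (l + 2 * k) * conj (maskCoeff fw l))
      (if k = 0 then 1 / 2 else 0) := by
  have hinner := (hasSum_integral_mul_conj_twoScale_comp_sub (hS.integrable_self hc)
    (hS.summable_norm_maskCoeff hc) (hS.norm_le_majorant_zero hc) hc k).mul_left (1 / 2)
  rw [← hfw.eq_twoScale hS hc, hfw.integral_mul_conj_comp_sub_intCast hS hc, mul_ite, mul_one,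
    mul_zero] at hinner
  refine hinner.congr_fun fun l => ?_
  rw [← maskCoeff]
  ring

theorem tsum_maskCoeff (hfw : IsFWavelet fw m₀) (hS : AssumptionS fw Φ) (hc : Continuous fw) :
    ∑' k, maskCoeff fw k = 1 := by
  have hzero : 𝓕 fw 0 ≠ 0 := by
    simpa only [← fourier_two_pi_mul, mul_zero] using hfw.fourier_zero
  have hscale := fourierTransform_twoScale (hS.summable_norm_maskCoeff hc)
    (hS.integrable_self hc) 0
  rw [← hfw.eq_twoScale hS hc, mul_zero, eq_comm, mul_eq_right₀ hzero] at hscale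
  simpa [expSum] using hscale

end IsFWavelet

theorem norm_waveCoeff (h : ℤ → ℂ) (k : ℤ) : ‖waveCoeff h k‖ = ‖h (1 - k)‖ := by
  simp [waveCoeff]

theorem summable_norm_waveCoeff {h : ℤ → ℂ} (hh : Summable fun k => ‖h k‖) :
    Summable fun k => ‖waveCoeff h k‖ := by
  simp_rw [norm_waveCoeff]
  exact (Equiv.subLeft (1 : ℤ)).summable_iff.2 hh

theorem expSum_waveCoeff (h : ℤ → ℂ) (w : ℝ) :
    expSum (waveCoeff h) w = conj (expSum h (w + 1 / 2)) * 𝐞 (-w) := by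
  have hsign (k : ℤ) : (-1 : ℂ) ^ k = 𝐞 (k * (1 / 2)) := by
    rw [← Complex.exp_pi_mul_I, ← Complex.exp_int_mul, Real.fourierChar_apply]
    congr 1
    push_cast
    ring
  rw [expSum, expSum, Complex.conj_tsum, ← tsum_mul_right, ← (Equiv.subLeft (1 : ℤ)).tsum_eq]
  congr 1 with k
  simp only [Equiv.subLeft_apply, waveCoeff, sub_sub_cancel, map_mul,
    conj_fourierChar, neg_neg]
  rw [hsign, mul_comm (𝐞 _ : ℂ), mul_assoc, mul_assoc, ← Circle.coe_mul, ← Circle.coe_mul,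
    ← AddChar.map_add_eq_mul, ← AddChar.map_add_eq_mul]
  congr 3
  push_cast
  ring

theorem IsMWavelet.fourierTransform_two_mul (hmw : IsMWavelet fw m₀ mw) :
    ∀ᵐ w : ℝ, 𝓕 mw (2 * w) =
      conj (m₀ (2 * Real.pi * (w + 1 / 2))) * 𝐞 (-w) * 𝓕 fw w := by
  filter_upwards [ae_comp_mul_left hmw.2 (r := 2 * (2 * Real.pi)) (by positivity)] with w hw
  rw [mul_assoc, mul_div_cancel_left₀ _ two_ne_zero, mul_left_comm, fourier_two_pi_mul,
    fourier_two_pi_mul] at hw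
  rw [hw, Real.fourierChar_apply]
  congr 3
  · ring_nf
  · push_cast
    ring

theorem IsMWavelet.eq_twoScale (hmw : IsMWavelet fw m₀ mw) (hmc : Continuous mw)
    (hfw : IsFWavelet fw m₀) (hS : AssumptionS fw Φ) (hc : Continuous fw) :
    mw = twoScale (waveCoeff (maskCoeff fw)) fw := by
  refine SubGaussWavelet.eq_twoScale hmc hmw.1
    (summable_norm_waveCoeff (hS.summable_norm_maskCoeff hc)) (hS.norm_le_majorant_zero hc) hc
    (hS.integrable_self hc) ?_
  filter_upwards [hmw.fourierTransform_two_mul,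
    ae_comp_add_right (hfw.mask_eq_expSum hS hc) (1 / 2)] with w hw hmask
  rw [hw, hmask, expSum_waveCoeff]

end Mask

/-! ### Conjugate quadrature filters -/

section Parity

variable {E : Type*} [NormedAddCommGroup E] {l m : ℤ}

theorem injective_sub_two_mul (l : ℤ) : Function.Injective fun k : ℤ => l - 2 * k := fun i j h => by
  simpa using h

theorem tsum_comp_sub_two_mul_congr (B : ℤ → E) (hlm : Even (l - m)) :
    ∑' k : ℤ, B (l - 2 * k) = ∑' k : ℤ, B (m - 2 * k) := by
  obtain ⟨r, hr⟩ := hlm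
  rw [← (Equiv.addRight r).tsum_eq fun k => B (l - 2 * k)]
  refine tsum_congr fun k => congrArg B ?_
  simp only [Equiv.coe_addRight]
  omega

theorem tsum_comp_sub_two_mul_add [CompleteSpace E] {B : ℤ → E} (hB : Summable B)
    (hlm : Odd (l - m)) : ∑' k : ℤ, B (l - 2 * k) + ∑' k : ℤ, B (m - 2 * k) = ∑' k, B k := by
  obtain ⟨r, hr⟩ := hlm
  have hcompl : (Set.range fun k : ℤ => l - 2 * k)ᶜ = Set.range fun k : ℤ => m - 2 * k := by
    ext x
    constructor
    · intro hx
      obtain ⟨k, hk | hk⟩ := Int.even_or_odd' (l - x)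
      · exact absurd ⟨k, by dsimp only; omega⟩ hx
      · exact ⟨k - r, by dsimp only; omega⟩
    · rintro ⟨i, rfl⟩ ⟨j, hj⟩
      dsimp only at hj
      omega
  have hsum (n : ℤ) := (hB.comp_injective (injective_sub_two_mul n)).hasSum
  exact (((injective_sub_two_mul l).hasSum_range_iff.2 (hsum l)).add_isCompl
    (hcompl ▸ isCompl_compl) ((injective_sub_two_mul m).hasSum_range_iff.2 (hsum m))).tsum_eq.symm

end Parity

/-- An absolutely summable conjugate quadrature filter, the discrete counterpart of a scaling
function with orthonormal translates. The normalization `∑ₗ |hₗ|² = 1 / 2` goes with the factor `2`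
of `twoScale`. -/
structure IsQuadratureFilter (h : ℤ → ℂ) : Prop where
  summable_norm : Summable fun k => ‖h k‖
  tsum_mul_conj : ∀ k : ℤ, ∑' l : ℤ, h (l + 2 * k) * conj (h l) = if k = 0 then 1 / 2 else 0

section Filter

variable {a b d h : ℤ → ℂ}

theorem summable_mul_conj_comp_add (hd : Summable fun k => ‖d k‖)
    (ha : Summable fun k => ‖a k‖) (r : ℤ) :
    Summable fun j : ℤ => d j * conj (a (j + r)) := by
  refine Summable.of_norm_bounded (hd.mul_right (∑' k, ‖a k‖)) fun j => ?_
  rw [norm_mul, RCLike.norm_conj]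
  gcongr
  exact ha.le_tsum (j + r) fun _ _ => norm_nonneg _

theorem summable_prod_comp_sub_two_mul_mul (hd : Summable fun k => ‖d k‖)
    (ha : Summable fun k => ‖a k‖) :
    Summable fun q : ℤ × ℤ => d (q.1 - 2 * q.2) * a q.1 := by
  have hinj : Function.Injective fun q : ℤ × ℤ => (q.1 - 2 * q.2, q.1) := by
    rintro ⟨l, i⟩ ⟨m, j⟩ hqr
    simp only [Prod.mk.injEq] at hqr ⊢
    omega
  have hprod := (summable_mul_of_summable_norm hd ha).comp_injective hinj
  simpa only [Function.comp_def] using hprod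

theorem tsum_tsum_comp_sub_two_mul_mul (hd : Summable fun k => ‖d k‖)
    (ha : Summable fun k => ‖a k‖) :
    ∑' k : ℤ, ∑' l : ℤ, d (l - 2 * k) * a l = ∑' l : ℤ, (∑' k : ℤ, d (l - 2 * k)) * a l := by
  simp_rw [← tsum_mul_right]
  exact (summable_prod_comp_sub_two_mul_mul hd ha).tsum_comm
    (f := fun l k => d (l - 2 * k) * a l)

theorem summable_norm_comp_sub_two_mul_mul (hd : Summable fun k => ‖d k‖)
    (ha : Summable fun k => ‖a k‖) (k : ℤ) : Summable fun l : ℤ => ‖d (l - 2 * k) * a l‖ :=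
  (summable_prod_comp_sub_two_mul_mul hd ha).norm.comp_injective
    (i := fun l : ℤ => (l, k)) fun _ _ h => (Prod.mk.inj h).1

theorem summable_filtered_mul_conj_filtered (hd : Summable fun k => ‖d k‖)
    (ha : Summable fun k => ‖a k‖) (hb : Summable fun k => ‖b k‖) :
    Summable fun q : (ℤ × ℤ) × ℤ => a q.1.1 * conj (b q.1.2) *
      (d (q.1.1 - 2 * q.2) * conj (d (q.1.2 - 2 * q.2))) := by
  have hinj : Function.Injective fun q : (ℤ × ℤ) × ℤ => (q.1, q.1.1 - 2 * q.2) := by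
    rintro ⟨q, i⟩ ⟨r, j⟩ hqr
    simp only [Prod.mk.injEq] at hqr ⊢
    exact ⟨hqr.1, by rw [hqr.1] at hqr; omega⟩
  have habd := ((ha.mul_of_nonneg hb (fun _ => norm_nonneg _) fun _ => norm_nonneg _).mul_of_nonneg
    hd (fun _ => by positivity) fun _ => norm_nonneg _).comp_injective hinj
  refine Summable.of_norm_bounded (habd.mul_right (∑' k, ‖d k‖)) fun q => ?_
  simp only [norm_mul, RCLike.norm_conj, Function.comp_apply, ← mul_assoc]
  gcongr
  exact hd.le_tsum (q.1.2 - 2 * q.2) fun _ _ => norm_nonneg _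

theorem tsum_filtered_mul_conj_filtered (hd : Summable fun k => ‖d k‖)
    (ha : Summable fun k => ‖a k‖) (hb : Summable fun k => ‖b k‖) :
    ∑' k : ℤ, (∑' l : ℤ, d (l - 2 * k) * a l) * conj (∑' l : ℤ, d (l - 2 * k) * b l) =
      ∑' q : ℤ × ℤ, a q.1 * conj (b q.2) *
        ∑' k : ℤ, d (q.1 - 2 * k) * conj (d (q.2 - 2 * k)) := by
  have hprod (k : ℤ) : (∑' l : ℤ, d (l - 2 * k) * a l) * conj (∑' l : ℤ, d (l - 2 * k) * b l) =
      ∑' q : ℤ × ℤ, a q.1 * conj (b q.2) * (d (q.1 - 2 * k) * conj (d (q.2 - 2 * k))) := by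
    rw [Complex.conj_tsum, tsum_mul_tsum_of_summable_norm
      (summable_norm_comp_sub_two_mul_mul hd ha k)
      (by simpa only [RCLike.norm_conj] using summable_norm_comp_sub_two_mul_mul hd hb k)]
    congr 1 with q
    simp only [map_mul]
    ring
  simp_rw [hprod, ← tsum_mul_left]
  exact (summable_filtered_mul_conj_filtered hd ha hb).tsum_comm (f := fun (q : ℤ × ℤ) k =>
    a q.1 * conj (b q.2) * (d (q.1 - 2 * k) * conj (d (q.2 - 2 * k))))

theorem waveCoeff_mul_conj_waveCoeff (h : ℤ → ℂ) (l m : ℤ) :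
    waveCoeff h l * conj (waveCoeff h m) =
      (-1) ^ (l + m) * (h (1 - m) * conj (h (1 - l))) := by
  have hsign : (-1 : ℂ) ^ (1 - l) * (-1) ^ (1 - m) = (-1) ^ (l + m) := by
    have hexp : 1 - l + (1 - m) = l + m + 2 * (1 - l - m) := by ring
    rw [← zpow_add₀ (by norm_num), hexp, zpow_add₀ (by norm_num), zpow_mul]
    simp
  simp only [waveCoeff, map_mul, map_zpow₀, map_neg, map_one, Complex.conj_conj, ← hsign]
  ring

namespace IsQuadratureFilter

theorem tsum_mul_conj_comp_add_two_mul (hh : IsQuadratureFilter h) (k : ℤ) :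
    ∑' l : ℤ, h l * conj (h (l + 2 * k)) = if k = 0 then 1 / 2 else 0 := by
  have hconj := congrArg conj (hh.tsum_mul_conj k)
  simp only [Complex.conj_tsum, map_mul, Complex.conj_conj, mul_comm (conj _)] at hconj
  rw [hconj]
  split_ifs <;> simp only [map_zero, map_div₀, map_one, map_ofNat]

/- Both sums run over a parity class of `j ↦ h j * conj (h (j + m - l))`: the classes are
complementary and the signs agree if `l - m` is even, otherwise the two sums cancel. -/
theorem tsum_mul_conj_add_tsum_waveCoeff_mul_conj (hh : IsQuadratureFilter h) (l m : ℤ) :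
    ∑' k : ℤ, h (l - 2 * k) * conj (h (m - 2 * k)) +
      ∑' k : ℤ, waveCoeff h (l - 2 * k) * conj (waveCoeff h (m - 2 * k)) =
    if l = m then 1 / 2 else 0 := by
  let B : ℤ → ℂ := fun j => h j * conj (h (j + (m - l)))
  have hB : Summable B := summable_mul_conj_comp_add hh.summable_norm hh.summable_norm (m - l)
  have hlow : ∑' k : ℤ, h (l - 2 * k) * conj (h (m - 2 * k)) = ∑' k : ℤ, B (l - 2 * k) := by
    congr! 5 with k
    ring
  have hhigh : ∑' k : ℤ, waveCoeff h (l - 2 * k) * conj (waveCoeff h (m - 2 * k)) =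
      (-1) ^ (l + m) * ∑' k : ℤ, B (1 - m - 2 * k) := by
    rw [← (Equiv.neg ℤ).tsum_eq fun k => B (1 - m - 2 * k), ← tsum_mul_left]
    congr 1 with k
    have hexp : l - 2 * k + (m - 2 * k) = l + m + 2 * (-2 * k) := by ring
    rw [waveCoeff_mul_conj_waveCoeff, hexp, zpow_add₀ (by norm_num), zpow_mul]
    simp only [B, Equiv.neg_apply, even_two, Even.neg_pow, one_pow, one_zpow, mul_one, zpow_ofNat]
    have hl : 1 - m - 2 * -k + (m - l) = 1 - (l - 2 * k) := by ring
    have hm : 1 - m - 2 * -k = 1 - (m - 2 * k) := by ring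
    rw [hl, hm]
  rw [hlow, hhigh]
  rcases Int.even_or_odd' (l - m) with ⟨r, hr | hr⟩
  · have hsign : Even (l + m) := ⟨m + r, by omega⟩
    rw [hsign.neg_one_zpow, one_mul, tsum_comp_sub_two_mul_add hB ⟨m + r - 1, by omega⟩]
    have hshift : m - l = 2 * -r := by omega
    simp only [B, hshift, hh.tsum_mul_conj_comp_add_two_mul]
    congr 1
    exact propext (by omega)
  · have hsign : Odd (l + m) := ⟨m + r, by omega⟩
    rw [hsign.neg_one_zpow, if_neg (by omega),
      tsum_comp_sub_two_mul_congr (l := 1 - m) (m := l) B ⟨-(m + r), by omega⟩]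
    ring

theorem tsum_filtered_mul_conj_filtered_add (hh : IsQuadratureFilter h)
    (ha : Summable fun k => ‖a k‖) (hb : Summable fun k => ‖b k‖) :
    ∑' k : ℤ, (∑' l : ℤ, h (l - 2 * k) * a l) * conj (∑' l : ℤ, h (l - 2 * k) * b l) +
      ∑' k : ℤ, (∑' l : ℤ, waveCoeff h (l - 2 * k) * a l) *
        conj (∑' l : ℤ, waveCoeff h (l - 2 * k) * b l) =
    1 / 2 * ∑' l : ℤ, a l * conj (b l) := by
  have hsummable {d : ℤ → ℂ} (hd : Summable fun k => ‖d k‖) :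
      Summable fun q : ℤ × ℤ => a q.1 * conj (b q.2) *
        ∑' k : ℤ, d (q.1 - 2 * k) * conj (d (q.2 - 2 * k)) := by
    simpa only [tsum_mul_left] using (summable_filtered_mul_conj_filtered hd ha hb).prod
  have hwave := summable_norm_waveCoeff hh.summable_norm
  have hinj : Function.Injective fun l : ℤ => (l, l) := fun i j hij => (Prod.mk.inj hij).1
  have hdiag : Function.support (fun q : ℤ × ℤ =>
      a q.1 * conj (b q.2) * if q.1 = q.2 then (1 / 2 : ℂ) else 0) ⊆
      Set.range fun l : ℤ => (l, l) := by
    rintro ⟨i, j⟩ hij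
    have hij' : i = j := by
      by_contra hne
      simp [hne] at hij
    exact ⟨i, by rw [hij']⟩
  rw [tsum_filtered_mul_conj_filtered hh.summable_norm ha hb,
    tsum_filtered_mul_conj_filtered hwave ha hb,
    ← (hsummable hh.summable_norm).tsum_add (hsummable hwave)]
  simp_rw [← mul_add, hh.tsum_mul_conj_add_tsum_waveCoeff_mul_conj]
  rw [← hinj.tsum_eq hdiag]
  simp only [if_true, mul_comm _ (1 / 2 : ℂ), tsum_mul_left]

/- The sums `E`, `O` over the two parity classes satisfy `E + O = 1` and `|E|² + |O|² = 1 / 2`,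
which forces `|E - O|² = 0`. -/
theorem tsum_comp_sub_two_mul (hh : IsQuadratureFilter h) (hone : ∑' k, h k = 1) (l : ℤ) :
    ∑' k : ℤ, h (l - 2 * k) = 1 / 2 := by
  let σ : ℤ → ℂ := fun l => ∑' k : ℤ, h (l - 2 * k)
  have hparity (i j : ℤ) : σ (i - 2 * j) = σ i :=
    tsum_comp_sub_two_mul_congr h ⟨-j, by ring⟩
  have hadd : σ l + σ (l + 1) = 1 := by
    rw [← hone]
    exact tsum_comp_sub_two_mul_add hh.summable_norm.of_norm ⟨-1, by ring⟩
  have hconj : Summable fun k => ‖conj (h k)‖ := by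
    simpa only [RCLike.norm_conj] using hh.summable_norm
  have hsq : σ l * conj (σ l) + σ (l + 1) * conj (σ (l + 1)) = 1 / 2 := by
    calc σ l * conj (σ l) + σ (l + 1) * conj (σ (l + 1))
        = ∑' k : ℤ, σ (l - 2 * k) * conj (h (l - 2 * k)) +
            ∑' k : ℤ, σ (l + 1 - 2 * k) * conj (h (l + 1 - 2 * k)) := by
          simp only [hparity, tsum_mul_left, ← Complex.conj_tsum, σ]
      _ = ∑' i : ℤ, σ i * conj (h i) :=
          tsum_comp_sub_two_mul_add (B := fun i => σ i * conj (h i))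
            (by simpa only [tsum_mul_right] using
              (summable_prod_comp_sub_two_mul_mul hh.summable_norm hconj).prod) ⟨-1, by ring⟩
      _ = ∑' k : ℤ, ∑' i : ℤ, h (i + 2 * -k) * conj (h i) := by
          simp only [mul_neg, ← sub_eq_add_neg]
          exact (tsum_tsum_comp_sub_two_mul_mul hh.summable_norm hconj).symm
      _ = 1 / 2 := by simp only [hh.tsum_mul_conj, neg_eq_zero, tsum_ite_eq]
  have hsub : (σ l - σ (l + 1)) * conj (σ l - σ (l + 1)) = 0 := by
    have hconj_add := congrArg conj hadd
    rw [map_add, map_one] at hconj_add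
    rw [map_sub]
    linear_combination 2 * hsq - (conj (σ l) + conj (σ (l + 1))) * hadd - hconj_add
  rw [Complex.mul_conj, Complex.ofReal_eq_zero, Complex.normSq_eq_zero] at hsub
  change σ l = 1 / 2
  linear_combination (hadd + hsub) / 2

end IsQuadratureFilter

end Filter

/-! ### Reproducing kernels -/

/-- The kernel of the projection onto the span of the integer translates of `g`, when these are
orthonormal. -/
noncomputable def kernel (g : ℝ → ℂ) (x y : ℝ) : ℂ := ∑' k : ℤ, g (x - k) * conj (g (y - k))

section Kernel

variable {fw m₀ mw g : ℝ → ℂ} {Φ : ℝ → ℝ}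

theorem twoScale_sub_intCast (d : ℤ → ℂ) (g : ℝ → ℂ) (x : ℝ) (k : ℤ) :
    twoScale d g (x - k) = 2 * ∑' l : ℤ, d (l - 2 * k) * g (2 * x - l) := by
  rw [twoScale, ← (Equiv.subRight (2 * k)).tsum_eq]
  congr 2 with l
  simp only [Equiv.subRight_apply]
  congr 2
  push_cast
  ring

theorem kernel_twoScale (d : ℤ → ℂ) (g : ℝ → ℂ) (x y : ℝ) :
    kernel (twoScale d g) x y = 4 * ∑' k : ℤ, (∑' l : ℤ, d (l - 2 * k) * g (2 * x - l)) *
      conj (∑' l : ℤ, d (l - 2 * k) * g (2 * y - l)) := by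
  rw [kernel, ← tsum_mul_left]
  congr 1 with k
  rw [twoScale_sub_intCast, twoScale_sub_intCast, map_mul, map_ofNat]
  ring

theorem IsFWavelet.isQuadratureFilter_maskCoeff (hfw : IsFWavelet fw m₀) (hS : AssumptionS fw Φ)
    (hc : Continuous fw) : IsQuadratureFilter (maskCoeff fw) where
  summable_norm := hS.summable_norm_maskCoeff hc
  tsum_mul_conj k := (hfw.hasSum_maskCoeff_mul_conj hS hc k).tsum_eq

theorem IsMWavelet.kernel_add_kernel (hmw : IsMWavelet fw m₀ mw) (hmc : Continuous mw)
    (hfw : IsFWavelet fw m₀) (hS : AssumptionS fw Φ) (hc : Continuous fw) (x y : ℝ) :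
    kernel fw x y + kernel mw x y = 2 * kernel fw (2 * x) (2 * y) := by
  have hfilter := (hfw.isQuadratureFilter_maskCoeff hS hc).tsum_filtered_mul_conj_filtered_add
    (hS.summable_norm hc (2 * x)) (hS.summable_norm hc (2 * y))
  have hlow := kernel_twoScale (maskCoeff fw) fw x y
  have hhigh := kernel_twoScale (waveCoeff (maskCoeff fw)) fw x y
  rw [← hfw.eq_twoScale hS hc] at hlow
  rw [← hmw.eq_twoScale hmc hfw hS hc] at hhigh
  rw [hlow, hhigh, ← mul_add, hfilter, kernel]
  ring

theorem AssumptionS.enorm_kernel_le (hS : AssumptionS g Φ) (hg : Continuous g) (x y : ℝ) :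
    ‖kernel g x y‖ₑ ≤ ENNReal.ofReal (2 * constC Φ * Φ (|x - y| / 2)) :=
  calc ‖kernel g x y‖ₑ ≤ ∑' k : ℤ, ‖g (x - k) * conj (g (y - k))‖ₑ := enorm_tsum_le_tsum_enorm
    _ = ∑' k : ℤ, ‖g (x - k)‖ₑ * ‖g (y - k)‖ₑ := by simp only [enorm_mul, RCLike.enorm_conj]
    _ ≤ _ := hS.tsum_enorm_mul_enorm_le hg x y

/-! ### Partition of unity -/

theorem AssumptionS.summable_majorant (hS : AssumptionS g Φ) (x : ℝ) :
    Summable fun k : ℤ => Φ |x - k| := by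
  have hfin := (hS.tsum_majorant_le x).trans_lt ENNReal.ofReal_lt_top
  simpa only [ENNReal.toReal_ofReal (hS.majorant_nonneg (abs_nonneg _))] using
    ENNReal.summable_toReal hfin.ne

theorem AssumptionS.majorant_abs_sub_intCast_le (hS : AssumptionS g Φ) {x : ℝ} (hx : |x| ≤ 1)
    (k : ℤ) : Φ |x - k| ≤ Φ |1 - (k : ℝ)| + Φ |-1 - (k : ℝ)| + Φ |0 - (k : ℝ)| := by
  obtain ⟨hx₁, hx₂⟩ := abs_le.1 hx
  have hanti {u v : ℝ} (huv : |u| ≤ |v|) : Φ |v| ≤ Φ |u| :=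
    hS.antitoneOn (abs_nonneg u) (abs_nonneg v) huv
  have hright := hS.majorant_nonneg (abs_nonneg (1 - (k : ℝ)))
  have hleft := hS.majorant_nonneg (abs_nonneg (-1 - (k : ℝ)))
  have hmid := hS.majorant_nonneg (abs_nonneg (0 - (k : ℝ)))
  rcases lt_trichotomy k 0 with hk | rfl | hk
  · have hk' : (k : ℝ) ≤ -1 := by exact_mod_cast Int.le_sub_one_of_lt hk
    have hle : Φ |x - k| ≤ Φ |-1 - (k : ℝ)| := hanti <| by
      rw [abs_of_nonneg (by linarith), abs_of_nonneg (by linarith)]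
      linarith
    linarith
  · have hle : Φ |x - (0 : ℤ)| ≤ Φ |0 - ((0 : ℤ) : ℝ)| := hanti (by simp)
    linarith
  · have hk' : (1 : ℝ) ≤ k := by exact_mod_cast hk
    have hle : Φ |x - k| ≤ Φ |1 - (k : ℝ)| := hanti <| by
      rw [abs_of_nonpos (by linarith), abs_of_nonpos (by linarith)]
      linarith
    linarith

theorem AssumptionS.continuousAt_zero_tsum_comp_sub_intCast (hS : AssumptionS g Φ)
    (hg : Continuous g) : ContinuousAt (fun x : ℝ => ∑' k : ℤ, g (x - k)) 0 := by
  have hcont : ContinuousOn (fun x : ℝ => ∑' k : ℤ, g (x - k)) (Set.Icc (-1) 1) :=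
    continuousOn_tsum (fun k => by fun_prop)
      (((hS.summable_majorant 1).add (hS.summable_majorant (-1))).add (hS.summable_majorant 0))
      fun k x hx => (hS.norm_le hg _).trans (hS.majorant_abs_sub_intCast_le (abs_le.2 hx) k)
  exact hcont.continuousAt (Icc_mem_nhds (by norm_num) one_pos)

namespace IsFWavelet

theorem tsum_comp_two_mul_sub_intCast (hfw : IsFWavelet fw m₀) (hS : AssumptionS fw Φ)
    (hc : Continuous fw) (x : ℝ) : ∑' k : ℤ, fw (2 * x - k) = ∑' k : ℤ, fw (x - k) := by
  have hh := hfw.isQuadratureFilter_maskCoeff hS hc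
  have hscale (k : ℤ) := congrFun (hfw.eq_twoScale hS hc) (x - k)
  simp only [twoScale_sub_intCast] at hscale
  simp_rw [hscale]
  rw [tsum_mul_left, tsum_tsum_comp_sub_two_mul_mul hh.summable_norm (hS.summable_norm hc (2 * x))]
  simp_rw [hh.tsum_comp_sub_two_mul (hfw.tsum_maskCoeff hS hc)]
  rw [tsum_mul_left]
  ring

/- The periodization `θ` satisfies `θ x = θ (2⁻ⁿ x)` for all `n` and is continuous at `0`. -/
theorem tsum_comp_sub_intCast_eq (hfw : IsFWavelet fw m₀) (hS : AssumptionS fw Φ)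
    (hc : Continuous fw) (x : ℝ) : ∑' k : ℤ, fw (x - k) = ∑' k : ℤ, fw (0 - k) := by
  set θ : ℝ → ℂ := fun x => ∑' k : ℤ, fw (x - k)
  have hhalf (n : ℕ) : θ (x * (1 / 2) ^ n) = θ x := by
    induction n with
    | zero => rw [pow_zero, mul_one]
    | succ n ih =>
      have hdouble : 2 * (x * (1 / 2) ^ (n + 1)) = x * (1 / 2) ^ n := by ring
      rw [← ih, ← hdouble]
      exact (hfw.tsum_comp_two_mul_sub_intCast hS hc _).symm
  have hpow : Tendsto (fun n : ℕ => x * (1 / 2 : ℝ) ^ n) atTop (𝓝 0) := by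
    simpa only [mul_zero] using (tendsto_pow_atTop_nhds_zero_of_lt_one (r := (1 / 2 : ℝ))
      (by norm_num) (by norm_num)).const_mul x
  have hlim := (hS.continuousAt_zero_tsum_comp_sub_intCast hc).tendsto.comp hpow
  exact tendsto_nhds_unique (tendsto_const_nhds.congr fun n => (hhalf n).symm) hlim

theorem tsum_comp_sub_intCast_mul_conj_integral (hfw : IsFWavelet fw m₀) (hS : AssumptionS fw Φ)
    (hc : Continuous fw) (x : ℝ) : (∑' k : ℤ, fw (x - k)) * conj (∫ z, fw z) = 1 := by
  have hfubini := integral_tsum (μ := (volume : Measure ℝ))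
    (f := fun (k : ℤ) z => fw z * conj (fw (1 * z - k)))
    (fun k => (hc.mul (Complex.continuous_conj.comp (by fun_prop))).aestronglyMeasurable)
    (hS.tsum_lintegral_enorm_mul_conj_lt_top hc (hS.integrable_self hc) 1).ne
  simp only [one_mul, hfw.integral_mul_conj_comp_sub_intCast hS hc, tsum_mul_left,
    ← Complex.conj_tsum, hfw.tsum_comp_sub_intCast_eq hS hc, tsum_ite_eq,
    integral_mul_const] at hfubini
  rw [hfw.tsum_comp_sub_intCast_eq hS hc x, mul_comm]
  simpa only [map_mul, Complex.conj_conj, map_one] using congrArg conj hfubini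

end IsFWavelet

theorem AssumptionS.tsum_lintegral_enorm_kernel_lt_top (hS : AssumptionS g Φ) (hg : Continuous g)
    (x : ℝ) : ∑' k : ℤ, ∫⁻ y : ℝ, ‖g (x - k) * conj (g (y - k))‖ₑ < ∞ := by
  have htranslate (k : ℤ) : ∫⁻ y : ℝ, ‖g (x - k) * conj (g (y - k))‖ₑ =
      ‖g (x - k)‖ₑ * ∫⁻ y, ‖g y‖ₑ := by
    simp only [enorm_mul, RCLike.enorm_conj]
    rw [lintegral_const_mul' _ _ enorm_ne_top,
      lintegral_sub_right_eq_self (fun y => ‖g y‖ₑ) (k : ℝ)]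
  simp_rw [htranslate]
  rw [ENNReal.tsum_mul_right]
  exact ENNReal.mul_lt_top ((hS.tsum_enorm_le hg x).trans_lt ENNReal.ofReal_lt_top)
    (hS.integrable_self hg).2

theorem IsFWavelet.integral_kernel (hfw : IsFWavelet fw m₀) (hS : AssumptionS fw Φ)
    (hc : Continuous fw) (x : ℝ) : ∫ y, kernel fw x y = 1 := by
  have hmeas (k : ℤ) : AEStronglyMeasurable fun y : ℝ => fw (x - k) * conj (fw (y - k)) :=
    (continuous_const.mul (Complex.continuous_conj.comp (by fun_prop))).aestronglyMeasurable
  simp only [kernel]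
  rw [integral_tsum hmeas (hS.tsum_lintegral_enorm_kernel_lt_top hc x).ne,
    ← hfw.tsum_comp_sub_intCast_mul_conj_integral hS hc x, ← tsum_mul_right]
  congr 1 with k
  rw [integral_const_mul, integral_conj, integral_sub_right_eq_self fw (k : ℝ)]

end Kernel

/-! ### Growth functions -/

/-- The functions dominating the size of the process. The doubling condition at infinity is the case
`a = 2` of the bound `c (a * x) ≤ c x * A a`. -/
structure IsGrowthFunction (c : ℝ → ℝ) : Prop where
  even : ∀ x, c (-x) = c x
  monotoneOn : MonotoneOn c (Set.Ici 0)
  nonneg_zero : 0 ≤ c 0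
  doubling : (fun x => c (2 * x)) =O[atTop] c

theorem AssumptionS.integrable_majorant_half {g : ℝ → ℂ} {Φ : ℝ → ℝ} (hS : AssumptionS g Φ) :
    Integrable fun u : ℝ => Φ (|u| / 2) := by
  simpa only [abs_div, abs_two] using hS.integrable.comp_div (two_ne_zero' ℝ)

namespace IsGrowthFunction

variable {c Φ : ℝ → ℝ} {g : ℝ → ℂ}

theorem comp_abs (hc : IsGrowthFunction c) (x : ℝ) : c |x| = c x := by
  rcases abs_choice x with h | h <;> rw [h]
  exact hc.even x

theorem le_of_abs_le (hc : IsGrowthFunction c) {x y : ℝ} (h : |x| ≤ |y|) : c x ≤ c y := by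
  rw [← hc.comp_abs x, ← hc.comp_abs y]
  exact hc.monotoneOn (abs_nonneg x) (abs_nonneg y) h

theorem nonneg (hc : IsGrowthFunction c) (x : ℝ) : 0 ≤ c x :=
  hc.nonneg_zero.trans (hc.le_of_abs_le (abs_zero.trans_le (abs_nonneg x)))

theorem of_comp_two_mul_le {A x₀ : ℝ} (heven : ∀ x, c (-x) = c x)
    (hmono : MonotoneOn c (Set.Ici 0)) (hzero : 0 ≤ c 0)
    (hA : ∀ x, x₀ ≤ x → c (2 * x) ≤ c x * A) : IsGrowthFunction c := by
  have hnonneg {x : ℝ} (hx : 0 ≤ x) : 0 ≤ c x := hzero.trans (hmono Set.self_mem_Ici hx hx)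
  refine ⟨heven, hmono, hzero, Asymptotics.IsBigO.of_bound A ?_⟩
  filter_upwards [eventually_ge_atTop x₀, eventually_ge_atTop 0] with x hx hx0
  rw [Real.norm_of_nonneg (hnonneg (mul_nonneg two_pos.le hx0)), Real.norm_of_nonneg (hnonneg hx0),
    mul_comm A]
  exact hA x hx

theorem measurable (hc : IsGrowthFunction c) : Measurable c := by
  have hmono : Monotone fun x => c (max x 0) := fun x y hxy =>
    hc.monotoneOn (le_max_right x 0) (le_max_right y 0) (max_le_max_right 0 hxy)
  have hfactor : c = (fun x => c (max x 0)) ∘ fun x => |x| := by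
    ext x
    simp only [Function.comp_apply, max_eq_left (abs_nonneg x), hc.comp_abs]
  rw [hfactor]
  exact hmono.measurable.comp measurable_norm

theorem add_mul_le (hc : IsGrowthFunction c) (t u : ℝ) {r : ℝ} (hr : |r| ≤ 1) :
    c (t + r * u) ≤ c (2 * t) + c (2 * u) := by
  have habs : |t + r * u| ≤ |t| + |u| := (abs_add_le _ _).trans <| by
    rw [abs_mul]
    gcongr
    exact mul_le_of_le_one_left (abs_nonneg u) hr
  rcases le_total |t| |u| with h | h
  · refine le_add_of_nonneg_of_le (hc.nonneg _) (hc.le_of_abs_le ?_)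
    rw [abs_mul, abs_two]
    linarith
  · refine le_add_of_le_of_nonneg (hc.le_of_abs_le ?_) (hc.nonneg _)
    rw [abs_mul, abs_two]
    linarith

theorem exists_comp_four_mul_le (hc : IsGrowthFunction c) :
    ∃ K M : ℝ, ∀ x, c (4 * x) ≤ K * c x + M := by
  have hdouble : Tendsto (fun x : ℝ => 2 * x) atTop atTop := tendsto_id.const_mul_atTop two_pos
  obtain ⟨K, hK, hbound⟩ := ((hc.doubling.comp_tendsto hdouble).trans hc.doubling).exists_pos
  obtain ⟨x₀, hx₀⟩ := eventually_atTop.1 hbound.bound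
  refine ⟨K, c (4 * x₀), fun x => ?_⟩
  rcases le_total x₀ |x| with h | h
  · refine le_add_of_le_of_nonneg ?_ (hc.nonneg _)
    have hle := hx₀ |x| h
    simp only [Function.comp_apply, Real.norm_of_nonneg (hc.nonneg _), hc.comp_abs] at hle
    refine (hc.le_of_abs_le (le_of_eq ?_)).trans hle
    rw [← mul_assoc, abs_mul, abs_mul, abs_abs]
    norm_num
  · refine le_add_of_nonneg_of_le (mul_nonneg hK.le (hc.nonneg x)) (hc.le_of_abs_le ?_)
    rw [abs_mul, abs_mul]
    exact mul_le_mul_of_nonneg_left (h.trans (le_abs_self x₀)) (abs_nonneg _)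

theorem integrable_majorant_half_mul (hc : IsGrowthFunction c) (hS : AssumptionS g Φ)
    (hcΦ : Integrable fun x : ℝ => c x * Φ |x|) (b : ℝ) :
    Integrable fun u : ℝ => Φ (|u| / 2) * (b + c (2 * u)) := by
  obtain ⟨K, M, hKM⟩ := hc.exists_comp_four_mul_le
  have hfour : Integrable fun x : ℝ => Φ |x| * c (4 * x) := by
    refine ((hcΦ.const_mul K).add (hS.integrable.mul_const M)).mono'
      (hS.integrable.aestronglyMeasurable.mul
        (hc.measurable.comp (measurable_const_mul 4)).aestronglyMeasurable) (.of_forall fun x => ?_)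
    have hΦ := hS.majorant_nonneg (abs_nonneg x)
    rw [Real.norm_of_nonneg (mul_nonneg hΦ (hc.nonneg _))]
    calc Φ |x| * c (4 * x) ≤ Φ |x| * (K * c x + M) := by gcongr; exact hKM x
      _ = K * (c x * Φ |x|) + Φ |x| * M := by ring
  have hhalf : Integrable fun u : ℝ => Φ (|u| / 2) * c (2 * u) := by
    refine (hfour.comp_div (two_ne_zero' ℝ)).congr (.of_forall fun u => ?_)
    have hu : 4 * (u / 2) = 2 * u := by ring
    simp only [hu, abs_div, abs_two]
  simp only [mul_add]
  exact (hS.integrable_majorant_half.mul_const b).add hhalf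

theorem integrable_majorant_dilated_mul (hc : IsGrowthFunction c) (hS : AssumptionS g Φ)
    (hcΦ : Integrable fun x : ℝ => c x * Φ |x|) (t : ℝ) {r : ℝ} (hr : 1 ≤ r) :
    Integrable fun s : ℝ => Φ (|r * t - r * s| / 2) * c s := by
  have hscale (s : ℝ) : |s - t| / 2 ≤ |r * t - r * s| / 2 := by
    rw [← mul_sub, abs_mul, abs_sub_comm t s]
    gcongr
    exact le_mul_of_one_le_left (abs_nonneg _) (hr.trans (le_abs_self r))
  have hmeas : AEStronglyMeasurable (fun s : ℝ => Φ (|r * t - r * s| / 2)) volume := by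
    simpa only [← mul_sub] using ((hS.integrable_majorant_half.comp_mul_left'
      (one_pos.trans_le hr).ne').comp_sub_left t).aestronglyMeasurable
  refine ((hc.integrable_majorant_half_mul hS hcΦ (c (2 * t))).comp_sub_right t).mono'
    (hmeas.mul hc.measurable.aestronglyMeasurable) (.of_forall fun s => ?_)
  have hΦ : 0 ≤ Φ (|r * t - r * s| / 2) := hS.majorant_nonneg (by positivity)
  have hcs := hc.add_mul_le t (s - t) (r := 1) abs_one.le
  rw [one_mul, add_sub_cancel] at hcs
  rw [Real.norm_of_nonneg (mul_nonneg hΦ (hc.nonneg s))]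
  exact mul_le_mul (hS.antitoneOn (Set.mem_Ici.2 (by positivity)) (Set.mem_Ici.2 (by positivity))
    (hscale s)) hcs (hc.nonneg s) (hS.majorant_nonneg (by positivity))

end IsGrowthFunction

/-! ### Wavelet expansions of vector-valued functions -/

theorem enorm_sum_sub_le_of_hasSum {ι E : Type*} [DecidableEq ι] [NormedAddCommGroup E]
    {f : ι → E} {a : E} (hf : HasSum f a) (s : Finset ι) :
    ‖∑ i ∈ s, f i - a‖ₑ ≤ ∑' i, if i ∈ s then 0 else ‖f i‖ₑ := by
  have hrest : HasSum (fun i => if i ∈ s then 0 else f i) (a - ∑ i ∈ s, f i) := by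
    have hfinite := hasSum_sum_of_ne_finset_zero (f := fun i => if i ∈ s then f i else 0)
      (L := .unconditional ι) fun i (hi : i ∉ s) => if_neg hi
    rw [Finset.sum_congr rfl fun i hi => if_pos hi] at hfinite
    refine (hf.sub hfinite).congr_fun fun i => ?_
    split_ifs <;> simp only [sub_self, sub_zero]
  rw [← enorm_neg, neg_sub, ← hrest.tsum_eq]
  refine enorm_tsum_le_tsum_enorm.trans (ENNReal.tsum_le_tsum fun i => ?_)
  split_ifs <;> simp only [enorm_zero, le_refl]

theorem hasSum_integral_of_tsum_lintegral_ne_top {α ι E : Type*} [MeasurableSpace α] {μ : Measure α}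
    [Countable ι] [NormedAddCommGroup E] [NormedSpace ℝ E] [CompleteSpace E] {F : ι → α → E}
    (hF : ∀ i, AEStronglyMeasurable (F i) μ) (hfin : ∑' i, ∫⁻ a, ‖F i a‖ₑ ∂μ ≠ ∞) :
    HasSum (fun i => ∫ a, F i a ∂μ) (∫ a, ∑' i, F i a ∂μ) := by
  rw [integral_tsum hF hfin]
  refine (Summable.of_norm (tsum_enorm_ne_top_iff_summable_norm.1 ?_)).hasSum
  exact ne_top_of_le_ne_top hfin
    (ENNReal.tsum_le_tsum fun i => enorm_integral_le_lintegral_enorm _)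

/-- The wavelets `fw` and `mw` are continuous and `Φf`, `Φm` are majorants of them, in the sense of
Assumption S. -/
structure IsWaveletPair (fw mw m₀ : ℝ → ℂ) (Φf Φm : ℝ → ℝ) : Prop where
  isFWavelet : IsFWavelet fw m₀
  isMWavelet : IsMWavelet fw m₀ mw
  continuous_fw : Continuous fw
  continuous_mw : Continuous mw
  majorant_fw : AssumptionS fw Φf
  majorant_mw : AssumptionS mw Φm

section Dilate

variable {g : ℝ → ℂ}

theorem dilate_mul_conj_dilate (g : ℝ → ℂ) (j : ℕ) (k : ℤ) (t s : ℝ) :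
    dilate g j k t * conj (dilate g j k s) =
      2 ^ j * (g (2 ^ j * t - k) * conj (g (2 ^ j * s - k))) := by
  have hscale :
      (((2 : ℝ) ^ ((j : ℝ) / 2) : ℝ) : ℂ) * (((2 : ℝ) ^ ((j : ℝ) / 2) : ℝ) : ℂ) = 2 ^ j := by
    rw [← Complex.ofReal_mul, ← Real.rpow_add two_pos, add_halves, Real.rpow_natCast]
    push_cast
    rfl
  simp only [dilate, map_mul, Complex.conj_ofReal]
  rw [← hscale]
  ring

theorem continuous_dilate (hg : Continuous g) (j : ℕ) (k : ℤ) : Continuous (dilate g j k) := by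
  unfold dilate
  fun_prop

theorem enorm_dilate (g : ℝ → ℂ) (j : ℕ) (k : ℤ) (t : ℝ) :
    ‖dilate g j k t‖ₑ = ENNReal.ofReal ((2 : ℝ) ^ ((j : ℝ) / 2)) * ‖g (2 ^ j * t - k)‖ₑ := by
  rw [dilate, enorm_mul, ← ofReal_norm, Complex.norm_real, Real.norm_of_nonneg (by positivity)]

end Dilate

section Kernel

variable {fw m₀ g : ℝ → ℂ} {Φ : ℝ → ℝ}

theorem measurable_kernel (hg : Continuous g) (x : ℝ) : Measurable (kernel g x) :=
  Measurable.tsum fun k =>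
    (continuous_const.mul (Complex.continuous_conj.comp (by fun_prop))).measurable

theorem AssumptionS.norm_kernel_le (hS : AssumptionS g Φ) (hg : Continuous g) (x y : ℝ) :
    ‖kernel g x y‖ ≤ 2 * constC Φ * Φ (|x - y| / 2) := by
  have hC := hS.constC_nonneg
  have hΦ := hS.majorant_nonneg (show 0 ≤ |x - y| / 2 by positivity)
  have hle := hS.enorm_kernel_le hg x y
  rwa [← ofReal_norm, ENNReal.ofReal_le_ofReal_iff (by positivity)] at hle

theorem AssumptionS.norm_kernel_add_le (hS : AssumptionS g Φ) (hg : Continuous g) (x u : ℝ) :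
    ‖kernel g x (x + u)‖ ≤ 2 * constC Φ * Φ (|u| / 2) := by
  simpa only [sub_add_cancel_left, abs_neg] using hS.norm_kernel_le hg x (x + u)

theorem AssumptionS.integrable_kernel_add (hS : AssumptionS g Φ) (hg : Continuous g) (x : ℝ) :
    Integrable fun u : ℝ => kernel g x (x + u) :=
  (hS.integrable_majorant_half.const_mul _).mono'
    ((measurable_kernel hg x).comp (measurable_const_add x)).aestronglyMeasurable
    (.of_forall (hS.norm_kernel_add_le hg x))

theorem AssumptionS.hasSum_dilate_mul_conj (hS : AssumptionS g Φ) (hg : Continuous g) (j : ℕ)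
    (t s : ℝ) : HasSum (fun k : ℤ => dilate g j k t * conj (dilate g j k s))
      (2 ^ j * kernel g (2 ^ j * t) (2 ^ j * s)) := by
  have hfin : ∑' k : ℤ, ‖g (2 ^ j * t - k) * conj (g (2 ^ j * s - k))‖ₑ ≠ ∞ := by
    simp only [enorm_mul, RCLike.enorm_conj]
    exact ((hS.tsum_enorm_mul_enorm_le hg _ _).trans_lt ENNReal.ofReal_lt_top).ne
  simp_rw [dilate_mul_conj_dilate]
  exact (Summable.of_norm (tsum_enorm_ne_top_iff_summable_norm.1 hfin)).hasSum.mul_left _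

end Kernel

section Expansion

variable {E : Type*} [NormedAddCommGroup E] [NormedSpace ℂ E]
  {c Φ Φf Φm : ℝ → ℝ} {g fw mw m₀ : ℝ → ℂ} {Z : ℝ → E}

/-- The coefficient `∫ Z(r) conj(g(r)) dr` of a vector-valued function `Z`. -/
noncomputable def analysisCoeff (g : ℝ → ℂ) (Z : ℝ → E) : E := ∫ r : ℝ, conj (g r) • Z r

/-- The integral operator with kernel `2^j K(2^j t, 2^j s)`, where `K` is `kernel g`: it sums the
wavelet expansion of `Z` over all translates of `g` at level `j`. -/
noncomputable def levelProj (g : ℝ → ℂ) (Z : ℝ → E) (j : ℕ) (t : ℝ) : E :=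
  ∫ s : ℝ, ((2 : ℂ) ^ j * kernel g (2 ^ j * t) (2 ^ j * s)) • Z s

theorem integrable_levelProj (hc : IsGrowthFunction c) (hS : AssumptionS g Φ)
    (hcΦ : Integrable fun x : ℝ => c x * Φ |x|) (hg : Continuous g) (hZ : Continuous Z)
    (hZc : ∀ s, ‖Z s‖ ≤ c s) (j : ℕ) (t : ℝ) :
    Integrable fun s : ℝ => ((2 : ℂ) ^ j * kernel g (2 ^ j * t) (2 ^ j * s)) • Z s := by
  have hmajorant := hc.integrable_majorant_dilated_mul hS hcΦ t (one_le_pow₀ one_le_two (n := j))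
  refine (hmajorant.const_mul (2 ^ j * (2 * constC Φ))).mono' ?_ (.of_forall fun s => ?_)
  · exact (((measurable_kernel hg _).comp (measurable_const_mul _)).const_mul
      _).aestronglyMeasurable.smul hZ.aestronglyMeasurable
  · have hC := hS.constC_nonneg
    have hΦ := hS.majorant_nonneg (show 0 ≤ |2 ^ j * t - 2 ^ j * s| / 2 by positivity)
    rw [norm_smul, norm_mul, norm_pow, RCLike.norm_ofNat]
    calc 2 ^ j * ‖kernel g (2 ^ j * t) (2 ^ j * s)‖ * ‖Z s‖
        ≤ 2 ^ j * (2 * constC Φ * Φ (|2 ^ j * t - 2 ^ j * s| / 2)) * c s := by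
          gcongr
          exacts [hS.norm_kernel_le hg _ _, hZc s]
      _ = _ := by ring

theorem IsWaveletPair.levelProj_eq_add_sum (hW : IsWaveletPair fw mw m₀ Φf Φm)
    (hc : IsGrowthFunction c) (hcf : Integrable fun x : ℝ => c x * Φf |x|)
    (hcm : Integrable fun x : ℝ => c x * Φm |x|) (hZ : Continuous Z) (hZc : ∀ s, ‖Z s‖ ≤ c s)
    (n : ℕ) (t : ℝ) :
    levelProj fw Z n t = levelProj fw Z 0 t + ∑ j ∈ Finset.range n, levelProj mw Z j t := by
  have hsucc (j : ℕ) : levelProj fw Z (j + 1) t = levelProj fw Z j t + levelProj mw Z j t := by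
    simp only [levelProj]
    rw [← integral_add
      (integrable_levelProj hc hW.majorant_fw hcf hW.continuous_fw hZ hZc j t)
      (integrable_levelProj hc hW.majorant_mw hcm hW.continuous_mw hZ hZc j t)]
    congr 1 with s
    rw [← add_smul, ← mul_add, hW.isMWavelet.kernel_add_kernel hW.continuous_mw hW.isFWavelet
      hW.majorant_fw hW.continuous_fw, pow_succ (2 : ℂ), pow_succ' (2 : ℝ), mul_assoc (2 : ℝ),
      mul_assoc (2 : ℝ), mul_assoc (2 ^ j : ℂ)]
  induction n with
  | zero => rw [Finset.sum_range_zero, add_zero]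
  | succ n ih => rw [hsucc, ih, Finset.sum_range_succ, add_assoc]

theorem tsum_lintegral_enorm_dilate_smul_lt_top (hc : IsGrowthFunction c) (hS : AssumptionS g Φ)
    (hcΦ : Integrable fun x : ℝ => c x * Φ |x|) (hg : Continuous g) (hZ : Continuous Z)
    (hZc : ∀ s, ‖Z s‖ ≤ c s) (j : ℕ) (t : ℝ) :
    ∑' k : ℤ, ∫⁻ s : ℝ, ‖(dilate g j k t * conj (dilate g j k s)) • Z s‖ₑ < ∞ := by
  have hC := hS.constC_nonneg
  have hmeas (k : ℤ) : Continuous fun s : ℝ => (dilate g j k t * conj (dilate g j k s)) • Z s :=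
    (continuous_const.mul (Complex.continuous_conj.comp (continuous_dilate hg j k))).smul hZ
  have hpointwise (s : ℝ) : ∑' k : ℤ, ‖(dilate g j k t * conj (dilate g j k s)) • Z s‖ₑ ≤
      2 ^ j * ENNReal.ofReal (2 * constC Φ) *
        ENNReal.ofReal (Φ (|2 ^ j * t - 2 ^ j * s| / 2) * c s) := by
    have hΦ := hS.majorant_nonneg (show 0 ≤ |2 ^ j * t - 2 ^ j * s| / 2 by positivity)
    simp only [enorm_smul, dilate_mul_conj_dilate, enorm_mul, enorm_pow, RCLike.enorm_conj]
    rw [ENNReal.tsum_mul_right, ENNReal.tsum_mul_left, ENNReal.ofReal_mul hΦ, ← mul_assoc,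
      mul_assoc (2 ^ j), ← ENNReal.ofReal_mul (by positivity), ← ofReal_norm (2 : ℂ),
      RCLike.norm_ofNat, ENNReal.ofReal_ofNat]
    gcongr
    · exact hS.tsum_enorm_mul_enorm_le hg _ _
    · exact (ofReal_norm (Z s)).ge.trans (ENNReal.ofReal_le_ofReal (hZc s))
  rw [← lintegral_tsum fun k => (hmeas k).enorm.measurable.aemeasurable]
  refine (lintegral_mono hpointwise).trans_lt ?_
  rw [lintegral_const_mul' _ _ (by finiteness)]
  exact ENNReal.mul_lt_top (by finiteness)
    (hc.integrable_majorant_dilated_mul hS hcΦ t (one_le_pow₀ one_le_two)).lintegral_lt_top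

theorem levelProj_eq_integral (g : ℝ → ℂ) (Z : ℝ → E) (n : ℕ) (t : ℝ) :
    levelProj g Z n t =
      ∫ u : ℝ, kernel g (2 ^ n * t) (2 ^ n * t + u) • Z (t + (1 / 2) ^ n * u) := by
  have hpow : (2 : ℝ) ^ n ≠ 0 := by positivity
  have hdilate := Measure.integral_comp_mul_left (fun u : ℝ =>
    kernel g (2 ^ n * t) (2 ^ n * t + u) • Z (t + (1 / 2) ^ n * u)) (2 ^ n)
  have htranslate := integral_sub_right_eq_self (μ := (volume : Measure ℝ)) (fun s : ℝ =>
    kernel g (2 ^ n * t) (2 ^ n * t + 2 ^ n * s) • Z (t + (1 / 2) ^ n * (2 ^ n * s))) t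
  rw [hdilate, abs_of_nonneg (by positivity), eq_inv_smul_iff₀ hpow] at htranslate
  rw [← htranslate, levelProj, ← integral_smul]
  congr 1 with s
  have hs : 2 ^ n * t + 2 ^ n * (s - t) = 2 ^ n * s := by ring
  rw [hs, ← Complex.coe_smul, smul_smul, one_div, inv_pow, inv_mul_cancel_left₀ hpow,
    add_sub_cancel]
  push_cast
  rfl

theorem aestronglyMeasurable_kernel_smul (hg : Continuous g) {F : ℝ → E} (hF : Continuous F)
    (x : ℝ) : AEStronglyMeasurable (fun u => kernel g x (x + u) • F u) volume :=
  ((measurable_kernel hg x).comp (measurable_const_add x)).aestronglyMeasurable.smul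
    hF.aestronglyMeasurable

theorem norm_kernel_smul_sub_le (hc : IsGrowthFunction c) (hS : AssumptionS g Φ)
    (hg : Continuous g) (hZc : ∀ s, ‖Z s‖ ≤ c s) (n : ℕ) (t u : ℝ) :
    ‖kernel g (2 ^ n * t) (2 ^ n * t + u) • (Z (t + (1 / 2) ^ n * u) - Z t)‖ ≤
      2 * constC Φ * (Φ (|u| / 2) * (c (2 * t) + c t + c (2 * u))) := by
  have hC := hS.constC_nonneg
  have hΦ := hS.majorant_nonneg (show 0 ≤ |u| / 2 by positivity)
  have hhalf : |(1 / 2 : ℝ) ^ n| ≤ 1 := by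
    rw [abs_of_nonneg (by positivity)]
    exact pow_le_one₀ one_half_pos.le one_half_lt_one.le
  have hdiff : ‖Z (t + (1 / 2) ^ n * u) - Z t‖ ≤ c (2 * t) + c t + c (2 * u) := by
    linarith [norm_sub_le (Z (t + (1 / 2) ^ n * u)) (Z t), hZc (t + (1 / 2) ^ n * u),
      hc.add_mul_le t u hhalf, hZc t]
  rw [norm_smul, ← mul_assoc]
  gcongr
  exact hS.norm_kernel_add_le hg _ u

variable [CompleteSpace E]

theorem hasSum_levelProj (hc : IsGrowthFunction c) (hS : AssumptionS g Φ)
    (hcΦ : Integrable fun x : ℝ => c x * Φ |x|) (hg : Continuous g) (hZ : Continuous Z)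
    (hZc : ∀ s, ‖Z s‖ ≤ c s) (j : ℕ) (t : ℝ) :
    HasSum (fun k : ℤ => dilate g j k t • analysisCoeff (dilate g j k) Z) (levelProj g Z j t) := by
  have hmeas (k : ℤ) : Continuous fun s : ℝ => (dilate g j k t * conj (dilate g j k s)) • Z s :=
    (continuous_const.mul (Complex.continuous_conj.comp (continuous_dilate hg j k))).smul hZ
  have hsum := hasSum_integral_of_tsum_lintegral_ne_top (fun k => (hmeas k).aestronglyMeasurable)
    (tsum_lintegral_enorm_dilate_smul_lt_top hc hS hcΦ hg hZ hZc j t).ne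
  simp only [((hS.hasSum_dilate_mul_conj hg j t _).smul_const (Z _)).tsum_eq] at hsum
  refine hsum.congr_fun fun k => ?_
  simp only [analysisCoeff, mul_smul, integral_smul]

/-- As the reproducing kernel of the f-wavelet integrates to `1`, the level-`n` projection is an
average of the values of `Z` near `t`. -/
theorem levelProj_sub_eq (hc : IsGrowthFunction c) (hfw : IsFWavelet fw m₀)
    (hS : AssumptionS fw Φ) (hcΦ : Integrable fun x : ℝ => c x * Φ |x|) (hg : Continuous fw)
    (hZ : Continuous Z) (hZc : ∀ s, ‖Z s‖ ≤ c s) (n : ℕ) (t : ℝ) :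
    levelProj fw Z n t - Z t =
      ∫ u : ℝ, kernel fw (2 ^ n * t) (2 ^ n * t + u) • (Z (t + (1 / 2) ^ n * u) - Z t) := by
  have hconst : ∫ u : ℝ, kernel fw (2 ^ n * t) (2 ^ n * t + u) • Z t = Z t := by
    rw [integral_smul_const, integral_add_left_eq_self (fun y => kernel fw (2 ^ n * t) y),
      hfw.integral_kernel hS hg, one_smul]
  have hdiff : Integrable fun u : ℝ =>
      kernel fw (2 ^ n * t) (2 ^ n * t + u) • (Z (t + (1 / 2) ^ n * u) - Z t) :=
    ((hc.integrable_majorant_half_mul hS hcΦ (c (2 * t) + c t)).const_mul (2 * constC Φ)).mono'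
      (aestronglyMeasurable_kernel_smul hg (by fun_prop) _)
      (.of_forall fun u => norm_kernel_smul_sub_le hc hS hg hZc n t u)
  have hadd := integral_add hdiff ((hS.integrable_kernel_add hg (2 ^ n * t)).smul_const (Z t))
  simp only [← smul_add, sub_add_cancel] at hadd
  rw [levelProj_eq_integral, sub_eq_iff_eq_add, hadd, hconst]

theorem tendsto_levelProj (hc : IsGrowthFunction c) (hfw : IsFWavelet fw m₀)
    (hS : AssumptionS fw Φ) (hcΦ : Integrable fun x : ℝ => c x * Φ |x|) (hg : Continuous fw)
    (hZ : Continuous Z) (hZc : ∀ s, ‖Z s‖ ≤ c s) (t : ℝ) :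
    Tendsto (fun n => levelProj fw Z n t) atTop (𝓝 (Z t)) := by
  rw [← tendsto_sub_nhds_zero_iff]
  simp only [levelProj_sub_eq hc hfw hS hcΦ hg hZ hZc]
  rw [← integral_zero ℝ E]
  refine tendsto_integral_of_dominated_convergence _
    (fun n => aestronglyMeasurable_kernel_smul hg (by fun_prop) _)
    ((hc.integrable_majorant_half_mul hS hcΦ (c (2 * t) + c t)).const_mul (2 * constC Φ))
    (fun n => .of_forall fun u => norm_kernel_smul_sub_le hc hS hg hZc n t u)
    (.of_forall fun u => ?_)
  have hpoint : Tendsto (fun n : ℕ => t + (1 / 2 : ℝ) ^ n * u) atTop (𝓝 t) := by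
    simpa only [zero_mul, add_zero] using ((tendsto_pow_atTop_nhds_zero_of_lt_one
      one_half_pos.le one_half_lt_one).mul_const u).const_add t
  have hdiff := (tendsto_iff_norm_sub_tendsto_zero.1 ((hZ.tendsto t).comp hpoint)).const_mul
    (2 * constC Φ * Φ (|u| / 2))
  rw [mul_zero] at hdiff
  refine squeeze_zero_norm (fun n => ?_) hdiff
  rw [norm_smul]
  exact mul_le_mul_of_nonneg_right (hS.norm_kernel_add_le hg _ u) (norm_nonneg _)

/-! ### Truncation of the expansion -/

theorem enorm_level_error_le (hc : IsGrowthFunction c) (hS : AssumptionS g Φ)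
    (hcΦ : Integrable fun x : ℝ => c x * Φ |x|) (hg : Continuous g) (hZ : Continuous Z)
    (hZc : ∀ s, ‖Z s‖ ≤ c s) (j : ℕ) (t : ℝ) (s : Finset ℤ) :
    ‖∑ k ∈ s, dilate g j k t • analysisCoeff (dilate g j k) Z - levelProj g Z j t‖ₑ ≤
      (⨆ k : ℤ, ‖analysisCoeff (dilate g j k) Z‖ₑ) * (ENNReal.ofReal ((2 : ℝ) ^ ((j : ℝ) / 2)) *
        ∑' k : ℤ, if k ∈ s then 0 else ‖g (2 ^ j * t - k)‖ₑ) := by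
  refine (enorm_sum_sub_le_of_hasSum (hasSum_levelProj hc hS hcΦ hg hZ hZc j t) s).trans ?_
  rw [← ENNReal.tsum_mul_left, ← ENNReal.tsum_mul_left]
  refine ENNReal.tsum_le_tsum fun k => ?_
  split_ifs
  · exact zero_le
  · rw [enorm_smul, enorm_dilate, mul_comm]
    gcongr
    exact le_iSup (fun k : ℤ => ‖analysisCoeff (dilate g j k) Z‖ₑ) k

namespace IsWaveletPair

theorem enorm_sum_sub_levelProj_le (hW : IsWaveletPair fw mw m₀ Φf Φm)
    (hc : IsGrowthFunction c) (hcf : Integrable fun x : ℝ => c x * Φf |x|)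
    (hcm : Integrable fun x : ℝ => c x * Φm |x|) (hZ : Continuous Z) (hZc : ∀ s, ‖Z s‖ ≤ c s)
    (t : ℝ) (N : ℕ) (s₀ : Finset ℤ) (s : ℕ → Finset ℤ) {w₀ : ℝ≥0∞} {w : ℕ → ℝ≥0∞}
    (hw₀ : ∑' k : ℤ, (if k ∈ s₀ then 0 else ‖fw (t - k)‖ₑ) ≤ w₀)
    (hw : ∀ j, ∑' k : ℤ, (if k ∈ s j then 0 else ‖mw (2 ^ j * t - k)‖ₑ) ≤ w j) :
    ‖(∑ k ∈ s₀, dilate fw 0 k t • analysisCoeff (dilate fw 0 k) Z +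
        ∑ j ∈ Finset.range N, ∑ k ∈ s j, dilate mw j k t • analysisCoeff (dilate mw j k) Z) -
          levelProj fw Z N t‖ₑ ≤
      (⨆ k : ℤ, ‖analysisCoeff (dilate fw 0 k) Z‖ₑ) * w₀ +
        ∑' j : ℕ, (⨆ k : ℤ, ‖analysisCoeff (dilate mw j k) Z‖ₑ) *
          (ENNReal.ofReal ((2 : ℝ) ^ ((j : ℝ) / 2)) * w j) := by
  rw [hW.levelProj_eq_add_sum hc hcf hcm hZ hZc N t, add_sub_add_comm, ← Finset.sum_sub_distrib]
  refine (enorm_add_le _ _).trans (add_le_add ?_ ?_)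
  · refine (enorm_level_error_le hc hW.majorant_fw hcf hW.continuous_fw hZ hZc 0 t s₀).trans ?_
    simp only [Nat.cast_zero, zero_div, Real.rpow_zero, ENNReal.ofReal_one, pow_zero, one_mul]
    gcongr
  · refine (enorm_sum_le _ _).trans (le_trans (Finset.sum_le_sum fun j _ => ?_)
      (ENNReal.sum_le_tsum (Finset.range N)))
    refine (enorm_level_error_le hc hW.majorant_mw hcm hW.continuous_mw hZ hZc j t (s j)).trans ?_
    gcongr
    exact hw j

theorem enorm_expansion_error_le (hW : IsWaveletPair fw mw m₀ Φf Φm)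
    (hc : IsGrowthFunction c) (hcf : Integrable fun x : ℝ => c x * Φf |x|)
    (hcm : Integrable fun x : ℝ => c x * Φm |x|) (hZ : Continuous Z) (hZc : ∀ s, ‖Z s‖ ≤ c s)
    (t : ℝ) (n : ℕ) (s₀ : Finset ℤ) (s : ℕ → Finset ℤ) (hs : ∀ j, n ≤ j → s j = ∅)
    {w₀ : ℝ≥0∞} {w : ℕ → ℝ≥0∞}
    (hw₀ : ∑' k : ℤ, (if k ∈ s₀ then 0 else ‖fw (t - k)‖ₑ) ≤ w₀)
    (hw : ∀ j, ∑' k : ℤ, (if k ∈ s j then 0 else ‖mw (2 ^ j * t - k)‖ₑ) ≤ w j) :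
    ‖(∑ k ∈ s₀, dilate fw 0 k t • analysisCoeff (dilate fw 0 k) Z +
        ∑ j ∈ Finset.range n, ∑ k ∈ s j, dilate mw j k t • analysisCoeff (dilate mw j k) Z) -
          Z t‖ₑ ≤
      (⨆ k : ℤ, ‖analysisCoeff (dilate fw 0 k) Z‖ₑ) * w₀ +
        ∑' j : ℕ, (⨆ k : ℤ, ‖analysisCoeff (dilate mw j k) Z‖ₑ) *
          (ENNReal.ofReal ((2 : ℝ) ^ ((j : ℝ) / 2)) * w j) := by
  refine le_of_tendsto ((tendsto_levelProj hc hW.isFWavelet hW.majorant_fw hcf hW.continuous_fw hZ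
    hZc t).const_sub _).enorm ?_
  filter_upwards [eventually_ge_atTop n] with N hN
  have hempty : ∀ j ∈ Finset.range N, j ∉ Finset.range n →
      ∑ k ∈ s j, dilate mw j k t • analysisCoeff (dilate mw j k) Z = 0 := fun j _ hj => by
    rw [hs j (by simpa only [Finset.mem_range, not_lt] using hj), Finset.sum_empty]
  rw [Finset.sum_subset (Finset.range_subset_range.2 hN) hempty]
  exact hW.enorm_sum_sub_levelProj_le hc hcf hcm hZ hZc t N s₀ s hw₀ hw

end IsWaveletPair

end Expansion

/-! ### Exponential moments of `φ`-sub-Gaussian families -/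

namespace IsNFunction

variable {φ : ℝ → ℝ}

theorem nonneg (hφ : IsNFunction φ) (x : ℝ) : 0 ≤ φ x := by
  have hmid := hφ.convex.2 (Set.mem_univ x) (Set.mem_univ (-x)) one_half_pos.le one_half_pos.le
    (add_halves 1)
  simp only [smul_eq_mul, mul_neg, add_neg_cancel, hφ.zero, hφ.even] at hmid
  linarith

theorem comp_abs (hφ : IsNFunction φ) (x : ℝ) : φ |x| = φ x := by
  rcases abs_choice x with h | h <;> rw [h]
  exact hφ.even x

theorem le_of_abs_le (hφ : IsNFunction φ) {x y : ℝ} (h : |x| ≤ |y|) : φ x ≤ φ y := by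
  rw [← hφ.comp_abs x, ← hφ.comp_abs y]
  rcases (abs_nonneg x).eq_or_lt with h0 | h0
  · rw [← h0, hφ.zero]
    exact hφ.nonneg _
  · exact hφ.strictMono.monotoneOn (Set.mem_Ioi.2 h0) (Set.mem_Ioi.2 (h0.trans_le h)) h

end IsNFunction

theorem lintegral_ofReal_le_of_le_convex_combination {Ω : Type*} [MeasurableSpace Ω]
    {P : Measure Ω} {F G H : Ω → ℝ} {a b : ℝ} {B : ℝ≥0∞} (hF : AEMeasurable F P)
    (hFB : ∫⁻ ω, ENNReal.ofReal (F ω) ∂P ≤ B) (hGB : ∫⁻ ω, ENNReal.ofReal (G ω) ∂P ≤ B)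
    (ha : 0 ≤ a) (hb : 0 ≤ b) (hab : a + b = 1) (hH : ∀ ω, H ω ≤ a * F ω + b * G ω) :
    ∫⁻ ω, ENNReal.ofReal (H ω) ∂P ≤ B :=
  calc ∫⁻ ω, ENNReal.ofReal (H ω) ∂P
      ≤ ∫⁻ ω, (ENNReal.ofReal a * ENNReal.ofReal (F ω) +
          ENNReal.ofReal b * ENNReal.ofReal (G ω)) ∂P := by
        refine lintegral_mono fun ω => ?_
        rw [← ENNReal.ofReal_mul ha, ← ENNReal.ofReal_mul hb]
        exact (ENNReal.ofReal_le_ofReal (hH ω)).trans ENNReal.ofReal_add_le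
    _ = ENNReal.ofReal a * ∫⁻ ω, ENNReal.ofReal (F ω) ∂P +
          ENNReal.ofReal b * ∫⁻ ω, ENNReal.ofReal (G ω) ∂P := by
        rw [lintegral_add_left' (hF.ennreal_ofReal.const_mul _),
          lintegral_const_mul' _ _ ENNReal.ofReal_ne_top,
          lintegral_const_mul' _ _ ENNReal.ofReal_ne_top]
    _ ≤ ENNReal.ofReal a * B + ENNReal.ofReal b * B := by gcongr
    _ = B := by rw [← add_mul, ← ENNReal.ofReal_add ha hb, hab, ENNReal.ofReal_one, one_mul]

section ExpMoment

variable {Ω : Type*} [MeasurableSpace Ω] {P : Measure Ω} {φ : ℝ → ℝ} {ξ η : Ω → ℝ}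

theorem ExpMomentBound.mono (hφ : IsNFunction φ) {a b : ℝ} (h : ExpMomentBound φ P ξ a)
    (hab : |a| ≤ |b|) : ExpMomentBound φ P ξ b := fun l => by
  refine (h l).trans (ENNReal.ofReal_le_ofReal (Real.exp_le_exp.2 (hφ.le_of_abs_le ?_)))
  rw [abs_mul, abs_mul]
  gcongr

theorem ExpMomentBound.const_mul (a : ℝ) {r : ℝ} (h : ExpMomentBound φ P ξ r) :
    ExpMomentBound φ P (fun ω => a * ξ ω) (r * a) := fun l => by
  simpa only [mul_assoc, mul_left_comm, mul_comm] using h (a * l)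

theorem ExpMomentBound.add {r : ℝ} (hξ : ExpMomentBound φ P ξ r) (hη : ExpMomentBound φ P η r)
    (hm : AEMeasurable ξ P) : ExpMomentBound φ P (fun ω => ξ ω + η ω) (2 * r) := fun l => by
  have hcomm : 2 * r * l = r * (2 * l) := by ring
  rw [hcomm]
  refine lintegral_ofReal_le_of_le_convex_combination
    (F := fun ω => Real.exp (2 * l * ξ ω)) (by fun_prop) (hξ (2 * l)) (hη (2 * l))
    one_half_pos.le one_half_pos.le (add_halves 1) fun ω => ?_
  have hconv := convexOn_exp.2 (Set.mem_univ (2 * l * ξ ω)) (Set.mem_univ (2 * l * η ω))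
    one_half_pos.le one_half_pos.le (add_halves 1)
  simp only [smul_eq_mul] at hconv
  refine (Real.exp_le_exp.2 (le_of_eq ?_)).trans hconv
  ring

theorem exists_expMomentBound_sum [IsProbabilityMeasure P] (hφ : IsNFunction φ) {ι : Type*}
    {X : ι → Ω → ℝ} (hX : ∀ i, IsSub φ P (X i)) (s : Finset ι) (a : ι → ℝ) :
    ∃ r : ℝ, 0 ≤ r ∧ ExpMomentBound φ P (fun ω => ∑ i ∈ s, a i * X i ω) r := by
  classical
  induction s using Finset.induction_on with
  | empty => exact ⟨0, le_rfl, fun l => by simp [hφ.zero]⟩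
  | insert i s hi ih =>
    obtain ⟨r, hr0, hr⟩ := ih
    obtain ⟨hint, -, q, -, hq⟩ := hX i
    refine ⟨2 * max |q * a i| r, mul_nonneg zero_le_two (hr0.trans (le_max_right _ _)), ?_⟩
    simp_rw [Finset.sum_insert hi]
    refine ((hq.const_mul (a i)).mono hφ ?_).add (hr.mono hφ ?_) (hint.aemeasurable.const_mul _)
    · exact (le_max_left _ _).trans (le_abs_self _)
    · exact (abs_of_nonneg hr0).trans_le ((le_max_right _ _).trans (le_abs_self _))

theorem expMomentBound_of_subNorm_le (hφ : IsNFunction φ)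
    (hex : ∃ r : ℝ, 0 ≤ r ∧ ExpMomentBound φ P ξ r) {b : ℝ} (hb : subNorm φ P ξ ≤ b) :
    ExpMomentBound φ P ξ b := fun l => by
  have hlarger : ∀ᶠ b' in 𝓝[>] b, ∫⁻ ω, ENNReal.ofReal (Real.exp (l * ξ ω)) ∂P ≤
      ENNReal.ofReal (Real.exp (φ (b' * l))) := by
    filter_upwards [self_mem_nhdsWithin] with b' hb'
    obtain ⟨a, ⟨ha0, ha⟩, hab⟩ := exists_lt_of_csInf_lt hex (hb.trans_lt hb')
    exact ha.mono hφ ((abs_of_nonneg ha0).trans_le (hab.le.trans (le_abs_self b'))) l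
  have hcont : Continuous fun b' : ℝ => ENNReal.ofReal (Real.exp (φ (b' * l))) :=
    ENNReal.continuous_ofReal.comp (Real.continuous_exp.comp
      (hφ.continuous.comp (continuous_mul_const l)))
  exact ge_of_tendsto ((hcont.tendsto b).mono_left nhdsWithin_le_nhds) hlarger

theorem ExpMomentBound.lintegral_cosh_le (hφ : IsNFunction φ) (hm : AEMeasurable ξ P) {b : ℝ}
    (h : ExpMomentBound φ P ξ b) (l : ℝ) :
    ∫⁻ ω, ENNReal.ofReal (Real.cosh (l * ξ ω)) ∂P ≤ ENNReal.ofReal (Real.exp (φ (b * l))) := by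
  have hneg := h (-l)
  rw [mul_neg, hφ.even] at hneg
  refine lintegral_ofReal_le_of_le_convex_combination (F := fun ω => Real.exp (l * ξ ω))
    (by fun_prop) (h l) hneg one_half_pos.le one_half_pos.le (add_halves 1) fun ω => le_of_eq ?_
  rw [Real.cosh_eq, neg_mul]
  ring

/-- Convexity of `x ↦ cosh √x`, at the points `u ^ 2 / a` and `v ^ 2 / b`. -/
theorem cosh_sqrt_add_sq_le {a b : ℝ} (ha : 0 < a) (hb : 0 < b) (hab : a + b = 1) (u v : ℝ) :
    Real.cosh √(u ^ 2 + v ^ 2) ≤ a * Real.cosh (u / √a) + b * Real.cosh (v / √b) := by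
  have hright := ((Real.hasSum_cosh (u / √a)).mul_left a).add
    ((Real.hasSum_cosh (v / √b)).mul_left b)
  refine hasSum_le (fun n => ?_) (Real.hasSum_cosh √(u ^ 2 + v ^ 2)) hright
  rw [← mul_div_assoc, ← mul_div_assoc, ← add_div]
  gcongr
  rw [pow_mul, pow_mul, pow_mul, Real.sq_sqrt (by positivity), div_pow u √a 2, div_pow v √b 2,
    Real.sq_sqrt ha.le, Real.sq_sqrt hb.le]
  have hconv := (convexOn_pow (𝕜 := ℝ) n).2 (Set.mem_Ici.2 (show 0 ≤ u ^ 2 / a by positivity))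
    (Set.mem_Ici.2 (show 0 ≤ v ^ 2 / b by positivity)) ha.le hb.le hab
  simp only [smul_eq_mul] at hconv
  rwa [mul_div_cancel₀ _ ha.ne', mul_div_cancel₀ _ hb.ne'] at hconv

theorem lintegral_cosh_sqrt_add_sq_le (hm : AEMeasurable ξ P) {a b : ℝ} {B : ℝ≥0∞} (ha : 0 < a)
    (hb : 0 < b) (hab : a + b = 1) (l : ℝ)
    (hξ : ∫⁻ ω, ENNReal.ofReal (Real.cosh (l / √a * ξ ω)) ∂P ≤ B)
    (hη : ∫⁻ ω, ENNReal.ofReal (Real.cosh (l / √b * η ω)) ∂P ≤ B) :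
    ∫⁻ ω, ENNReal.ofReal (Real.cosh (l * √(ξ ω ^ 2 + η ω ^ 2))) ∂P ≤ B := by
  refine lintegral_ofReal_le_of_le_convex_combination
    (F := fun ω => Real.cosh (l / √a * ξ ω)) (by fun_prop) hξ hη ha.le hb.le hab fun ω => ?_
  have hscale : Real.cosh (l * √(ξ ω ^ 2 + η ω ^ 2)) =
      Real.cosh √((l * ξ ω) ^ 2 + (l * η ω) ^ 2) := by
    rw [mul_pow, mul_pow, ← mul_add, Real.sqrt_mul (sq_nonneg l), Real.sqrt_sq_eq_abs,
      ← Real.cosh_abs, abs_mul, abs_of_nonneg (Real.sqrt_nonneg _)]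
  rw [hscale, div_mul_eq_mul_div, div_mul_eq_mul_div]
  exact cosh_sqrt_add_sq_le ha hb hab (l * ξ ω) (l * η ω)

end ExpMoment

section SquareIntegrable

variable {Ω : Type*} [MeasurableSpace Ω] {P : Measure Ω}

theorem coeFn_toL2 {ξ : Ω → ℝ} (h : MemLp ξ 2 P) : toL2 P ξ =ᵐ[P] fun ω => (ξ ω : ℂ) := by
  have hcomplex : MemLp (fun ω => (ξ ω : ℂ)) 2 P := h.ofReal
  rw [toL2, dif_pos hcomplex]
  exact MemLp.coeFn_toLp _

theorem norm_sq_eq_integral (Z : Lp ℂ 2 P) : ‖Z‖ ^ 2 = ∫ ω, ‖Z ω‖ ^ 2 ∂P := by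
  have hinner := L2.inner_def (𝕜 := ℂ) Z Z
  simp only [inner_self_eq_norm_sq_to_K, Complex.coe_algebraMap, ← Complex.ofReal_pow,
    integral_complex_ofReal] at hinner
  exact_mod_cast hinner

theorem coeFn_sum_smul {p : ℝ≥0∞} {ι : Type*} (s : Finset ι) (z : ι → ℂ) (v : ι → Lp ℂ p P) :
    ↑(∑ i ∈ s, z i • v i) =ᵐ[P] fun ω => ∑ i ∈ s, z i * v i ω := by
  have hterm : ∀ᵐ ω ∂P, ∀ i ∈ s, (z i • v i) ω = z i * v i ω :=
    (ae_ball_iff s.countable_toSet).2 fun i _ => Lp.coeFn_smul (z i) (v i)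
  filter_upwards [hterm, Lp.coeFn_fun_finsetSum s fun i => z i • v i] with ω hω hsum
  rw [hsum]
  exact Finset.sum_congr rfl hω

theorem coeFn_sum_smul_toL2 {ι : Type*} {X : ι → Ω → ℝ} (hX2 : ∀ i, MemLp (X i) 2 P)
    (s : Finset ι) (z : ι → ℂ) :
    ↑(∑ i ∈ s, z i • toL2 P (X i)) =ᵐ[P] fun ω => ∑ i ∈ s, z i * (X i ω : ℂ) := by
  have htoL2 : ∀ᵐ ω ∂P, ∀ i ∈ s, toL2 P (X i) ω = X i ω :=
    (ae_ball_iff s.countable_toSet).2 fun i _ => coeFn_toL2 (hX2 i)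
  filter_upwards [htoL2, coeFn_sum_smul s z fun i => toL2 P (X i)] with ω hω hsum
  rw [hsum]
  exact Finset.sum_congr rfl fun i hi => by rw [hω i hi]

theorem norm_sum_mul_ofReal {ι : Type*} (s : Finset ι) (z : ι → ℂ) (x : ι → ℝ) :
    ‖∑ i ∈ s, z i * (x i : ℂ)‖ =
      √((∑ i ∈ s, (z i).re * x i) ^ 2 + (∑ i ∈ s, (z i).im * x i) ^ 2) := by
  simp only [Complex.norm_eq_sqrt_sq_add_sq, Complex.re_sum, Complex.im_sum,
    Complex.re_mul_ofReal, Complex.im_mul_ofReal]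

/-- Fatou's lemma along an almost everywhere convergent subsequence. -/
theorem lintegral_comp_le_of_tendsto_Lp {E : Type*} [NormedAddCommGroup E] [MeasurableSpace E]
    [BorelSpace E] {p : ℝ≥0∞} [Fact (1 ≤ p)] {h : E → ℝ≥0∞} (hh : Continuous h)
    {W : ℕ → Lp E p P} {Z : Lp E p P} (hW : Tendsto W atTop (𝓝 Z)) {B : ℝ≥0∞}
    (hB : ∀ᶠ n in atTop, ∫⁻ ω, h (W n ω) ∂P ≤ B) : ∫⁻ ω, h (Z ω) ∂P ≤ B := by
  obtain ⟨ns, hns, hae⟩ := (tendstoInMeasure_of_tendsto_Lp hW).exists_seq_tendsto_ae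
  calc ∫⁻ ω, h (Z ω) ∂P = ∫⁻ ω, liminf (fun n => h (W (ns n) ω)) atTop ∂P :=
        lintegral_congr_ae (hae.mono fun ω hω => (((hh.tendsto _).comp hω).liminf_eq).symm)
    _ ≤ liminf (fun n => ∫⁻ ω, h (W (ns n) ω) ∂P) atTop :=
        lintegral_liminf_le' fun n => hh.measurable.comp_aemeasurable
          (Lp.aestronglyMeasurable (W (ns n))).aemeasurable
    _ ≤ B := liminf_le_of_frequently_le' (hns.tendsto_atTop.eventually hB).frequently

/-- The closed linear span of the process `X` in complex `L_2(Ω)`, which contains all its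
mean-square integrals. -/
noncomputable def closedSpan {ι : Type*} (P : Measure Ω) (X : ι → Ω → ℝ) :
    Submodule ℂ (Lp ℂ 2 P) :=
  (Submodule.span ℂ (Set.range fun i => toL2 P (X i))).topologicalClosure

/-- The two-sided exponential moment bound `E cosh(l ‖ξ‖) ≤ exp(φ(τ l))`, an analogue of
`ExpMomentBound` for vector-valued `ξ`. -/
def CoshMomentBound {E : Type*} [Norm E] (φ : ℝ → ℝ) (P : Measure Ω) (ξ : Ω → E) (τ : ℝ) : Prop :=
  ∀ l : ℝ, ∫⁻ ω, ENNReal.ofReal (Real.cosh (l * ‖ξ ω‖)) ∂P ≤ ENNReal.ofReal (Real.exp (φ (τ * l)))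

end SquareIntegrable

namespace IsStrictlySub

variable {Ω : Type*} [MeasurableSpace Ω] {P : Measure Ω} {φ : ℝ → ℝ} {ι : Type*}
  {X : ι → Ω → ℝ} {C : ℝ}

theorem aemeasurable_sum_mul (hX : IsStrictlySub φ P X C) (s : Finset ι) (a : ι → ℝ) :
    AEMeasurable (fun ω => ∑ i ∈ s, a i * X i ω) P :=
  Finset.aemeasurable_fun_sum _ fun i _ => (hX.1.1 i).1.aemeasurable.const_mul _

variable [IsProbabilityMeasure P]

theorem lintegral_cosh_le (hφ : IsNFunction φ) (hX : IsStrictlySub φ P X C)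
    (s : Finset ι) (a : ι → ℝ) {σ : ℝ} (hσ0 : 0 ≤ σ)
    (hσ : ∫ ω, (∑ i ∈ s, a i * X i ω) ^ 2 ∂P ≤ σ ^ 2) (l : ℝ) :
    ∫⁻ ω, ENNReal.ofReal (Real.cosh (l * ∑ i ∈ s, a i * X i ω)) ∂P ≤
      ENNReal.ofReal (Real.exp (φ (C * σ * l))) := by
  have hC := hX.2.1
  refine (expMomentBound_of_subNorm_le hφ (exists_expMomentBound_sum hφ hX.1.1 s a)
    ((hX.2.2 s a).trans ?_)).lintegral_cosh_le hφ (hX.aemeasurable_sum_mul s a) l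
  gcongr
  exact (Real.sqrt_le_sqrt hσ).trans_eq (Real.sqrt_sq hσ0)

theorem lintegral_cosh_sqrt_le (hφ : IsNFunction φ) (hX : IsStrictlySub φ P X C) (s : Finset ι)
    (a b : ι → ℝ) {σ : ℝ} (hσ0 : 0 < σ)
    (hσ : ∫ ω, (∑ i ∈ s, a i * X i ω) ^ 2 ∂P + ∫ ω, (∑ i ∈ s, b i * X i ω) ^ 2 ∂P < σ ^ 2)
    (l : ℝ) :
    ∫⁻ ω, ENNReal.ofReal (Real.cosh
        (l * √((∑ i ∈ s, a i * X i ω) ^ 2 + (∑ i ∈ s, b i * X i ω) ^ 2))) ∂P ≤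
      ENNReal.ofReal (Real.exp (φ (C * σ * l))) := by
  have hcosh (e : ι → ℝ) {r : ℝ} (hr : 0 < r)
      (he : ∫ ω, (∑ i ∈ s, e i * X i ω) ^ 2 ∂P ≤ r * σ ^ 2) :
      ∫⁻ ω, ENNReal.ofReal (Real.cosh (l / √r * ∑ i ∈ s, e i * X i ω)) ∂P ≤
        ENNReal.ofReal (Real.exp (φ (C * σ * l))) := by
    have : 0 < √r := Real.sqrt_pos.2 hr
    have hscale : C * (√r * σ) * (l / √r) = C * σ * l := by field_simp
    rw [← hscale]
    refine hX.lintegral_cosh_le hφ s e (by positivity) ?_ _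
    rwa [mul_pow, Real.sq_sqrt hr.le]
  set u := ∫ ω, (∑ i ∈ s, a i * X i ω) ^ 2 ∂P
  set v := ∫ ω, (∑ i ∈ s, b i * X i ω) ^ 2 ∂P
  have : 0 ≤ u := integral_nonneg fun _ => by positivity
  have : 0 ≤ v := integral_nonneg fun _ => by positivity
  obtain ⟨δ, hδ⟩ : ∃ δ, u + v + 2 * δ = σ ^ 2 := ⟨(σ ^ 2 - u - v) / 2, by ring⟩
  have hδ0 : 0 < δ := by linarith
  refine lintegral_cosh_sqrt_add_sq_le (a := (u + δ) / σ ^ 2) (b := (v + δ) / σ ^ 2)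
    (hX.aemeasurable_sum_mul s a) (by positivity) (by positivity) ?_ l
    (hcosh a (by positivity) ?_) (hcosh b (by positivity) ?_)
  · rw [← add_div, div_eq_one_iff_eq (by positivity)]
    linarith
  · rw [div_mul_cancel₀ _ (by positivity)]
    linarith
  · rw [div_mul_cancel₀ _ (by positivity)]
    linarith

theorem lintegral_cosh_norm_sum_le (hφ : IsNFunction φ) (hX : IsStrictlySub φ P X C)
    (hX2 : ∀ i, MemLp (X i) 2 P) (s : Finset ι) (z : ι → ℂ) {σ : ℝ}
    (hσ : ‖∑ i ∈ s, z i • toL2 P (X i)‖ < σ) (l : ℝ) :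
    ∫⁻ ω, ENNReal.ofReal (Real.cosh (l * ‖(∑ i ∈ s, z i • toL2 P (X i)) ω‖)) ∂P ≤
      ENNReal.ofReal (Real.exp (φ (C * σ * l))) := by
  have hnorm : ∀ᵐ ω ∂P, ‖(∑ i ∈ s, z i • toL2 P (X i)) ω‖ =
      √((∑ i ∈ s, (z i).re * X i ω) ^ 2 + (∑ i ∈ s, (z i).im * X i ω) ^ 2) := by
    filter_upwards [coeFn_sum_smul_toL2 hX2 s z] with ω hω
    rw [hω, norm_sum_mul_ofReal]
  have hsq (e : ι → ℝ) : Integrable (fun ω => (∑ i ∈ s, e i * X i ω) ^ 2) P :=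
    (memLp_finsetSum s fun i _ => (hX2 i).const_mul (e i)).integrable_sq
  rw [lintegral_congr_ae (hnorm.mono fun ω hω => by rw [hω])]
  refine hX.lintegral_cosh_sqrt_le hφ s _ _ ((norm_nonneg _).trans_lt hσ) ?_ l
  calc ∫ ω, (∑ i ∈ s, (z i).re * X i ω) ^ 2 ∂P + ∫ ω, (∑ i ∈ s, (z i).im * X i ω) ^ 2 ∂P
      = ‖∑ i ∈ s, z i • toL2 P (X i)‖ ^ 2 := by
        rw [← integral_add (hsq _) (hsq _), norm_sq_eq_integral]
        refine integral_congr_ae (hnorm.mono fun ω hω => ?_)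
        simp only [hω]
        rw [Real.sq_sqrt (by positivity)]
    _ < σ ^ 2 := pow_lt_pow_left₀ hσ (norm_nonneg _) two_ne_zero

theorem lintegral_cosh_norm_le_of_norm_lt (hφ : IsNFunction φ) (hX : IsStrictlySub φ P X C)
    (hX2 : ∀ i, MemLp (X i) 2 P) {Z : Lp ℂ 2 P}
    (hZ : Z ∈ closedSpan P X)
    {σ : ℝ} (hσ : ‖Z‖ < σ) (l : ℝ) :
    ∫⁻ ω, ENNReal.ofReal (Real.cosh (l * ‖Z ω‖)) ∂P ≤
      ENNReal.ofReal (Real.exp (φ (C * σ * l))) := by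
  obtain ⟨W, hWmem, hWlim⟩ := mem_closure_iff_seq_limit.1 hZ
  refine lintegral_comp_le_of_tendsto_Lp (h := fun y : ℂ => ENNReal.ofReal (Real.cosh (l * ‖y‖)))
    (ENNReal.continuous_ofReal.comp (Real.continuous_cosh.comp (by fun_prop))) hWlim ?_
  filter_upwards [hWlim.norm.eventually_lt_const hσ] with n hn
  obtain ⟨z, hz⟩ := Finsupp.mem_span_range_iff_exists_finsupp.1 (hWmem n)
  rw [← hz] at hn ⊢
  exact hX.lintegral_cosh_norm_sum_le hφ hX2 z.support z hn l

theorem coshMomentBound (hφ : IsNFunction φ) (hX : IsStrictlySub φ P X C)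
    (hX2 : ∀ i, MemLp (X i) 2 P) {Z : Lp ℂ 2 P} (hZ : Z ∈ closedSpan P X) {σ : ℝ}
    (hσ : ‖Z‖ ≤ σ) : CoshMomentBound φ P Z (C * σ) := fun l => by
  have hcont : Continuous fun r : ℝ => ENNReal.ofReal (Real.exp (φ (C * r * l))) :=
    ENNReal.continuous_ofReal.comp (Real.continuous_exp.comp (hφ.continuous.comp (by fun_prop)))
  have hlarger : ∀ᶠ r in 𝓝[>] σ, ∫⁻ ω, ENNReal.ofReal (Real.cosh (l * ‖Z ω‖)) ∂P ≤
      ENNReal.ofReal (Real.exp (φ (C * r * l))) := by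
    filter_upwards [self_mem_nhdsWithin] with r hr
    exact hX.lintegral_cosh_norm_le_of_norm_lt hφ hX2 hZ (hσ.trans_lt hr) l
  exact ge_of_tendsto ((hcont.tendsto σ).mono_left nhdsWithin_le_nhds) hlarger

end IsStrictlySub

/-! ### Moment and deviation bounds -/

theorem rpow_le_mul_exp {y s l : ℝ} (hy : 0 ≤ y) (hs : 0 < s) (hl : 0 < l) :
    y ^ s ≤ (s / l) ^ s * Real.exp (-s) * Real.exp (l * y) := by
  have hlinear : y ≤ s / l * Real.exp (l * y / s - 1) := by
    have hexp := Real.add_one_le_exp (l * y / s - 1)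
    rw [sub_add_cancel] at hexp
    calc y = s / l * (l * y / s) := by field_simp
      _ ≤ s / l * Real.exp (l * y / s - 1) := by gcongr
  calc y ^ s ≤ (s / l * Real.exp (l * y / s - 1)) ^ s := Real.rpow_le_rpow hy hlinear hs.le
    _ = (s / l) ^ s * Real.exp (-s) * Real.exp (l * y) := by
        rw [Real.mul_rpow (by positivity) (by positivity), ← Real.exp_mul, mul_assoc,
          ← Real.exp_add]
        congr 2
        field_simp
        ring

theorem rpow_le_mul_cosh {y s l : ℝ} (hy : 0 ≤ y) (hs : 0 < s) (hl : 0 < l) :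
    y ^ s ≤ 2 * ((s / l) ^ s * Real.exp (-s)) * Real.cosh (l * y) := by
  have hcosh : Real.exp (l * y) ≤ 2 * Real.cosh (l * y) := by
    rw [Real.cosh_eq]
    linarith [Real.exp_pos (-(l * y))]
  refine (rpow_le_mul_exp hy hs hl).trans ?_
  rw [mul_comm 2, mul_assoc _ 2]
  gcongr

section CoshMomentBound

variable {Ω E : Type*} [MeasurableSpace Ω] [NormedAddCommGroup E] {P : Measure Ω} {φ : ℝ → ℝ}
  {ξ η : Ω → E} {τ : ℝ}

theorem CoshMomentBound.congr_ae (h : CoshMomentBound φ P ξ τ) (hξη : ξ =ᵐ[P] η) :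
    CoshMomentBound φ P η τ := fun l =>
  (lintegral_congr_ae (hξη.mono fun ω hω => by simp only [hω])).symm.trans_le (h l)

theorem CoshMomentBound.mono (hφ : IsNFunction φ) (h : CoshMomentBound φ P ξ τ) {τ' : ℝ}
    (hτ : |τ| ≤ |τ'|) : CoshMomentBound φ P ξ τ' := fun l => by
  refine (h l).trans (ENNReal.ofReal_le_ofReal (Real.exp_le_exp.2 (hφ.le_of_abs_le ?_)))
  rw [abs_mul, abs_mul]
  gcongr

theorem CoshMomentBound.lintegral_rpow_le_of_pos (h : CoshMomentBound φ P ξ τ) (hτ : 0 < τ)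
    {s a : ℝ} (hs : 0 < s) (ha : 0 < a) :
    ∫⁻ ω, ‖ξ ω‖ₑ ^ s ∂P ≤
      ENNReal.ofReal (2 * ((s * τ / a) ^ s * Real.exp (-s)) * Real.exp (φ a)) := by
  have hl : 0 < a / τ := by positivity
  have hcosh := h (a / τ)
  rw [mul_div_cancel₀ _ hτ.ne'] at hcosh
  have hpointwise (ω : Ω) : ‖ξ ω‖ₑ ^ s ≤
      ENNReal.ofReal (2 * ((s * τ / a) ^ s * Real.exp (-s))) *
        ENNReal.ofReal (Real.cosh (a / τ * ‖ξ ω‖)) := by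
    rw [← ENNReal.ofReal_mul (by positivity), ← ofReal_norm,
      ENNReal.ofReal_rpow_of_nonneg (norm_nonneg _) hs.le, ← div_div_eq_mul_div]
    exact ENNReal.ofReal_le_ofReal (rpow_le_mul_cosh (norm_nonneg _) hs hl)
  refine (lintegral_mono hpointwise).trans ?_
  rw [lintegral_const_mul' _ _ ENNReal.ofReal_ne_top,
    ENNReal.ofReal_mul (q := Real.exp (φ a)) (by positivity)]
  exact mul_le_mul_right hcosh _

theorem CoshMomentBound.lintegral_rpow_le (hφ : IsNFunction φ) (h : CoshMomentBound φ P ξ τ)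
    (hτ : 0 ≤ τ) {s a : ℝ} (hs : 0 < s) (ha : 0 < a) :
    ∫⁻ ω, ‖ξ ω‖ₑ ^ s ∂P ≤
      ENNReal.ofReal (2 * ((s * τ / a) ^ s * Real.exp (-s)) * Real.exp (φ a)) := by
  have hcont : Continuous fun r : ℝ =>
      ENNReal.ofReal (2 * ((s * r / a) ^ s * Real.exp (-s)) * Real.exp (φ a)) := by
    have hpow : Continuous fun r : ℝ => (s * r / a) ^ s :=
      Continuous.rpow_const (by fun_prop) fun _ => Or.inr hs.le
    exact ENNReal.continuous_ofReal.comp (by fun_prop)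
  have hlarger : ∀ᶠ r in 𝓝[>] τ, ∫⁻ ω, ‖ξ ω‖ₑ ^ s ∂P ≤
      ENNReal.ofReal (2 * ((s * r / a) ^ s * Real.exp (-s)) * Real.exp (φ a)) := by
    filter_upwards [self_mem_nhdsWithin] with r hr
    have hr0 : 0 < r := hτ.trans_lt hr
    refine (h.mono hφ ?_).lintegral_rpow_le_of_pos hr0 hs ha
    rw [abs_of_nonneg hτ, abs_of_pos hr0]
    exact le_of_lt hr
  exact ge_of_tendsto ((hcont.tendsto τ).mono_left nhdsWithin_le_nhds) hlarger

end CoshMomentBound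

section Deviation

variable {α E : Type*} [MeasurableSpace α] [NormedAddCommGroup E] {μ : Measure α} {p s : ℝ}

theorem lintegral_enorm_rpow_rpow_le {g : α → E} (hg : AEStronglyMeasurable g μ) (hp : 0 < p)
    (hps : p ≤ s) :
    (∫⁻ x, ‖g x‖ₑ ^ p ∂μ) ^ (s / p) ≤ μ Set.univ ^ (s / p - 1) * ∫⁻ x, ‖g x‖ₑ ^ s ∂μ := by
  have hs : 0 < s := hp.trans_le hps
  have hjensen := ENNReal.rpow_le_rpow (eLpNorm'_le_eLpNorm'_mul_rpow_measure_univ hp hps hg) hs.le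
  rw [eLpNorm', eLpNorm', ENNReal.mul_rpow_of_nonneg _ _ hs.le, ← ENNReal.rpow_mul,
    ← ENNReal.rpow_mul, ← ENNReal.rpow_mul, one_div_mul_cancel hs.ne', ENNReal.rpow_one,
    sub_mul, one_div_mul_cancel hs.ne', one_div_mul_eq_div] at hjensen
  rwa [mul_comm]

variable [MeasurableSpace E] [BorelSpace E] [SecondCountableTopology E] {Ω : Type*}
  [MeasurableSpace Ω] {P : Measure Ω} [SFinite P] [SFinite μ] {Y : α → Ω → E}

theorem lintegral_lintegral_enorm_rpow_rpow_le (hY : Measurable (Function.uncurry Y))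
    (hp : 0 < p) (hps : p ≤ s) {M : ℝ≥0∞} (hM : ∀ᵐ t ∂μ, ∫⁻ ω, ‖Y t ω‖ₑ ^ s ∂P ≤ M) :
    ∫⁻ ω, (∫⁻ t, ‖Y t ω‖ₑ ^ p ∂μ) ^ (s / p) ∂P ≤ μ Set.univ ^ (s / p) * M := by
  have hYs : Measurable fun q : Ω × α => ‖Y q.2 q.1‖ₑ ^ s :=
    (hY.comp measurable_swap).enorm.pow_const s
  calc ∫⁻ ω, (∫⁻ t, ‖Y t ω‖ₑ ^ p ∂μ) ^ (s / p) ∂P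
      ≤ ∫⁻ ω, μ Set.univ ^ (s / p - 1) * ∫⁻ t, ‖Y t ω‖ₑ ^ s ∂μ ∂P :=
        lintegral_mono fun ω => lintegral_enorm_rpow_rpow_le
          (hY.comp measurable_prodMk_right).aestronglyMeasurable hp hps
    _ = μ Set.univ ^ (s / p - 1) * ∫⁻ t, ∫⁻ ω, ‖Y t ω‖ₑ ^ s ∂P ∂μ := by
        rw [lintegral_const_mul _ hYs.lintegral_prod_right',
          lintegral_lintegral_swap hYs.aemeasurable]
    _ ≤ μ Set.univ ^ (s / p - 1) * ∫⁻ _, M ∂μ := by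
        gcongr 1
        exact lintegral_mono_ae hM
    _ = μ Set.univ ^ (s / p) * M := by
        have hexponent : 0 ≤ s / p - 1 := sub_nonneg.2 ((one_le_div hp).2 hps)
        rw [lintegral_const, mul_left_comm, mul_comm]
        nth_rewrite 2 [← ENNReal.rpow_one (μ Set.univ)]
        rw [← ENNReal.rpow_add_of_nonneg _ _ hexponent zero_le_one, sub_add_cancel]

theorem measure_lt_lintegral_rpow_le (hY : Measurable (Function.uncurry Y)) (hp : 0 < p)
    (hps : p ≤ s) {a : ℝ≥0∞} (ha0 : a ≠ 0) (ha : a ≠ ∞) {M : ℝ≥0∞}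
    (hM : ∀ᵐ t ∂μ, ∫⁻ ω, ‖Y t ω‖ₑ ^ s ∂P ≤ M) :
    P {ω | a < ∫⁻ t, ‖Y t ω‖ₑ ^ p ∂μ} ≤ μ Set.univ ^ (s / p) * M / a ^ (s / p) := by
  have hexponent : 0 ≤ s / p := (div_pos (hp.trans_le hps) hp).le
  have hmeas : Measurable fun ω => ∫⁻ t, ‖Y t ω‖ₑ ^ p ∂μ :=
    ((hY.comp measurable_swap).enorm.pow_const p).lintegral_prod_right'
  calc P {ω | a < ∫⁻ t, ‖Y t ω‖ₑ ^ p ∂μ}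
      ≤ P {ω | a ^ (s / p) ≤ (∫⁻ t, ‖Y t ω‖ₑ ^ p ∂μ) ^ (s / p)} :=
        measure_mono fun ω hω => ENNReal.rpow_le_rpow (le_of_lt hω) hexponent
    _ ≤ (∫⁻ ω, (∫⁻ t, ‖Y t ω‖ₑ ^ p ∂μ) ^ (s / p) ∂P) / a ^ (s / p) :=
        meas_ge_le_lintegral_div (hmeas.pow_const _).aemeasurable
          (ENNReal.rpow_pos (pos_iff_ne_zero.2 ha0) ha).ne'
          (ENNReal.rpow_ne_top_of_nonneg hexponent ha)
    _ ≤ μ Set.univ ^ (s / p) * M / a ^ (s / p) := by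
        gcongr
        exact lintegral_lintegral_enorm_rpow_rpow_le hY hp hps hM

end Deviation

/-! ### Optimization of the exponential bound -/

section Optimization

variable {φ f : ℝ → ℝ}

theorem IsDensity.nonneg (hf : IsDensity φ f) {x : ℝ} (hx : 0 ≤ x) : 0 ≤ f x := by
  rw [← hf.zero]
  exact hf.monotoneOn (Set.mem_Ici.2 le_rfl) (Set.mem_Ici.2 hx) hx

theorem IsDensity.intervalIntegrable (hf : IsDensity φ f) {a b : ℝ} (ha : 0 ≤ a) (hb : 0 ≤ b) :
    IntervalIntegrable f volume a b :=
  MonotoneOn.intervalIntegrable (hf.monotoneOn.mono fun _ hx =>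
    Set.mem_Ici.2 ((le_inf ha hb).trans hx.1))

/-- The derivative `x - f y` of `y ↦ x * y - φ y` is nonnegative on `[0, b]`. -/
theorem IsDensity.mul_sub_le (hf : IsDensity φ f) {x b y : ℝ} (hx : 0 ≤ x) (hb : f b ≤ x)
    (hy : |y| ≤ b) : x * y - φ y ≤ x * b - φ b := by
  have hb0 : 0 ≤ b := (abs_nonneg y).trans hy
  have hincrement : φ b - φ y = ∫ v in |y|..b, f v := by
    rw [hf.integral_eq, hf.integral_eq y, abs_of_nonneg hb0,
      intervalIntegral.integral_interval_sub_left (hf.intervalIntegrable le_rfl hb0)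
        (hf.intervalIntegrable le_rfl (abs_nonneg y))]
  have hslope : ∫ v in |y|..b, f v ≤ ∫ _ in |y|..b, x := by
    refine intervalIntegral.integral_mono_on hy
      (hf.intervalIntegrable (abs_nonneg y) hb0) (by simp) fun v hv => ?_
    exact (hf.monotoneOn (Set.mem_Ici.2 ((abs_nonneg y).trans hv.1)) (Set.mem_Ici.2 hb0)
      hv.2).trans hb
  rw [intervalIntegral.integral_const, smul_eq_mul] at hslope
  nlinarith [mul_le_mul_of_nonneg_left (le_abs_self y) hx]

theorem le_mul_exp_neg_youngFenchel {K x : ℝ} (hK : 0 < K) {q : ℝ≥0∞}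
    (hq : ∀ y, q ≤ ENNReal.ofReal (K * Real.exp (-(x * y - φ y)))) :
    q ≤ ENNReal.ofReal (K * Real.exp (-youngFenchel φ x)) := by
  have hqt : q ≠ ∞ := ne_top_of_le_ne_top ENNReal.ofReal_ne_top (hq 0)
  rcases eq_or_ne q 0 with rfl | hq0
  · exact zero_le
  have hqr : 0 < q.toReal := ENNReal.toReal_pos hq0 hqt
  have hsup : youngFenchel φ x ≤ Real.log (K / q.toReal) := by
    refine ciSup_le fun y => ?_
    have hy := ENNReal.toReal_le_of_le_ofReal (by positivity) (hq y)
    rwa [Real.exp_neg, ← div_eq_mul_inv, le_div_comm₀ hqr (Real.exp_pos _),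
      ← Real.le_log_iff_exp_le (by positivity)] at hy
  rw [← ENNReal.ofReal_toReal hqt]
  refine ENNReal.ofReal_le_ofReal ?_
  rwa [Real.exp_neg, ← div_eq_mul_inv, le_div_comm₀ hqr (Real.exp_pos _),
    ← Real.le_log_iff_exp_le (by positivity)]

theorem IsDensity.le_mul_exp_neg_youngFenchel (hf : IsDensity φ f) {K x b : ℝ} (hK : 0 < K)
    (hx : 0 ≤ x) (hfb : f b ≤ x) {q : ℝ≥0∞}
    (hq : ∀ a, b ≤ a → q ≤ ENNReal.ofReal (K * Real.exp (-(x * a - φ a)))) :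
    q ≤ ENNReal.ofReal (K * Real.exp (-youngFenchel φ x)) := by
  refine SubGaussWavelet.le_mul_exp_neg_youngFenchel hK fun y => ?_
  obtain ⟨a, ha, hya⟩ : ∃ a, b ≤ a ∧ x * y - φ y ≤ x * a - φ a := by
    rcases le_total |y| b with hy | hy
    · exact ⟨b, le_rfl, hf.mul_sub_le hx hfb hy⟩
    · refine ⟨|y|, hy, ?_⟩
      have heven : φ |y| = φ y := by rw [hf.integral_eq, abs_abs, ← hf.integral_eq]
      rw [heven]
      gcongr
      exact le_abs_self y
  refine (hq a ha).trans (ENNReal.ofReal_le_ofReal ?_)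
  gcongr

end Optimization

/-! ### Trajectories of processes with uniform exponential moments -/

section Trajectories

variable {α Ω E : Type*} [MeasurableSpace α] [MeasurableSpace Ω] [NormedAddCommGroup E]
  [MeasurableSpace E] [BorelSpace E] [SecondCountableTopology E] {μ : Measure α}
  [IsFiniteMeasure μ] {P : Measure Ω} [SFinite P] {φ f : ℝ → ℝ} {p s τ : ℝ} {Y : α → Ω → E}

theorem ae_lintegral_rpow_lt_top (hφ : IsNFunction φ) (hY : Measurable (Function.uncurry Y))
    (hp : 0 < p) (hτ : 0 ≤ τ) (hM : ∀ᵐ t ∂μ, CoshMomentBound φ P (Y t) τ) :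
    ∀ᵐ ω ∂P, ∫⁻ t, ‖Y t ω‖ₑ ^ p ∂μ < ∞ := by
  have hmoment := lintegral_lintegral_enorm_rpow_rpow_le hY hp le_rfl
    (hM.mono fun t ht => ht.lintegral_rpow_le hφ hτ hp one_pos)
  simp only [div_self hp.ne', ENNReal.rpow_one] at hmoment
  exact ae_lt_top ((hY.comp measurable_swap).enorm.pow_const p).lintegral_prod_right'
    (ne_top_of_le_ne_top (ENNReal.mul_ne_top (measure_ne_top _ _) ENNReal.ofReal_ne_top) hmoment)

theorem measure_lt_lintegral_rpow_le_of_coshMomentBound (hφ : IsNFunction φ)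
    (hY : Measurable (Function.uncurry Y)) (hp : 0 < p) (hps : p ≤ s) (hτ : 0 ≤ τ)
    (hM : ∀ᵐ t ∂μ, CoshMomentBound φ P (Y t) τ) {a ε : ℝ} (ha : 0 < a) (hε : 0 < ε) :
    P {ω | ENNReal.ofReal ε < ∫⁻ t, ‖Y t ω‖ₑ ^ p ∂μ} ≤
      ENNReal.ofReal (2 * ((s * τ / a) ^ s * Real.exp (-s)) * Real.exp (φ a) *
        (μ.real Set.univ / ε) ^ (s / p)) := by
  have hs : 0 < s := hp.trans_le hps
  refine (measure_lt_lintegral_rpow_le hY hp hps (ENNReal.ofReal_pos.2 hε).ne'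
    ENNReal.ofReal_ne_top (hM.mono fun t ht => ht.lintegral_rpow_le hφ hτ hs ha)).trans_eq ?_
  rw [← ofReal_measureReal, ENNReal.ofReal_rpow_of_nonneg (by positivity) (by positivity),
    ENNReal.ofReal_rpow_of_pos hε, ← ENNReal.ofReal_mul (by positivity),
    ← ENNReal.ofReal_div_of_pos (by positivity), mul_comm, mul_div_assoc,
    Real.div_rpow (by positivity) hε.le]

theorem measure_lt_lintegral_rpow_eq_zero (hφ : IsNFunction φ)
    (hY : Measurable (Function.uncurry Y)) (hp : 0 < p)
    (hM : ∀ᵐ t ∂μ, CoshMomentBound φ P (Y t) 0) {ε : ℝ} (hε : 0 < ε) :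
    P {ω | ENNReal.ofReal ε < ∫⁻ t, ‖Y t ω‖ₑ ^ p ∂μ} = 0 := by
  simpa [Real.zero_rpow hp.ne'] using
    measure_lt_lintegral_rpow_le_of_coshMomentBound hφ hY hp le_rfl le_rfl hM one_pos hε

theorem tendsto_measure_lt_lintegral_rpow {β : Type*} {l : Filter β} {Y : β → α → Ω → E}
    {τ : β → ℝ} (hφ : IsNFunction φ) (hY : ∀ i, Measurable (Function.uncurry (Y i)))
    (hp : 0 < p) (hτ : ∀ i, 0 ≤ τ i) (hτl : Tendsto τ l (𝓝 0))
    (hM : ∀ᶠ i in l, ∀ᵐ t ∂μ, CoshMomentBound φ P (Y i t) (τ i)) {ε : ℝ} (hε : 0 < ε) :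
    Tendsto (fun i => P {ω | ENNReal.ofReal ε < ∫⁻ t, ‖Y i t ω‖ₑ ^ p ∂μ}) l (𝓝 0) := by
  have hcont : Continuous fun r : ℝ =>
      ENNReal.ofReal (2 * ((p * r / 1) ^ p * Real.exp (-p)) * Real.exp (φ 1) *
        (μ.real Set.univ / ε) ^ (p / p)) := by
    have hpow : Continuous fun r : ℝ => (p * r / 1) ^ p :=
      Continuous.rpow_const (by fun_prop) fun _ => Or.inr hp.le
    exact ENNReal.continuous_ofReal.comp (by fun_prop)
  have hbound := (hcont.tendsto 0).comp hτl
  simp only [mul_zero, zero_div, Real.zero_rpow hp.ne', zero_mul, ENNReal.ofReal_zero] at hbound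
  refine tendsto_of_tendsto_of_tendsto_of_le_of_le' tendsto_const_nhds hbound
    (Eventually.of_forall fun _ => zero_le) (hM.mono fun i hi => ?_)
  exact measure_lt_lintegral_rpow_le_of_coshMomentBound hφ (hY i) hp le_rfl (hτ i) hi one_pos hε

/-- The moment order `s = x * a` minimizes `(s * τ / a) ^ s * exp (-s) * (x * τ) ^ (-s)`. -/
theorem measure_lt_lintegral_rpow_le_exp (hφ : IsNFunction φ)
    (hY : Measurable (Function.uncurry Y)) (hp : 0 < p) (hτ : 0 < τ)
    (hM : ∀ᵐ t ∂μ, CoshMomentBound φ P (Y t) τ) (hμ : 0 < μ.real Set.univ) {a x : ℝ}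
    (hx : 0 < x) (hpa : p ≤ x * a) :
    P {ω | ENNReal.ofReal ((x * τ) ^ p * μ.real Set.univ) < ∫⁻ t, ‖Y t ω‖ₑ ^ p ∂μ} ≤
      ENNReal.ofReal (2 * Real.exp (-(x * a - φ a))) := by
  have ha : 0 < a := pos_of_mul_pos_right (hp.trans_le hpa) hx.le
  refine (measure_lt_lintegral_rpow_le_of_coshMomentBound hφ hY hp hpa hτ.le hM ha
    (by positivity)).trans_eq (congrArg ENNReal.ofReal ?_)
  have hlevel : (μ.real Set.univ / ((x * τ) ^ p * μ.real Set.univ)) ^ (x * a / p) =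
      ((x * τ) ^ (x * a))⁻¹ := by
    rw [div_mul_cancel_right₀ hμ.ne', Real.inv_rpow (by positivity),
      ← Real.rpow_mul (by positivity), mul_div_cancel₀ _ hp.ne']
  have hscale : x * a * τ / a = x * τ := by field_simp
  rw [hlevel, hscale, neg_sub, sub_eq_add_neg, add_comm, Real.exp_add]
  field_simp

theorem measure_lt_lintegral_rpow_le_exp_neg_youngFenchel (hφ : IsNFunction φ)
    (hf : IsDensity φ f) (hY : Measurable (Function.uncurry Y)) (hp : 0 < p) (hτ : 0 < τ)
    (hM : ∀ᵐ t ∂μ, CoshMomentBound φ P (Y t) τ) (hμ : 0 < μ.real Set.univ) {x : ℝ}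
    (hx : 0 < x) (hfx : f (p / x) ≤ x) :
    P {ω | ENNReal.ofReal ((x * τ) ^ p * μ.real Set.univ) < ∫⁻ t, ‖Y t ω‖ₑ ^ p ∂μ} ≤
      ENNReal.ofReal (2 * Real.exp (-youngFenchel φ x)) :=
  hf.le_mul_exp_neg_youngFenchel two_pos hx.le hfx fun _ ha =>
    measure_lt_lintegral_rpow_le_exp hφ hY hp hτ hM hμ hx ((div_le_iff₀' hx).1 ha)

theorem measure_lt_lintegral_rpow_le_exp_neg_youngFenchel_rpow (hφ : IsNFunction φ)
    (hf : IsDensity φ f) (hY : Measurable (Function.uncurry Y)) (hp : 0 < p) (hτ : 0 < τ)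
    (hM : ∀ᵐ t ∂μ, CoshMomentBound φ P (Y t) τ) (hμ : 0 < μ.real Set.univ) {κ ε : ℝ}
    (hκ : κ = τ ^ p * μ.real Set.univ) (hε : 0 < ε)
    (hεf : κ * f (p * (κ / ε) ^ (1 / p)) ^ p < ε) :
    P {ω | ENNReal.ofReal ε < ∫⁻ t, ‖Y t ω‖ₑ ^ p ∂μ} ≤
      ENNReal.ofReal (2 * Real.exp (-youngFenchel φ ((ε / κ) ^ (1 / p)))) := by
  have hκ0 : 0 < κ := by rw [hκ]; positivity
  obtain ⟨x, hx⟩ : ∃ x, x = (ε / κ) ^ (1 / p) := ⟨_, rfl⟩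
  have hx0 : 0 < x := by rw [hx]; positivity
  have hxp : x ^ p = ε / κ := by
    rw [hx, ← Real.rpow_mul (by positivity), one_div_mul_cancel hp.ne', Real.rpow_one]
  have hxinv : p * (κ / ε) ^ (1 / p) = p / x := by
    rw [hx, div_eq_mul_inv p, ← Real.inv_rpow (by positivity), inv_div]
  have hlevel : (x * τ) ^ p * μ.real Set.univ = ε := by
    rw [Real.mul_rpow hx0.le hτ.le, hxp, mul_assoc, ← hκ, div_mul_cancel₀ _ hκ0.ne']
  have hfx : f (p / x) ≤ x := by
    refine le_of_lt ((Real.rpow_lt_rpow_iff (hf.nonneg (by positivity)) hx0.le hp).1 ?_)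
    rwa [hxp, lt_div_iff₀' hκ0, ← hxinv]
  have hbound := measure_lt_lintegral_rpow_le_exp_neg_youngFenchel hφ hf hY hp hτ hM hμ hx0 hfx
  rwa [hlevel, hx] at hbound

end Trajectories

/-! ### The process and its wavelet expansion in `L_2(Ω)` -/

section SecondOrder

variable {Ω : Type*} [MeasurableSpace Ω] {P : Measure Ω}

theorem norm_toL2_sq {ξ : Ω → ℝ} (h : MemLp ξ 2 P) : ‖toL2 P ξ‖ ^ 2 = ∫ ω, ξ ω ^ 2 ∂P := by
  rw [norm_sq_eq_integral]
  refine integral_congr_ae ((coeFn_toL2 h).mono fun ω hω => ?_)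
  simp only [hω, Complex.norm_real, Real.norm_eq_abs, sq_abs]

variable {X : ℝ → Ω → ℝ}

theorem norm_toL2_eq_sqrt_cov (hX2 : ∀ t, MemLp (X t) 2 P) (t : ℝ) :
    ‖toL2 P (X t)‖ = √|cov P X t t| := by
  have hcov : cov P X t t = ‖toL2 P (X t)‖ ^ 2 := by
    simp only [norm_toL2_sq (hX2 t), cov, sq]
  rw [hcov, abs_of_nonneg (sq_nonneg _), Real.sqrt_sq (norm_nonneg _)]

theorem norm_toL2_sub_sq (hX2 : ∀ t, MemLp (X t) 2 P) (t s : ℝ) :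
    ‖toL2 P (X t) - toL2 P (X s)‖ ^ 2 = cov P X t t - 2 * cov P X t s + cov P X s s := by
  have hint (a b : ℝ) : Integrable (fun ω => X a ω * X b ω) P := (hX2 a).integrable_mul (hX2 b)
  rw [norm_sq_eq_integral, cov, cov, cov, ← integral_const_mul,
    ← integral_sub (hint t t) ((hint t s).const_mul 2),
    ← integral_add (f := fun ω => X t ω * X t ω - 2 * (X t ω * X s ω))
      ((hint t t).sub ((hint t s).const_mul 2)) (hint s s)]
  refine integral_congr_ae ?_
  filter_upwards [Lp.coeFn_sub (toL2 P (X t)) (toL2 P (X s)), coeFn_toL2 (hX2 t),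
    coeFn_toL2 (hX2 s)] with ω hsub ht hs
  rw [hsub, Pi.sub_apply, ht, hs, ← Complex.ofReal_sub, Complex.norm_real, Real.norm_eq_abs,
    sq_abs]
  ring

theorem continuous_toL2 (hX2 : ∀ t, MemLp (X t) 2 P)
    (hR : Continuous fun q : ℝ × ℝ => cov P X q.1 q.2) : Continuous fun t => toL2 P (X t) := by
  refine continuous_iff_continuousAt.2 fun s => tendsto_iff_norm_sub_tendsto_zero.2 ?_
  have hcov : Continuous fun t => √(cov P X t t - 2 * cov P X t s + cov P X s s) :=
    Real.continuous_sqrt.comp (((hR.comp (continuous_id.prodMk continuous_id)).sub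
      (continuous_const.mul (hR.comp (continuous_id.prodMk continuous_const)))).add
        continuous_const)
  simp only [← norm_toL2_sub_sq hX2, Real.sqrt_sq (norm_nonneg _)] at hcov
  simpa only [sub_self, norm_zero] using hcov.tendsto s

theorem integral_mem_of_isClosed {α E : Type*} [MeasurableSpace α] {μ : Measure α}
    [NormedAddCommGroup E] [NormedSpace ℝ E] [CompleteSpace E] {K : Submodule ℝ E}
    (hK : IsClosed (K : Set E)) {v : α → E} (hv : ∀ a, v a ∈ K) : ∫ a, v a ∂μ ∈ K := by
  have : CompleteSpace K := hK.completeSpace_coe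
  have hcoe : ∫ a, v a ∂μ = (∫ a, (⟨v a, hv a⟩ : K) ∂μ : K) :=
    K.subtypeₗᵢ.integral_comp_comm fun a => ⟨v a, hv a⟩
  rw [hcoe]
  exact Submodule.coe_mem _

theorem toL2_mem_closedSpan (t : ℝ) : toL2 P (X t) ∈ closedSpan P X :=
  Submodule.le_topologicalClosure _ (Submodule.subset_span ⟨t, rfl⟩)

theorem coeff_mem_closedSpan (g : ℝ → ℂ) : coeff P X g ∈ closedSpan P X :=
  integral_mem_of_isClosed (K := (closedSpan P X).restrictScalars ℝ)
    (Submodule.isClosed_topologicalClosure _) fun t =>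
      Submodule.smul_mem _ _ (toL2_mem_closedSpan t)

/-- The partial sum `approx` of the wavelet expansion as an element of `L_2(Ω)`. -/
noncomputable def approxL2 (P : Measure Ω) (X : ℝ → Ω → ℝ) (fw mw : ℝ → ℂ) (n k0 : ℕ) (k : ℕ → ℕ)
    (t : ℝ) : Lp ℂ 2 P :=
  ∑ i ∈ Finset.Icc (-(k0 : ℤ)) (k0 : ℤ), dilate fw 0 i t • xi P X fw i +
    ∑ j ∈ Finset.range n, ∑ i ∈ Finset.Icc (-(k j : ℤ)) (k j : ℤ),
      dilate mw j i t • eta P X mw j i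

variable {fw mw : ℝ → ℂ} {n k0 : ℕ} {k : ℕ → ℕ} {t : ℝ}

theorem approxL2_mem_closedSpan : approxL2 P X fw mw n k0 k t ∈ closedSpan P X :=
  Submodule.add_mem _
    (Submodule.sum_mem _ fun _ _ => Submodule.smul_mem _ _ (coeff_mem_closedSpan _))
    (Submodule.sum_mem _ fun _ _ => Submodule.sum_mem _ fun _ _ =>
      Submodule.smul_mem _ _ (coeff_mem_closedSpan _))

theorem coeFn_approxL2 : approxL2 P X fw mw n k0 k t =ᵐ[P] approx P X fw mw n k0 k t := by
  have hlevels : ∀ᵐ ω ∂P, ∀ j, (∑ i ∈ Finset.Icc (-(k j : ℤ)) (k j : ℤ),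
      dilate mw j i t • eta P X mw j i) ω =
      ∑ i ∈ Finset.Icc (-(k j : ℤ)) (k j : ℤ), dilate mw j i t * eta P X mw j i ω :=
    ae_all_iff.2 fun j => coeFn_sum_smul _ _ _
  filter_upwards [Lp.coeFn_add (∑ i ∈ Finset.Icc (-(k0 : ℤ)) (k0 : ℤ),
      dilate fw 0 i t • xi P X fw i) (∑ j ∈ Finset.range n,
        ∑ i ∈ Finset.Icc (-(k j : ℤ)) (k j : ℤ), dilate mw j i t • eta P X mw j i),
    coeFn_sum_smul (Finset.Icc (-(k0 : ℤ)) (k0 : ℤ)) (dilate fw 0 · t) (xi P X fw),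
    Lp.coeFn_fun_finsetSum (Finset.range n) fun j => ∑ i ∈ Finset.Icc (-(k j : ℤ)) (k j : ℤ),
      dilate mw j i t • eta P X mw j i, hlevels] with ω hadd hscaling hsum hlevel
  rw [approxL2, hadd, Pi.add_apply, hscaling, hsum, approx]
  simp only [hlevel, mul_comm]

theorem measurable_approx (hfw : Continuous fw) (hmw : Continuous mw) :
    Measurable (Function.uncurry (approx P X fw mw n k0 k)) := by
  have hterm {g : ℝ → ℂ} (hg : Continuous g) (j : ℕ) (i : ℤ) (v : Lp ℂ 2 P) :
      Measurable fun q : ℝ × Ω => v q.2 * dilate g j i q.1 :=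
    ((Lp.stronglyMeasurable v).measurable.comp measurable_snd).mul
      ((continuous_dilate hg j i).measurable.comp measurable_fst)
  exact (Finset.measurable_fun_sum _ fun i _ => hterm hfw 0 i _).add
    (Finset.measurable_fun_sum _ fun j _ => Finset.measurable_fun_sum _ fun i _ => hterm hmw j i _)

theorem continuous_approx (hfw : Continuous fw) (hmw : Continuous mw) (ω : Ω) :
    Continuous fun t => approx P X fw mw n k0 k t ω :=
  (continuous_finsetSum _ fun i _ => (continuous_dilate hfw 0 i).const_mul _).add
    (continuous_finsetSum _ fun j _ => continuous_finsetSum _ fun i _ =>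
      (continuous_dilate hmw j i).const_mul _)

theorem inLp_approx (hfw : Continuous fw) (hmw : Continuous mw) (p T : ℝ) :
    InLp P (approx P X fw mw n k0 k) p T := by
  refine Eventually.of_forall fun ω => ?_
  have hcont := continuous_approx (P := P) (X := X) (n := n) (k0 := k0) (k := k) hfw hmw ω
  obtain ⟨B, hB⟩ := isCompact_Icc.exists_bound_of_continuousOn hcont.continuousOn
  exact MemLp.of_bound hcont.aestronglyMeasurable B (ae_restrict_of_forall_mem measurableSet_Icc hB)

variable [IsProbabilityMeasure P] {φ : ℝ → ℝ} {C σ : ℝ}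

theorem IsStrictlySub.coshMomentBound_ofReal (hφ : IsNFunction φ) (hX : IsStrictlySub φ P X C)
    (hX2 : ∀ t, MemLp (X t) 2 P) (hσ : ‖toL2 P (X t)‖ ≤ σ) :
    CoshMomentBound φ P (fun ω => (X t ω : ℂ)) (C * σ) :=
  (hX.coshMomentBound hφ hX2 (toL2_mem_closedSpan t) hσ).congr_ae (coeFn_toL2 (hX2 t))

theorem IsStrictlySub.coshMomentBound_approx_sub (hφ : IsNFunction φ)
    (hX : IsStrictlySub φ P X C) (hX2 : ∀ t, MemLp (X t) 2 P)
    (hσ : ‖approxL2 P X fw mw n k0 k t - toL2 P (X t)‖ ≤ σ) :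
    CoshMomentBound φ P (fun ω => approx P X fw mw n k0 k t ω - X t ω) (C * σ) :=
  (hX.coshMomentBound hφ hX2 (Submodule.sub_mem _ approxL2_mem_closedSpan (toL2_mem_closedSpan t))
    hσ).congr_ae ((Lp.coeFn_sub _ _).trans (coeFn_approxL2.sub (coeFn_toL2 (hX2 t))))

theorem IsStrictlySub.inLp (hφ : IsNFunction φ) (hX : IsStrictlySub φ P X C)
    (hX2 : ∀ t, MemLp (X t) 2 P) (hXm : Measurable (Function.uncurry X))
    (hXc : Continuous fun t => toL2 P (X t)) {p : ℝ} (hp : 0 < p) (T : ℝ) :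
    InLp P (fun t ω => (X t ω : ℂ)) p T := by
  have hXm' : Measurable (Function.uncurry fun t ω => (X t ω : ℂ)) :=
    Complex.measurable_ofReal.comp hXm
  obtain ⟨σ, hσ⟩ := (isCompact_Icc (a := (0 : ℝ)) (b := T)).exists_bound_of_continuousOn
    hXc.continuousOn
  have hbound : ∀ᵐ t ∂volume.restrict (Set.Icc 0 T),
      CoshMomentBound φ P (fun ω => (X t ω : ℂ)) (C * max σ 0) :=
    ae_restrict_of_forall_mem measurableSet_Icc fun t ht =>
      hX.coshMomentBound_ofReal hφ hX2 ((hσ t ht).trans (le_max_left σ 0))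
  filter_upwards [ae_lintegral_rpow_lt_top hφ hXm' hp
    (mul_nonneg hX.2.1.le (le_max_right σ 0)) hbound] with ω hω
  refine ⟨(hXm'.comp measurable_prodMk_right).aestronglyMeasurable, ?_⟩
  rwa [eLpNorm_lt_top_iff_lintegral_rpow_enorm_lt_top (ENNReal.ofReal_pos.2 hp).ne'
    ENNReal.ofReal_ne_top, ENNReal.toReal_ofReal hp.le]

end SecondOrder

/-! ### The constant of the exponential bound -/

theorem tsum_eq_sum_range_add_tsum_subtype (F : ℕ → ℝ≥0∞) (J : ℕ) :
    ∑' j, F j = ∑ j ∈ Finset.range J, F j + ∑' j : {j : ℕ // J ≤ j}, F j := by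
  have hcompl : ((Finset.range J : Set ℕ))ᶜ = Set.Ici J := by
    ext j
    simp
  rw [← ENNReal.sum_add_tsum_compl (Finset.range J), tsum_congr_set_coe F hcompl]
  rfl

section Convergence

variable {β : Type*} {l : Filter β}

theorem tendsto_const_mul_zero_of_le {S D : ℝ≥0∞} {w : β → ℝ≥0∞} (hfin : S * D ≠ ∞)
    (hle : ∀ᶠ i in l, w i ≤ D) (hw : Tendsto w l (𝓝 0)) :
    Tendsto (fun i => S * w i) l (𝓝 0) := by
  rcases eq_or_ne S ∞ with rfl | hS
  · have hD : D = 0 := by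
      by_contra h
      exact hfin (ENNReal.top_mul h)
    refine tendsto_const_nhds.congr' (hle.mono fun i hi => ?_)
    simp only [nonpos_iff_eq_zero.1 (hi.trans_eq hD), mul_zero]
  · simpa only [mul_zero] using ENNReal.Tendsto.const_mul hw (Or.inr hS)

theorem tendsto_tsum_zero_of_dominated [l.IsCountablyGenerated] {ι : Type*} {F : β → ι → ℝ≥0∞}
    {D : ι → ℝ≥0∞} (hD : ∑' j, D j ≠ ∞) (hle : ∀ᶠ i in l, ∀ j, F i j ≤ D j)
    (hF : ∀ j, Tendsto (fun i => F i j) l (𝓝 0)) :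
    Tendsto (fun i => ∑' j, F i j) l (𝓝 0) := by
  let _ : MeasurableSpace ι := ⊤
  have hlim := tendsto_lintegral_filter_of_dominated_convergence (μ := Measure.count)
    (f := fun _ : ι => 0) D (Eventually.of_forall fun _ => measurable_from_top)
    (hle.mono fun _ hi => Eventually.of_forall hi) (by rwa [lintegral_count])
    (Eventually.of_forall hF)
  simpa only [lintegral_count, lintegral_zero] using hlim

end Convergence

section ErrorBound

variable {Ω : Type*} [MeasurableSpace Ω] {P : Measure Ω} {X : ℝ → Ω → ℝ} {fw mw m₀ : ℝ → ℂ}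
  {Φ Φf Φm c : ℝ → ℝ} {g : ℝ → ℂ} {T : ℝ}

/-- The bound of the mean-square error of a partial wavelet expansion in which the omitted terms
of the scaling part have weight `w₀`, and those of the level `j` have weight `w j`. -/
noncomputable def errorBound (P : Measure Ω) (X : ℝ → Ω → ℝ) (fw mw : ℝ → ℂ) (w₀ : ℝ)
    (w : ℕ → ℝ) : ℝ≥0∞ :=
  supXi P X fw * ENNReal.ofReal w₀ +
    ∑' j : ℕ, supEta P X mw j * ENNReal.ofReal ((2 : ℝ) ^ ((j : ℝ) / 2) * w j)

/-- The weight of the terms of the level `j` with index outside `[-k j, k j]`: a tail below the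
level `J`, where `k` is large enough for the tail estimate, and the bound of the full sum from the
level `J` on. -/
noncomputable def levelWeight (Φ : ℝ → ℝ) (T : ℝ) (J : ℕ) (k : ℕ → ℕ) (j : ℕ) : ℝ :=
  if j < J then tailC Φ (2 ^ j * T) (k j) else constC Φ

/-- The mean-square error bound that appears, as the base of the `p`-th power, in `cInfty`. -/
noncomputable def tailErrorBound (P : Measure Ω) (X : ℝ → Ω → ℝ) (fw mw : ℝ → ℂ) (Φf Φm : ℝ → ℝ)
    (T : ℝ) (n k0 : ℕ) (k : ℕ → ℕ) : ℝ≥0∞ :=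
  errorBound P X fw mw (tailC Φf T k0) (levelWeight Φm T (levelJ T n k) k)

theorem lt_levelJ_iff {n j : ℕ} {k : ℕ → ℕ} :
    j < levelJ T n k ↔ ∀ i ≤ j, i ≠ n ∧ 2 ^ i * T + 1 ≤ k i := by
  refine ⟨fun hj i hi => ?_, fun h => ?_⟩
  · simpa only [Set.mem_ofPred_eq, not_or, not_lt] using Nat.notMem_of_lt_sInf (hi.trans_lt hj)
  · by_contra! hj
    have hmem : levelJ T n k = n ∨ (k (levelJ T n k) : ℝ) < 2 ^ levelJ T n k * T + 1 :=
      Nat.sInf_mem (s := {j : ℕ | j = n ∨ (k j : ℝ) < 2 ^ j * T + 1}) ⟨n, Or.inl rfl⟩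
    exact hmem.elim (h _ hj).1 (h _ hj).2.not_gt

theorem eventually_lt_levelJ {k : ℕ → ℕ → ℕ} (hk : ∀ j, Tendsto (fun n => k n j) atTop atTop)
    (T : ℝ) (j : ℕ) : ∀ᶠ n in atTop, j < levelJ T n (k n) := by
  simp only [lt_levelJ_iff]
  refine (Set.finite_Iic j).eventually_all.2 fun i _ => ?_
  exact ((eventually_gt_atTop i).mono fun _ => ne_of_lt).and
    ((tendsto_natCast_atTop_atTop.comp (hk i)).eventually_ge_atTop _)

theorem cInfty_eq {C p : ℝ} {n k0 : ℕ} {k : ℕ → ℕ} :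
    cInfty P X fw mw Φf Φm C p T n k0 k =
      C ^ p * T * (tailErrorBound P X fw mw Φf Φm T n k0 k).toReal ^ p := by
  have hbelow : ∑ j ∈ Finset.range (levelJ T n k), supEta P X mw j *
      ENNReal.ofReal ((2 : ℝ) ^ ((j : ℝ) / 2) * levelWeight Φm T (levelJ T n k) k j) =
      ∑ j ∈ Finset.range (levelJ T n k), supEta P X mw j *
        ENNReal.ofReal ((2 : ℝ) ^ ((j : ℝ) / 2) * tailC Φm (2 ^ j * T) (k j)) :=
    Finset.sum_congr rfl fun j hj => by rw [levelWeight, if_pos (Finset.mem_range.1 hj)]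
  have habove (j : {j : ℕ // levelJ T n k ≤ j}) :
      levelWeight Φm T (levelJ T n k) k j = constC Φm := if_neg j.2.not_gt
  simp only [cInfty, tailErrorBound, errorBound, habove, ← hbelow, ← add_assoc,
    tsum_eq_sum_range_add_tsum_subtype _ (levelJ T n k)]

theorem AssumptionS.tailC_le_constC (hS : AssumptionS g Φ) {S : ℝ} (hS0 : 0 ≤ S) {K : ℕ}
    (hK : S + 1 ≤ K) : tailC Φ S K ≤ constC Φ := by
  have hnear := hS.setIntegral_Ioi_anti (a := 0) (b := (K : ℝ) - S - 1) le_rfl (by linarith)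
  have hfar := hS.setIntegral_Ioi_anti (a := 0) (b := (K : ℝ) - 1) le_rfl (by linarith)
  have htotal := hS.setIntegral_Ioi_zero_le
  have hzero := hS.majorant_nonneg le_rfl
  have htail := hS.setIntegral_Ioi_nonneg (a := 1 / 2) (by norm_num)
  unfold tailC constC
  linarith

theorem AssumptionS.levelWeight_le_constC (hS : AssumptionS g Φ) (hT : 0 ≤ T) {n : ℕ}
    {k : ℕ → ℕ} (j : ℕ) : levelWeight Φ T (levelJ T n k) k j ≤ constC Φ := by
  unfold levelWeight
  split_ifs with hj
  · exact hS.tailC_le_constC (by positivity) (lt_levelJ_iff.1 hj j le_rfl).2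
  · exact le_rfl

theorem errorBound_mono {w₀ w₀' : ℝ} {w w' : ℕ → ℝ} (h₀ : w₀ ≤ w₀') (h : ∀ j, w j ≤ w' j) :
    errorBound P X fw mw w₀ w ≤ errorBound P X fw mw w₀' w' := by
  unfold errorBound
  gcongr with j
  exact h j

theorem tailErrorBound_ne_top (hSf : AssumptionS fw Φf) (hSm : AssumptionS mw Φm) (hT : 0 ≤ T)
    (hfin : errorBound P X fw mw (constC Φf) (fun _ => constC Φm) ≠ ∞) {n k0 : ℕ} {k : ℕ → ℕ}
    (hk0 : T + 1 ≤ k0) : tailErrorBound P X fw mw Φf Φm T n k0 k ≠ ∞ :=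
  ne_top_of_le_ne_top hfin
    (errorBound_mono (hSf.tailC_le_constC hT hk0) (hSm.levelWeight_le_constC hT))

theorem tendsto_errorBound {β : Type*} {l : Filter β} [l.IsCountablyGenerated] {D₀ D : ℝ}
    (hfin : errorBound P X fw mw D₀ (fun _ => D) ≠ ∞) {w₀ : β → ℝ} {w : β → ℕ → ℝ}
    (hle₀ : ∀ᶠ i in l, w₀ i ≤ D₀) (hle : ∀ᶠ i in l, ∀ j, w i j ≤ D)
    (hw₀ : Tendsto w₀ l (𝓝 0)) (hw : ∀ j, Tendsto (fun i => w i j) l (𝓝 0)) :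
    Tendsto (fun i => errorBound P X fw mw (w₀ i) (w i)) l (𝓝 0) := by
  unfold errorBound at hfin ⊢
  rw [ENNReal.add_ne_top] at hfin
  have hlevel {j : ℕ} {r : ℝ} (hr : r ≤ D) :
      ENNReal.ofReal ((2 : ℝ) ^ ((j : ℝ) / 2) * r) ≤
        ENNReal.ofReal ((2 : ℝ) ^ ((j : ℝ) / 2) * D) := by gcongr
  rw [← add_zero (0 : ℝ≥0∞)]
  refine (tendsto_const_mul_zero_of_le hfin.1 (hle₀.mono fun i => ENNReal.ofReal_le_ofReal) ?_).add
    (tendsto_tsum_zero_of_dominated hfin.2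
      (hle.mono fun i hi j => mul_le_mul_right (hlevel (hi j)) _) fun j =>
        tendsto_const_mul_zero_of_le (ENNReal.ne_top_of_tsum_ne_top hfin.2 j)
          (hle.mono fun i hi => hlevel (hi j)) ?_)
  · simpa only [ENNReal.ofReal_zero] using ENNReal.tendsto_ofReal hw₀
  · simpa only [mul_zero, ENNReal.ofReal_zero] using
      ENNReal.tendsto_ofReal ((hw j).const_mul ((2 : ℝ) ^ ((j : ℝ) / 2)))

theorem tendsto_tailErrorBound (hSf : AssumptionS fw Φf) (hSm : AssumptionS mw Φm) (hT : 0 ≤ T)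
    (hfin : errorBound P X fw mw (constC Φf) (fun _ => constC Φm) ≠ ∞) {k0 : ℕ → ℕ}
    {k : ℕ → ℕ → ℕ} (hk0 : Tendsto k0 atTop atTop)
    (hk : ∀ j, Tendsto (fun n => k n j) atTop atTop) :
    Tendsto (fun n => tailErrorBound P X fw mw Φf Φm T n (k0 n) (k n)) atTop (𝓝 0) := by
  refine tendsto_errorBound hfin ?_ (Eventually.of_forall fun n => hSm.levelWeight_le_constC hT)
    ((tendsto_tailC Φf T).comp hk0) fun j => ?_
  · filter_upwards [(tendsto_natCast_atTop_atTop.comp hk0).eventually_ge_atTop (T + 1)] with n hn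
    exact hSf.tailC_le_constC hT hn
  · refine ((tendsto_tailC Φm (2 ^ j * T)).comp (hk j)).congr' ?_
    filter_upwards [eventually_lt_levelJ hk T j] with n hn
    rw [levelWeight, if_pos hn, Function.comp_apply]

theorem AssumptionS.tsum_enorm_notMem_le (hS : AssumptionS g Φ) (hg : Continuous g) (x : ℝ)
    (s : Finset ℤ) :
    ∑' k : ℤ, (if k ∈ s then 0 else ‖g (x - k)‖ₑ) ≤ ENNReal.ofReal (constC Φ) :=
  (ENNReal.tsum_le_tsum fun k => by split_ifs <;> simp).trans (hS.tsum_enorm_le hg x)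

theorem IsWaveletPair.enorm_approxL2_sub_le (hW : IsWaveletPair fw mw m₀ Φf Φm)
    (hc : IsGrowthFunction c) (hcf : Integrable fun x : ℝ => c x * Φf |x|)
    (hcm : Integrable fun x : ℝ => c x * Φm |x|) (hX : Continuous fun t => toL2 P (X t))
    (hXc : ∀ t, ‖toL2 P (X t)‖ ≤ c t) {t : ℝ} (ht : t ∈ Set.Icc 0 T) {n k0 : ℕ} {k : ℕ → ℕ}
    (hk0 : T + 1 ≤ k0) :
    ‖approxL2 P X fw mw n k0 k t - toL2 P (X t)‖ₑ ≤
      tailErrorBound P X fw mw Φf Φm T n k0 k := by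
  set block : ℕ → Finset ℤ := fun j => if j < n then Finset.Icc (-(k j : ℤ)) (k j : ℤ) else ∅
    with hblock
  have hweight (j : ℕ) :
      ∑' i : ℤ, (if i ∈ block j then 0 else ‖mw (2 ^ j * t - i)‖ₑ) ≤
        ENNReal.ofReal (levelWeight Φm T (levelJ T n k) k j) := by
    unfold levelWeight
    split_ifs with hj
    · have hjn : j < n := by
        by_contra! hnj
        exact (lt_levelJ_iff.1 hj n hnj).1 rfl
      simp only [hblock, if_pos hjn]
      exact hW.majorant_mw.tsum_tail_enorm_le hW.continuous_mw (mul_nonneg (by positivity) ht.1)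
        (mul_le_mul_of_nonneg_left ht.2 (by positivity)) (lt_levelJ_iff.1 hj j le_rfl).2
    · exact hW.majorant_mw.tsum_enorm_notMem_le hW.continuous_mw _ _
  have herror := hW.enorm_expansion_error_le hc hcf hcm hX hXc t n
    (Finset.Icc (-(k0 : ℤ)) k0) block (fun j hj => if_neg hj.not_gt)
    (hW.majorant_fw.tsum_tail_enorm_le hW.continuous_fw ht.1 ht.2 hk0) hweight
  have hsum : ∑ j ∈ Finset.range n, ∑ i ∈ block j, dilate mw j i t • eta P X mw j i =
      ∑ j ∈ Finset.range n, ∑ i ∈ Finset.Icc (-(k j : ℤ)) (k j : ℤ),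
        dilate mw j i t • eta P X mw j i :=
    Finset.sum_congr rfl fun j hj => by simp only [hblock, if_pos (Finset.mem_range.1 hj)]
  simp only [tailErrorBound, errorBound, approxL2, supXi, supEta, ← Lp.enorm_def, ← hsum,
    ENNReal.ofReal_mul (Real.rpow_nonneg two_pos.le _)]
  exact herror

end ErrorBound

/-! ### Convergence in `L_p([0, T])` -/

section LpError

variable {Ω : Type*} [MeasurableSpace Ω] {P : Measure Ω} {X : ℝ → Ω → ℝ} {fw mw : ℝ → ℂ}

theorem measurable_approx_sub (hXm : Measurable (Function.uncurry X)) (hfw : Continuous fw)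
    (hmw : Continuous mw) {n k0 : ℕ} {k : ℕ → ℕ} :
    Measurable (Function.uncurry fun t ω => approx P X fw mw n k0 k t ω - (X t ω : ℂ)) :=
  (measurable_approx hfw hmw).sub (Complex.measurable_ofReal.comp hXm)

variable [IsProbabilityMeasure P] {φ f : ℝ → ℝ} {C p T ε : ℝ}

theorem IsStrictlySub.ae_coshMomentBound_approx_sub (hφ : IsNFunction φ)
    (hX : IsStrictlySub φ P X C) (hX2 : ∀ t, MemLp (X t) 2 P) {n k0 : ℕ} {k : ℕ → ℕ} {B : ℝ≥0∞}
    (hB : B ≠ ∞)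
    (herr : ∀ t ∈ Set.Icc 0 T, ‖approxL2 P X fw mw n k0 k t - toL2 P (X t)‖ₑ ≤ B) :
    ∀ᵐ t ∂volume.restrict (Set.Icc 0 T),
      CoshMomentBound φ P (fun ω => approx P X fw mw n k0 k t ω - X t ω) (C * B.toReal) :=
  ae_restrict_of_forall_mem measurableSet_Icc fun t ht =>
    hX.coshMomentBound_approx_sub hφ hX2 <| by
      simpa only [toReal_enorm] using ENNReal.toReal_mono hB (herr t ht)

theorem IsStrictlySub.tendsto_measure_lt_lpError (hφ : IsNFunction φ) (hX : IsStrictlySub φ P X C)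
    (hX2 : ∀ t, MemLp (X t) 2 P) (hXm : Measurable (Function.uncurry X)) (hfw : Continuous fw)
    (hmw : Continuous mw) (hp : 0 < p) {β : Type*} {l : Filter β} {n k0 : β → ℕ} {k : β → ℕ → ℕ}
    {B : β → ℝ≥0∞} (hB : Tendsto B l (𝓝 0))
    (herr : ∀ᶠ i in l, ∀ t ∈ Set.Icc 0 T,
      ‖approxL2 P X fw mw (n i) (k0 i) (k i) t - toL2 P (X t)‖ₑ ≤ B i) (hε : 0 < ε) :
    Tendsto (fun i => P {ω | ENNReal.ofReal ε <
      lpError P X fw mw p T (n i) (k0 i) (k i) ω ^ (1 / p)}) l (𝓝 0) := by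
  have hτ : Tendsto (fun i => C * (B i).toReal) l (𝓝 0) := by
    simpa only [Function.comp_apply, ENNReal.toReal_zero, mul_zero] using
      ((ENNReal.tendsto_toReal ENNReal.zero_ne_top).comp hB).const_mul C
  simp only [one_div, ENNReal.lt_rpow_inv_iff hp, ENNReal.ofReal_rpow_of_pos hε]
  refine tendsto_measure_lt_lintegral_rpow hφ (fun i => measurable_approx_sub hXm hfw hmw) hp
    (fun i => mul_nonneg hX.2.1.le ENNReal.toReal_nonneg) hτ ?_ (Real.rpow_pos_of_pos hε p)
  filter_upwards [herr, hB.eventually_lt_const ENNReal.zero_lt_top] with i hi hBi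
  exact hX.ae_coshMomentBound_approx_sub hφ hX2 hBi.ne hi

theorem IsStrictlySub.measure_lt_lpError_eq_zero (hφ : IsNFunction φ) (hX : IsStrictlySub φ P X C)
    (hX2 : ∀ t, MemLp (X t) 2 P) (hXm : Measurable (Function.uncurry X)) (hfw : Continuous fw)
    (hmw : Continuous mw) (hp : 0 < p) {n k0 : ℕ} {k : ℕ → ℕ}
    (herr : ∀ t ∈ Set.Icc 0 T, ‖approxL2 P X fw mw n k0 k t - toL2 P (X t)‖ₑ ≤ 0) (hε : 0 < ε) :
    P {ω | ENNReal.ofReal ε < lpError P X fw mw p T n k0 k ω} = 0 :=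
  measure_lt_lintegral_rpow_eq_zero hφ (measurable_approx_sub hXm hfw hmw) hp
    (by simpa only [ENNReal.toReal_zero, mul_zero] using
      hX.ae_coshMomentBound_approx_sub hφ hX2 ENNReal.zero_ne_top herr) hε

theorem IsStrictlySub.measure_lt_lpError_le (hφ : IsNFunction φ) (hf : IsDensity φ f)
    (hX : IsStrictlySub φ P X C) (hX2 : ∀ t, MemLp (X t) 2 P)
    (hXm : Measurable (Function.uncurry X)) (hfw : Continuous fw) (hmw : Continuous mw)
    (hp : 0 < p) (hT : 0 < T) {n k0 : ℕ} {k : ℕ → ℕ} {B : ℝ≥0∞} (hB : B ≠ ∞) (hB0 : B ≠ 0)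
    (herr : ∀ t ∈ Set.Icc 0 T, ‖approxL2 P X fw mw n k0 k t - toL2 P (X t)‖ₑ ≤ B) {κ : ℝ}
    (hκ : κ = C ^ p * T * B.toReal ^ p) (hε : 0 < ε)
    (hεf : κ * f (p * (κ / ε) ^ (1 / p)) ^ p < ε) :
    P {ω | ENNReal.ofReal ε < lpError P X fw mw p T n k0 k ω} ≤
      ENNReal.ofReal (2 * Real.exp (-youngFenchel φ ((ε / κ) ^ (1 / p)))) := by
  have hvolume : (volume.restrict (Set.Icc 0 T)).real Set.univ = T := by
    rw [measureReal_restrict_apply_univ, Real.volume_real_Icc_of_le hT.le, sub_zero]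
  refine measure_lt_lintegral_rpow_le_exp_neg_youngFenchel_rpow hφ hf
    (measurable_approx_sub hXm hfw hmw) hp (mul_pos hX.2.1 (ENNReal.toReal_pos hB0 hB))
    (hX.ae_coshMomentBound_approx_sub hφ hX2 hB herr) (hT.trans_eq hvolume.symm) ?_ hε hεf
  rw [hκ, hvolume, Real.mul_rpow hX.2.1.le ENNReal.toReal_nonneg, mul_right_comm]

theorem IsStrictlySub.measure_lt_lpError_le_and_eq_zero (hφ : IsNFunction φ) (hf : IsDensity φ f)
    (hX : IsStrictlySub φ P X C) (hX2 : ∀ t, MemLp (X t) 2 P)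
    (hXm : Measurable (Function.uncurry X)) (hfw : Continuous fw) (hmw : Continuous mw)
    (hp : 0 < p) (hT : 0 < T) {n k0 : ℕ} {k : ℕ → ℕ} {B : ℝ≥0∞} (hB : B ≠ ∞)
    (herr : ∀ t ∈ Set.Icc 0 T, ‖approxL2 P X fw mw n k0 k t - toL2 P (X t)‖ₑ ≤ B) {κ : ℝ}
    (hκ : κ = C ^ p * T * B.toReal ^ p) (hε : 0 < ε)
    (hεf : κ * f (p * (κ / ε) ^ (1 / p)) ^ p < ε) :
    (0 < κ → P {ω | ENNReal.ofReal ε < lpError P X fw mw p T n k0 k ω} ≤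
      ENNReal.ofReal (2 * Real.exp (-youngFenchel φ ((ε / κ) ^ (1 / p))))) ∧
    (κ = 0 → P {ω | ENNReal.ofReal ε < lpError P X fw mw p T n k0 k ω} = 0) := by
  have hκ0 : κ = 0 ↔ B = 0 := by
    simp [hκ, hT.ne', (Real.rpow_pos_of_pos hX.2.1 p).ne', hB, hp.ne', ENNReal.toReal_eq_zero_iff]
  refine ⟨fun hpos => hX.measure_lt_lpError_le hφ hf hX2 hXm hfw hmw hp hT hB
    (hκ0.not.1 hpos.ne') herr hκ hε hεf, fun hzero => ?_⟩
  exact hX.measure_lt_lpError_eq_zero hφ hX2 hXm hfw hmw hp (hκ0.1 hzero ▸ herr) hε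

end LpError

end SubGaussWavelet

open SubGaussWavelet in
theorem mainTheorem2_general
    {Ω : Type*} [MeasurableSpace Ω] {P : Measure Ω} [IsProbabilityMeasure P]
    {φ f : ℝ → ℝ} (hφ : IsNFunction φ) (hf : IsDensity φ f)
    {X : ℝ → Ω → ℝ} (hXmeas : Measurable (Function.uncurry X))
    {CX : ℝ} (hX : IsStrictlySub φ P X CX) (hX2 : ∀ t, MemLp (X t) 2 P)
    (hR : Continuous fun q : ℝ × ℝ => cov P X q.1 q.2)
    {fw mw m₀ : ℝ → ℂ} {Φf Φm : ℝ → ℝ} (hW : IsWaveletPair fw mw m₀ Φf Φm)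
    {c : ℝ → ℝ} (hc : IsGrowthFunction c)
    (hcΦf : Integrable fun x : ℝ => c x * Φf |x|) (hcΦm : Integrable fun x : ℝ => c x * Φm |x|)
    (hRc : ∀ t, √|cov P X t t| ≤ c t) {T : ℝ} (hT : 0 < T) {p : ℝ} (hp : 0 < p)
    (hsum : errorBound P X fw mw (constC Φf) (fun _ => constC Φm) < ∞) :
    InLp P (fun t ω => (X t ω : ℂ)) p T ∧
    (∀ (n k0 : ℕ) (k : ℕ → ℕ), InLp P (approx P X fw mw n k0 k) p T) ∧
    (∀ (k0 : ℕ → ℕ) (k : ℕ → ℕ → ℕ), Tendsto k0 atTop atTop →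
      (∀ j, Tendsto (fun n => k n j) atTop atTop) →
      ∀ ε : ℝ, 0 < ε →
        Tendsto (fun n => P {ω | ENNReal.ofReal ε <
          lpError P X fw mw p T n (k0 n) (k n) ω ^ (1 / p)}) atTop (𝓝 0)) ∧
    (∀ (n k0 : ℕ) (k : ℕ → ℕ), T + 1 ≤ (k0 : ℝ) →
      ∀ cn : ℝ, cn = cInfty P X fw mw Φf Φm CX p T n k0 k →
      ∀ ε : ℝ, 0 < ε → cn * f (p * (cn / ε) ^ (1 / p)) ^ p < ε →
        (0 < cn → P {ω | ENNReal.ofReal ε < lpError P X fw mw p T n k0 k ω} ≤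
          ENNReal.ofReal (2 * Real.exp (-youngFenchel φ ((ε / cn) ^ (1 / p))))) ∧
        (cn = 0 → P {ω | ENNReal.ofReal ε < lpError P X fw mw p T n k0 k ω} = 0)) := by
  have hcont : Continuous fun t => toL2 P (X t) := continuous_toL2 hX2 hR
  have herror {n k0 : ℕ} {k : ℕ → ℕ} (hk0 : T + 1 ≤ k0) : ∀ t ∈ Set.Icc 0 T,
      ‖approxL2 P X fw mw n k0 k t - toL2 P (X t)‖ₑ ≤ tailErrorBound P X fw mw Φf Φm T n k0 k :=
    fun t ht => hW.enorm_approxL2_sub_le hc hcΦf hcΦm hcont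
      (fun s => (norm_toL2_eq_sqrt_cov hX2 s).trans_le (hRc s)) ht hk0
  refine ⟨hX.inLp hφ hX2 hXmeas hcont hp T,
    fun n k0 k => inLp_approx hW.continuous_fw hW.continuous_mw p T,
    fun k0 k hk0 hk ε hε => ?_, fun n k0 k hk0 cn hcn ε hε hεf => ?_⟩
  · refine hX.tendsto_measure_lt_lpError hφ hX2 hXmeas hW.continuous_fw hW.continuous_mw hp
      (tendsto_tailErrorBound hW.majorant_fw hW.majorant_mw hT.le hsum.ne hk0 hk) ?_ hε
    filter_upwards [(tendsto_natCast_atTop_atTop.comp hk0).eventually_ge_atTop (T + 1)] with n hn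
    exact herror hn
  · exact hX.measure_lt_lpError_le_and_eq_zero hφ hf hX2 hXmeas hW.continuous_fw hW.continuous_mw
      hp hT (tailErrorBound_ne_top hW.majorant_fw hW.majorant_mw hT.le hsum.ne hk0) (herror hk0)
      (hcn.trans cInfty_eq) hε hεf

open SubGaussWavelet in
theorem mainTheorem2
    {Ω : Type*} [MeasurableSpace Ω] (P : Measure Ω) [IsProbabilityMeasure P]
    -- the N-function and its density
    (φ f : ℝ → ℝ) (hφ : AssumptionQ φ) (hf : IsDensity φ f)
    -- the strictly φ-sub-Gaussian process with determinative constant `CX`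
    (X : ℝ → Ω → ℝ) (hXmeas : Measurable (Function.uncurry X))
    (CX : ℝ) (hX : IsStrictlySub φ P X CX)
    (hX2 : ∀ t, MemLp (X t) 2 P)
    (hR : Continuous (fun q : ℝ × ℝ => cov P X q.1 q.2))
    -- the wavelets
    (fw mw m₀ : ℝ → ℂ) (hfw : IsFWavelet fw m₀) (hmw : IsMWavelet fw m₀ mw)
    (hfw_cont : Continuous fw) (hmw_cont : Continuous mw)
    (Φf Φm : ℝ → ℝ) (hSf : AssumptionS fw Φf) (hSm : AssumptionS mw Φm)
    -- the growth function
    (c A : ℝ → ℝ) (x₀ : ℝ)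
    (hc_even : ∀ x, c (-x) = c x) (hc_mono : MonotoneOn c (Set.Ici 0)) (hc_zero : 1 < c 0)
    (hA : ∀ a, 0 < a → 0 < A a) (hcA : ∀ a, 0 < a → ∀ x, x₀ ≤ x → c (a * x) ≤ c x * A a)
    (hcΦf : Integrable (fun x : ℝ => c x * Φf |x|)) (hcΦm : Integrable (fun x : ℝ => c x * Φm |x|))
    (hRc : ∀ t, Real.sqrt |cov P X t t| ≤ c t)
    -- the interval, the exponent, and the integrability conditions
    (T : ℝ) (hT : 0 < T) (p : ℝ) (hp : 1 ≤ p)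
    (hXp : IntegrableOn (fun t => (∫ ω, X t ω ^ 2 ∂P) ^ (p / 2)) (Set.Icc 0 T))
    (hsum : supXi P X fw * ENNReal.ofReal (constC Φf) +
      ∑' j : ℕ, supEta P X mw j * ENNReal.ofReal ((2 : ℝ) ^ ((j : ℝ) / 2) * constC Φm) < ∞) :
    -- `X` and its approximants are in `L_p([0,T])`
    InLp P (fun t ω => (X t ω : ℂ)) p T ∧
    (∀ (n k0 : ℕ) (k : ℕ → ℕ), InLp P (approx P X fw mw n k0 k) p T) ∧
    -- convergence in probability in `L_p([0,T])` as `k_n → ∞`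
    (∀ (k0 : ℕ → ℕ) (k : ℕ → ℕ → ℕ), Tendsto k0 atTop atTop →
      (∀ j, Tendsto (fun n => k n j) atTop atTop) →
      ∀ ε : ℝ, 0 < ε →
        Tendsto (fun n => P {ω | ENNReal.ofReal ε <
          lpError P X fw mw p T n (k0 n) (k n) ω ^ (1 / p)}) atTop (𝓝 0)) ∧
    -- the exponential bound, where the right-hand side is read as `0` if `c_n^∞ = 0`
    (∀ (n k0 : ℕ) (k : ℕ → ℕ), T + 1 ≤ (k0 : ℝ) →
      ∀ cn : ℝ, cn = cInfty P X fw mw Φf Φm CX p T n k0 k →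
      ∀ ε : ℝ, 0 < ε → cn * f (p * (cn / ε) ^ (1 / p)) ^ p < ε →
        (0 < cn → P {ω | ENNReal.ofReal ε < lpError P X fw mw p T n k0 k ω} ≤
          ENNReal.ofReal (2 * Real.exp (-youngFenchel φ ((ε / cn) ^ (1 / p))))) ∧
        (cn = 0 → P {ω | ENNReal.ofReal ε < lpError P X fw mw p T n k0 k ω} = 0)) :=
  mainTheorem2_general hφ.1 hf hXmeas hX hX2 hR ⟨hfw, hmw, hfw_cont, hmw_cont, hSf, hSm⟩
    (.of_comp_two_mul_le hc_even hc_mono (one_pos.trans hc_zero).le (hcA 2 two_pos)) hcΦf hcΦm hRc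
    hT (one_pos.trans_le hp) hsum
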